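/- Let $n\ge 2$, $\Lambda\ge 1$, $\mathbf p=(p_1,\dots,p_n)$ with $p_i>1$, and let $\overline p=\big(\frac1n\sum_{i=1}^n\frac1{p_i}\big)^{-1}$, $P=\max\{2,p_1,\dots,p_n\}$. Let $\Omega\subset\mathbb R^n$ be a bounded domain, $T>0$, $\Omega_T=\Omega\times(0,T)$, $\delta_1,\dots,\delta_n\ge 0$, $\Gamma=\sum_{i=1}^n\delta_i^{p_i}$, and let $a_i:\Omega_T\to\mathbb R$ be measurable with $\Lambda^{-1}\le a_i\le\Lambda$ a.e. in $\Omega_T$. Consider the equation $$\partial_t u=\sum_{i=1}^n\partial_{x_i}\Big[a_i(x,t)\,(|\partial_{x_i}u|-\delta_i)_+^{p_i-1}\frac{\partial_{x_i}u}{|\partial_{x_i}u|}\Big]\quad\text{in }\Omega_T. \qquad (*)$$ A local weak supersolution (resp. subsolution) of $(*)$ is a function $u\in L^P_{loc}(\Omega_T)\cap L^1_{loc}(0,T;W^{1,1}_{loc}(\Omega))$ with $\partial_{x_i}u\in L^{p_i}_{loc}(\Omega_T)$ for all $i$, such that $$\iint_{\Omega_T}\Big(u\,\partial_t\varphi-\sum_{i=1}^n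 a_i\,(|\partial_{x_i}u|-\delta_i)_+^{p_i-1}\frac{\partial_{x_i}u}{|\partial_{x_i}u|}\,\partial_{x_i}\varphi\Big)\,dx\,dt\ \le 0\quad(\text{resp. }\ge 0)$$ for all $\varphi\in C_0^\infty(\Omega_T)$ with $\varphi\ge0$. For $M,\rho>0$ put $$\mathcal Q^-_\rho(M)=\prod_{i=1}^n\Big\{|x_i|<M^{\frac{p_i-2}{p_i}}\rho^{\frac{\overline p}{p_i}}\Big\}\times(-\rho^{\overline p},0].$$ **Lemma (De Giorgi-type / Critical Mass Lemma).** Let $a\in(0,1)$. (1) There is $\nu^-\in(0,1)$, depending only on $n,\Lambda,\mathbf p,a$, such that the following holds. Let $u$ be a local weak supersolution of $(*)$ that is locally essentially bounded from below in $\Omega_T$, let $M,\rho>0$ and $(y,s)$ be such that the closure of $(y,s)+\mathcal Q^-_{2\rho}(M)$ is contained in $\Omega_T$, and let $\mu^-\in\mathbb R$ satisfy $u\ge\mu^-$ a.e. in $(y,s)+\mathcal Q^-_{2\rho}(M)$. If $M^2>\Gamma\rho^{\overline p}$ and $$\big|\{u\le\mu^-+M\}\cap[(y,s)+\mathcal Q^-_{2\rho}(M)]\big|\le\nu^-\,|\mathcal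 Q^-_{2\rho}(M)|,$$ then $u\ge\mu^-+aM$ a.e. in $(y,s)+\mathcal Q^-_\rho(M)$. (2) There is $\nu^+\in(0,1)$, depending only on $n,\Lambda,\mathbf p,a$, such that the following holds. Let $u$ be a local weak subsolution of $(*)$ that is locally essentially bounded from above in $\Omega_T$, let $M,\rho>0$ and $(y,s)$ be such that the closure of $(y,s)+\mathcal Q^-_{2\rho}(M)$ is contained in $\Omega_T$, and let $\mu^+\in\mathbb R$ satisfy $u\le\mu^+$ a.e. in $(y,s)+\mathcal Q^-_{2\rho}(M)$. If $M^2>\Gamma\rho^{\overline p}$ and $$\big|\{u\ge\mu^+-M\}\cap[(y,s)+\mathcal Q^-_{2\rho}(M)]\big|\le\nu^+\,|\mathcal Q^-_{2\rho}(M)|,$$ then $u\le\mu^+-aM$ a.e. in $(y,s)+\mathcal Q^-_\rho(M)$. -/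

import Mathlib

open MeasureTheory Set
open scoped ContDiff

noncomputable section

namespace CritMass

/-- Points `(x, t)` of space-time `ℝⁿ × ℝ`. (No norm of `ℝⁿ` enters below; topology, smooth
functions, bounded sets and Lebesgue measure are those of `ℝⁿ`.) -/
abbrev SpaceTime (n : ℕ) : Type := (Fin n → ℝ) × ℝ

/-- The parabolic cylinder `Ω_T = Ω × (0, T)`. -/
def parCyl {n : ℕ} (Ω : Set (Fin n → ℝ)) (T : ℝ) : Set (SpaceTime n) := Ω ×ˢ Ioo 0 T

/-- `f ∈ L^q_loc(U)` : `f ∈ L^q(K)` for every compact `K ⊆ U`. -/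
def MemLpLoc {X : Type*} [TopologicalSpace X] [MeasureSpace X]
    (f : X → ℝ) (q : ℝ) (U : Set X) : Prop :=
  ∀ K : Set X, IsCompact K → K ⊆ U → MemLp f (ENNReal.ofReal q) (volume.restrict K)

/-- Test functions `φ ∈ C_0^∞(U)`. -/
structure IsTestFunction {E : Type*} [NormedAddCommGroup E] [NormedSpace ℝ E]
    (φ : E → ℝ) (U : Set E) : Prop where
  smooth : ContDiff ℝ ∞ φ
  compact : HasCompactSupport φ
  support : tsupport φ ⊆ U

/-- `w` is the weak partial derivative `∂_{x_i} v` in `Ω`, both functions being in `L¹_loc(Ω)`. -/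
def HasWeakPartial {n : ℕ} (i : Fin n) (v w : (Fin n → ℝ) → ℝ) (Ω : Set (Fin n → ℝ)) : Prop :=
  MemLpLoc v 1 Ω ∧ MemLpLoc w 1 Ω ∧
    ∀ φ : (Fin n → ℝ) → ℝ, IsTestFunction φ Ω →
      ∫ x in Ω, v x * fderiv ℝ φ x (Pi.single i 1) = - ∫ x in Ω, w x * φ x

/-- `u ∈ L^𝐩_loc(0, T; W^{1,𝐩}_loc(Ω))` with spatial weak gradient `Du = (Du 0, …, Du (n-1))`:
`u` and `∂_{x_i} u` are in `L¹_loc(Ω_T)`, at almost every time `t` the slice `Du i (·, t)` is the weak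
derivative of `u(·, t)`, and `∂_{x_i} u ∈ L^{p_i}_loc(Ω_T)`. -/
structure IsSpatialGradient {n : ℕ} (p : Fin n → ℝ) (Ω : Set (Fin n → ℝ)) (T : ℝ)
    (u : SpaceTime n → ℝ) (Du : Fin n → SpaceTime n → ℝ) : Prop where
  memL1 : MemLpLoc u 1 (parCyl Ω T)
  grad_memL1 : ∀ i, MemLpLoc (Du i) 1 (parCyl Ω T)
  weak : ∀ᵐ t ∂(volume.restrict (Ioo 0 T)), ∀ i,
    HasWeakPartial i (fun x => u (x, t)) (fun x => Du i (x, t)) Ω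
  grad_memLp : ∀ i, MemLpLoc (Du i) (p i) (parCyl Ω T)

/-- `P = max {2, p_1, …, p_n}`. -/
def bigP {n : ℕ} (p : Fin n → ℝ) : ℝ := max 2 (⨆ i, p i)

/-- The harmonic average `p̄ = ((1/n) ∑ 1/p_i)⁻¹`. -/
def pbar {n : ℕ} (p : Fin n → ℝ) : ℝ := ((1 / (n : ℝ)) * ∑ i, 1 / p i)⁻¹

/-- The scalar flux `(|r| - δ)_+^{p-1} r / |r|`, equal to `0` at `r = 0`; it is the derivative of
`r ↦ (|r| - δ)_+^p / p`. -/
def flux (p δ r : ℝ) : ℝ := (max (|r| - δ) 0) ^ (p - 1) * (r / |r|)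

/-- The weak form `∬_{Ω_T} (u ∂_tφ - ∑_i a_i (|∂_i u| - δ_i)_+^{p_i-1} (∂_i u/|∂_i u|) ∂_iφ)`. -/
def weakForm {n : ℕ} (p δ : Fin n → ℝ) (A : Fin n → SpaceTime n → ℝ)
    (Ω : Set (Fin n → ℝ)) (T : ℝ) (u : SpaceTime n → ℝ) (Du : Fin n → SpaceTime n → ℝ)
    (φ : SpaceTime n → ℝ) : ℝ :=
  ∫ z in parCyl Ω T, (u z * fderiv ℝ φ z (0, 1)
    - ∑ i, A i z * flux (p i) (δ i) (Du i z) * fderiv ℝ φ z (Pi.single i 1, 0))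

/-- Local weak supersolutions of
`∂_t u = ∑_i ∂_i [a_i (|∂_i u| - δ_i)_+^{p_i-1} ∂_i u/|∂_i u|]` in `Ω_T`. -/
def IsSupersolution {n : ℕ} (p δ : Fin n → ℝ) (A : Fin n → SpaceTime n → ℝ)
    (Ω : Set (Fin n → ℝ)) (T : ℝ) (u : SpaceTime n → ℝ) : Prop :=
  MemLpLoc u (bigP p) (parCyl Ω T) ∧
    ∃ Du : Fin n → SpaceTime n → ℝ, IsSpatialGradient p Ω T u Du ∧
      ∀ φ : SpaceTime n → ℝ, IsTestFunction φ (parCyl Ω T) → (∀ z, 0 ≤ φ z) →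
        weakForm p δ A Ω T u Du φ ≤ 0

/-- Local weak subsolutions of the same equation. -/
def IsSubsolution {n : ℕ} (p δ : Fin n → ℝ) (A : Fin n → SpaceTime n → ℝ)
    (Ω : Set (Fin n → ℝ)) (T : ℝ) (u : SpaceTime n → ℝ) : Prop :=
  MemLpLoc u (bigP p) (parCyl Ω T) ∧
    ∃ Du : Fin n → SpaceTime n → ℝ, IsSpatialGradient p Ω T u Du ∧
      ∀ φ : SpaceTime n → ℝ, IsTestFunction φ (parCyl Ω T) → (∀ z, 0 ≤ φ z) →
        0 ≤ weakForm p δ A Ω T u Du φ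

/-- Measurable coefficients with `Λ⁻¹ ≤ a_i ≤ Λ` a.e. in `Ω_T`. -/
def CoeffBounds {n : ℕ} (Λ : ℝ) (A : Fin n → SpaceTime n → ℝ)
    (Ω : Set (Fin n → ℝ)) (T : ℝ) : Prop :=
  ∀ i, AEMeasurable (A i) (volume.restrict (parCyl Ω T)) ∧
    ∀ᵐ z ∂(volume.restrict (parCyl Ω T)), Λ⁻¹ ≤ A i z ∧ A i z ≤ Λ

/-- Locally (essentially) bounded from below. -/
def LocBddBelow {n : ℕ} (u : SpaceTime n → ℝ) (U : Set (SpaceTime n)) : Prop :=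
  ∀ K : Set (SpaceTime n), IsCompact K → K ⊆ U → ∃ c : ℝ, ∀ᵐ z ∂(volume.restrict K), c ≤ u z

/-- Locally (essentially) bounded from above. -/
def LocBddAbove {n : ℕ} (u : SpaceTime n → ℝ) (U : Set (SpaceTime n)) : Prop :=
  ∀ K : Set (SpaceTime n), IsCompact K → K ⊆ U → ∃ c : ℝ, ∀ᵐ z ∂(volume.restrict K), u z ≤ c

/-- The intrinsic cube `y + 𝒦_ρ(M) = ∏_i {|x_i - y_i| < M^{(p_i-2)/p_i} ρ^{p̄/p_i}}`. -/
def cube {n : ℕ} (p : Fin n → ℝ) (M ρ : ℝ) (y : Fin n → ℝ) : Set (Fin n → ℝ) :=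
  {x | ∀ i, |x i - y i| < M ^ ((p i - 2) / p i) * ρ ^ (pbar p / p i)}

/-- The backward intrinsic cylinder `(y,s) + 𝒬⁻_ρ(M) = [y + 𝒦_ρ(M)] × (s - ρ^{p̄}, s]`. -/
def cyl {n : ℕ} (p : Fin n → ℝ) (M ρ : ℝ) (y : Fin n → ℝ) (s : ℝ) : Set (SpaceTime n) :=
  cube p M ρ y ×ˢ Ioc (s - ρ ^ pbar p) s

/-- `Γ = ∑_i δ_i^{p_i}`. -/
def Gam {n : ℕ} (p δ : Fin n → ℝ) : ℝ := ∑ i, δ i ^ p i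

end CritMass

end

open CritMass

/-! The proof is a De Giorgi iteration in cylinders adapted to the equation. Let `L i` be the half
sides of the intrinsic cube and `τ = ρ ^ pbar p`. The intrinsic exponents are those for which `(M /
L i) ^ p i = M ^ 2 / τ` in every direction. Hence, after Young's inequality, each spatial cut-off
term costs a multiple of `M ^ 3 / τ`, exactly like the time cut-off term. The condition `M ^ 2 > Γ ρ
^ p̄` gives `δ i ≤ M / L i`, so the range `|∂_i u| ≤ δ i`, where the equation controls nothing,
costs no more than the rest. All constants are thus independent of `M`, `ρ` and `δ`.

The energy estimate tests with `3 (k - u)_+² ζ`, which is the time derivative of `(k - u)_+³ ζ` up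
to sign and cut-off terms; both powers are C¹ functions of `u`, so the truncation needs no
smoothing. Since `u` has no time derivative, `u`, its gradient and its flux are mollified separately
in space-time. The equation is linear in these three once the flux counts as an independent
function, so the mollified triple is a classical supersolution
(`WeakSupersolution.exists_smoothApproximation`). The nonlinear relation between flux and gradient
is used only after the limit. The product of flux and gradient passes to the limit by dominated
convergence with an `L¹`-convergent sequence of dominating functions.

Integrability is gained from the `L¹` Sobolev inequality on time slices, with weights `L i`,
interpolated by Hölder with the mass of the slice. That mass is bounded, uniformly in time, by the
integral of the positive part of the energy density; being one integral, this bound survives the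
limit (`SmoothApproximation.energy_inequalities`). The weighted `L¹` norms of the gradient are
controlled by the coercive part of the energy, so no Sobolev inequality with mixed exponents is
needed.

Together these facts bound the normalized measure `Y (j + 1)` of a level set by `K b ^ j Y j ^ (1 +
1 / n)` (`measure_decay_step`), which forces `Y` to zero when `Y 0` is small
(`exists_critical_mass`). This is done below times `t₁ < s`, where the final decay of the cut-off is
invisible, and then `t₁` tends to `s` (`critical_mass_supersolution`). The flux is odd in the
gradient, so subsolutions follow by changing sign. -/

namespace CritMass
open Filter Topology

/-! ### Generalized dominated convergence -/

/-- Dominated convergence with a convergent sequence of dominating functions. -/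
theorem tendsto_integral_of_tendsto_dominating {α : Type*} [MeasurableSpace α] {μ : Measure α}
    {f : ℕ → α → ℝ} {f₀ : α → ℝ} {D : ℕ → α → ℝ} {D₀ : α → ℝ}
    (hf : ∀ᶠ m in atTop, AEStronglyMeasurable (f m) μ) (hf₀ : AEStronglyMeasurable f₀ μ)
    (hD : ∀ m, Integrable (D m) μ) (hD₀ : Integrable D₀ μ)
    (hfD : ∀ᶠ m in atTop, ∀ᵐ x ∂μ, |f m x| ≤ D m x)
    (hlim : ∀ᵐ x ∂μ, Tendsto (fun m => f m x) atTop (𝓝 (f₀ x)))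
    (hDlim : ∀ᵐ x ∂μ, Tendsto (fun m => D m x) atTop (𝓝 (D₀ x)))
    (hDint : Tendsto (fun m => ∫ x, D m x ∂μ) atTop (𝓝 (∫ x, D₀ x ∂μ))) :
    Tendsto (fun m => ∫ x, f m x ∂μ) atTop (𝓝 (∫ x, f₀ x ∂μ)) := by
  have hfD₀ : ∀ᵐ x ∂μ, |f₀ x| ≤ D₀ x := by
    obtain ⟨N, hN⟩ := eventually_atTop.1 hfD
    have h1 : ∀ᵐ x ∂μ, ∀ m, N ≤ m → |f m x| ≤ D m x := by
      rw [ae_all_iff]; intro m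
      by_cases hm : N ≤ m
      · filter_upwards [hN m hm] with x hx _ using hx
      · exact Eventually.of_forall fun x h => absurd h hm
    filter_upwards [h1, hlim, hDlim] with x hx h2 h3
    exact le_of_tendsto_of_tendsto h2.abs h3 (eventually_atTop.2 ⟨N, hx⟩)
  have hf₀i : Integrable f₀ μ := hD₀.mono' hf₀ hfD₀
  -- the excess `(D - D_m)_+` tends to zero in `L¹`
  have hA : Tendsto (fun m => ∫ x, max (D₀ x - max (D m x) 0) 0 ∂μ) atTop (𝓝 0) := by
    have : Tendsto (fun m => ∫ x, max (D₀ x - max (D m x) 0) 0 ∂μ) atTop (𝓝 (∫ _, (0:ℝ) ∂μ)) := by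
      -- The functions `D m` need not be nonnegative for the first few `m`; cutting them off at zero
      -- keeps the integrand below `|D₀|` for every `m`.
      refine tendsto_integral_of_dominated_convergence (fun x => |D₀ x|) ?_ hD₀.abs ?_ ?_
      · intro m
        exact ((hD₀.aestronglyMeasurable.sub
          ((hD m).aestronglyMeasurable.sup aestronglyMeasurable_const)).sup
            aestronglyMeasurable_const)
      · intro m
        filter_upwards with x
        rw [Real.norm_eq_abs, abs_of_nonneg (le_max_right _ _)]
        refine max_le ?_ (abs_nonneg _)
        have := le_abs_self (D₀ x)
        have := le_max_right (D m x) 0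
        linarith
      · filter_upwards [hDlim, hfD₀] with x hx h0
        have : Tendsto (fun m => max (D₀ x - max (D m x) 0) 0) atTop
            (𝓝 (max (D₀ x - max (D₀ x) 0) 0)) :=
          (tendsto_const_nhds.sub (hx.max tendsto_const_nhds)).max tendsto_const_nhds
        simpa [max_eq_left ((abs_nonneg _).trans h0)] using this
    simpa using this
  have hB : Tendsto (fun m => ∫ x, |f m x - f₀ x| ∂μ) atTop (𝓝 0) := by
    -- `|f_m - f₀| ≤ |clip(f_m) - f₀| + (D_m - D₀) + (D₀ - D_m)_+`
    have hc : Tendsto (fun m => ∫ x, |max (min (f m x) (D₀ x)) (-D₀ x) - f₀ x| ∂μ) atTop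
        (𝓝 (∫ _, (0:ℝ) ∂μ)) := by
      refine tendsto_integral_filter_of_dominated_convergence (fun x => 2 * |D₀ x|) ?_ ?_
        (hD₀.abs.const_mul 2) ?_
      · filter_upwards [hf] with m hm
        exact ((((hm.inf hD₀.aestronglyMeasurable).sup
          hD₀.aestronglyMeasurable.neg).sub hf₀)).norm
      · filter_upwards with m
        filter_upwards [hfD₀] with x hx
        rw [Real.norm_eq_abs, abs_abs]
        have h0 : 0 ≤ D₀ x := (abs_nonneg _).trans hx
        rw [abs_of_nonneg h0]
        obtain ⟨h1, h2⟩ := abs_le.1 hx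
        rw [abs_le]
        have h3 : -D₀ x ≤ max (min (f m x) (D₀ x)) (-D₀ x) := le_max_right _ _
        have h4 : max (min (f m x) (D₀ x)) (-D₀ x) ≤ D₀ x :=
          max_le (min_le_right _ _) (by linarith)
        constructor <;> linarith
      · filter_upwards [hlim, hfD₀] with x hx h0
        obtain ⟨h1, h2⟩ := abs_le.1 h0
        have : Tendsto (fun m => |max (min (f m x) (D₀ x)) (-D₀ x) - f₀ x|) atTop
            (𝓝 (|max (min (f₀ x) (D₀ x)) (-D₀ x) - f₀ x|)) :=
          (((hx.min tendsto_const_nhds).max tendsto_const_nhds).sub tendsto_const_nhds).abs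
        simpa [min_eq_left h2, max_eq_left h1] using this
    have hs : Tendsto (fun m => (∫ x, |max (min (f m x) (D₀ x)) (-D₀ x) - f₀ x| ∂μ)
        + ((∫ x, D m x ∂μ) - ∫ x, D₀ x ∂μ) + ∫ x, max (D₀ x - max (D m x) 0) 0 ∂μ) atTop
        (𝓝 ((∫ _, (0:ℝ) ∂μ) + ((∫ x, D₀ x ∂μ) - ∫ x, D₀ x ∂μ) + 0)) :=
      (hc.add (hDint.sub tendsto_const_nhds)).add hA
    simp only [integral_zero, sub_self, add_zero] at hs
    refine tendsto_of_tendsto_of_tendsto_of_le_of_le' tendsto_const_nhds hs ?_ ?_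
    · exact Eventually.of_forall fun m => integral_nonneg fun x => abs_nonneg _
    · filter_upwards [hf, hfD] with m hm hmD
      have hfi : Integrable (f m) μ := (hD m).mono' hm hmD
      have i1 : Integrable (fun x => |max (min (f m x) (D₀ x)) (-D₀ x) - f₀ x|) μ :=
        (((hfi.inf hD₀).sup hD₀.neg).sub hf₀i).abs
      have i2 : Integrable (fun x => D m x - D₀ x) μ := (hD m).sub hD₀
      have i3 : Integrable (fun x => max (D₀ x - max (D m x) 0) 0) μ :=
        ((hD₀.sub (hD m).pos_part).pos_part)
      have i12 : Integrable (fun x => |max (min (f m x) (D₀ x)) (-D₀ x) - f₀ x|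
        + (D m x - D₀ x)) μ := i1.add i2
      rw [← integral_sub (hD m) hD₀, ← integral_add i1 i2, ← integral_add i12 i3]
      refine integral_mono_ae (hfi.sub hf₀i).abs (i12.add i3) ?_
      filter_upwards [hmD, hfD₀] with x h1 h2
      have hDm : 0 ≤ D m x := (abs_nonneg _).trans h1
      have hD0 : 0 ≤ D₀ x := (abs_nonneg _).trans h2
      simp only [max_eq_left hDm]
      obtain ⟨a1, a2⟩ := abs_le.1 h1
      obtain ⟨b1, b2⟩ := abs_le.1 h2
      have h3 := le_max_left (D₀ x - D m x) 0
      have h4 := le_max_right (D₀ x - D m x) 0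
      rcases le_total (f m x) (D₀ x) with h5 | h5
      · rw [min_eq_left h5]
        rcases le_total (f m x) (-D₀ x) with h6 | h6
        · rw [max_eq_right h6]
          have := le_abs_self (f₀ x - f m x)
          rw [abs_of_nonpos (by linarith : f m x - f₀ x ≤ 0),
            abs_of_nonpos (by linarith : -D₀ x - f₀ x ≤ 0)]
          linarith
        · rw [max_eq_left h6]; linarith
      · rw [min_eq_right h5, max_eq_left (by linarith : -D₀ x ≤ D₀ x),
          abs_of_nonneg (by linarith : 0 ≤ f m x - f₀ x),
          abs_of_nonneg (by linarith : 0 ≤ D₀ x - f₀ x)]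
        linarith
  have hfi : ∀ᶠ m in atTop, Integrable (f m) μ := by
    filter_upwards [hf, hfD] with m h1 h2 using (hD m).mono' h1 h2
  refine tendsto_iff_norm_sub_tendsto_zero.2 ?_
  refine tendsto_of_tendsto_of_tendsto_of_le_of_le' tendsto_const_nhds hB
    (Eventually.of_forall fun m => norm_nonneg _) ?_
  filter_upwards [hfi] with m hm
  rw [← integral_sub hm hf₀i]
  exact norm_integral_le_integral_norm _

/-! ### A weighted Sobolev inequality in L¹ -/

/-- Norm of a linear form on `ℝⁿ` with the maximum norm. -/
theorem norm_le_sum_abs_apply_single {n : ℕ} (φ : (Fin n → ℝ) →L[ℝ] ℝ) :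
    ‖φ‖ ≤ ∑ i, |φ (Pi.single i 1)| := by
  refine φ.opNorm_le_bound (Finset.sum_nonneg fun i _ => abs_nonneg _) fun x => ?_
  have hx : x = ∑ i, x i • (Pi.single i 1 : Fin n → ℝ) := by
    ext j; simp [Finset.sum_apply, Pi.single_apply]
  conv_lhs => rw [hx]
  rw [map_sum, Finset.sum_mul]
  refine (norm_sum_le _ _).trans (Finset.sum_le_sum fun i _ => ?_)
  rw [map_smul, norm_smul, mul_comm, Real.norm_eq_abs (φ _)]
  exact mul_le_mul_of_nonneg_left (norm_le_pi_norm x i) (abs_nonneg _)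

/-- Gagliardo–Nirenberg–Sobolev inequality in `L¹`, with anisotropic weights. -/
theorem lintegral_rpow_le_of_weights {n : ℕ} {q : ℝ} (hq : (n : ℝ).HolderConjugate q)
    {g : (Fin n → ℝ) → ℝ} (hg : ContDiff ℝ 1 g) (hgc : HasCompactSupport g)
    {L : Fin n → ℝ} (hL : ∀ i, 0 < L i) :
    ∫⁻ x, ‖g x‖ₑ ^ q ≤ ENNReal.ofReal (∏ i, L i) *
      (ENNReal.ofReal ((∏ i, L i)⁻¹) *
        ∫⁻ x, ENNReal.ofReal (∑ i, L i * |fderiv ℝ g x (Pi.single i 1)|)) ^ q := by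
  set P := ∏ i, L i with hP
  have hP0 : 0 < P := Finset.prod_pos fun i _ => hL i
  -- The unweighted inequality, whose constant is one, is applied to `g ∘ S`; the weights come from
  -- the chain rule and the powers of `∏ L i` from the Jacobian.
  set S : (Fin n → ℝ) →L[ℝ] (Fin n → ℝ) :=
    ContinuousLinearMap.pi fun i => L i • ContinuousLinearMap.proj i with hS
  have hSi : ∀ x i, S x i = L i * x i := fun x i => by simp [hS]
  have hmap : Measure.map S volume = ENNReal.ofReal P⁻¹ • (volume : Measure (Fin n → ℝ)) := by
    have hdet : LinearMap.toMatrix' (S : (Fin n → ℝ) →ₗ[ℝ] (Fin n → ℝ)) = Matrix.diagonal L := by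
      ext i j
      simp [LinearMap.toMatrix'_apply, hSi, Matrix.diagonal_apply, Pi.single_apply]
    have hd : LinearMap.det (S : (Fin n → ℝ) →ₗ[ℝ] (Fin n → ℝ)) = P := by
      rw [← LinearMap.det_toMatrix', hdet, Matrix.det_diagonal]
    have := Real.map_linearMap_volume_pi_eq_smul_volume_pi
      (f := (S : (Fin n → ℝ) →ₗ[ℝ] (Fin n → ℝ))) (by rw [hd]; exact hP0.ne')
    rw [hd, abs_of_pos (inv_pos.2 hP0)] at this
    exact this
  have hch : ∀ f : (Fin n → ℝ) → ENNReal, Measurable f →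
      ∫⁻ x, f (S x) = ENNReal.ofReal P⁻¹ * ∫⁻ x, f x := by
    intro f hf
    rw [← lintegral_map hf S.continuous.measurable, hmap, lintegral_smul_measure, smul_eq_mul]
  have hinj : IsClosedEmbedding S := by
    have hinv : ∀ x, (fun i => (L i)⁻¹ * S x i) = x := fun x => by
      ext i; rw [hSi, inv_mul_cancel_left₀ (hL i).ne']
    have : Function.LeftInverse (fun y : Fin n → ℝ => fun i => (L i)⁻¹ * y i) S := hinv
    exact this.isClosedEmbedding (by fun_prop) S.continuous
  have hgS : ContDiff ℝ 1 (g ∘ S) := hg.comp S.contDiff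
  have hgSc : HasCompactSupport (g ∘ S) := hgc.comp_isClosedEmbedding hinj
  have hq0 : 0 ≤ q := hq.symm.nonneg
  have key := lintegral_pow_le_pow_lintegral_fderiv_aux (ι := Fin n) (F := ℝ)
    (by simpa using hq) hgS hgSc
  have hmeas1 : Measurable fun x => ‖g x‖ₑ ^ q :=
    (hg.continuous.enorm.measurable).pow_const q
  have hcd : Continuous fun x => fderiv ℝ g x := hg.continuous_fderiv one_ne_zero
  have hmeas2 : Measurable fun x =>
      ENNReal.ofReal (∑ i, L i * |fderiv ℝ g x (Pi.single i 1)|) := by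
    refine (ENNReal.continuous_ofReal.comp ?_).measurable
    fun_prop
  have h1 : ∫⁻ x, ‖(g ∘ S) x‖ₑ ^ q = ENNReal.ofReal P⁻¹ * ∫⁻ x, ‖g x‖ₑ ^ q := hch _ hmeas1
  have h2 : ∫⁻ x, ‖fderiv ℝ (g ∘ S) x‖ₑ ≤ ENNReal.ofReal P⁻¹ *
      ∫⁻ x, ENNReal.ofReal (∑ i, L i * |fderiv ℝ g x (Pi.single i 1)|) := by
    rw [← hch _ hmeas2]
    refine lintegral_mono fun x => ?_
    rw [← ofReal_norm]
    refine ENNReal.ofReal_le_ofReal ?_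
    refine (norm_le_sum_abs_apply_single _).trans (le_of_eq (Finset.sum_congr rfl fun i _ => ?_))
    rw [fderiv_comp x (hg.differentiable one_ne_zero _) S.differentiableAt,
      ContinuousLinearMap.fderiv]
    have : S (Pi.single i 1) = L i • Pi.single i 1 := by
      ext j; rw [hSi]; by_cases h : j = i
      · subst h; simp
      · simp [h]
    simp [this, abs_mul, abs_of_pos (hL i)]
  rw [h1] at key
  have h3 := key.trans (ENNReal.rpow_le_rpow h2 hq0)
  have h4 := mul_le_mul_right h3 (ENNReal.ofReal P)
  rwa [← mul_assoc, ← ENNReal.ofReal_mul hP0.le, mul_inv_cancel₀ hP0.ne', ENNReal.ofReal_one,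
    one_mul] at h4

/-- Hölder with exponents `n` and its conjugate, applied to the product of `g ^ (1 / n)` and `g`,
interpolates between `L¹` and the Sobolev exponent. On time slices the first factor will be bounded
uniformly in time and the second integrated in time. -/
theorem integral_rpow_le_weighted_gradient {n : ℕ} (hn : 2 ≤ n)
    {g : (Fin n → ℝ) → ℝ} (hg : ContDiff ℝ 1 g) (hgc : HasCompactSupport g) (hg0 : ∀ x, 0 ≤ g x)
    {L : Fin n → ℝ} (hL : ∀ i, 0 < L i) :
    ∫ x, g x ^ (1 + 1 / (n : ℝ)) ≤ (∫ x, g x) ^ (1 / (n : ℝ)) *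
      ((∏ i, L i) ^ (-(1 / (n : ℝ))) * ∑ i, L i * ∫ x, |fderiv ℝ g x (Pi.single i 1)|) := by
  have hn1 : (1 : ℝ) < n := by exact_mod_cast hn
  have hn0 : (0 : ℝ) < n := by linarith
  set q : ℝ := Real.conjExponent n with hqdef
  have hq : (n : ℝ).HolderConjugate q := Real.HolderConjugate.conjExponent hn1
  have hq0 : 0 < q := hq.symm.pos
  have hqi : 1 / q = 1 - 1 / (n : ℝ) := by
    have := hq.inv_add_inv_eq_one
    rw [one_div, one_div]; linarith
  set P := ∏ i, L i with hP
  have hP0 : 0 < P := Finset.prod_pos fun i _ => hL i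
  have hgcont := hg.continuous
  have hcd : Continuous fun x => fderiv ℝ g x := hg.continuous_fderiv one_ne_zero
  set G : ℝ := ∑ i, L i * ∫ x, |fderiv ℝ g x (Pi.single i 1)| with hG
  have hG0 : 0 ≤ G := Finset.sum_nonneg fun i _ => mul_nonneg (hL i).le
    (integral_nonneg fun x => abs_nonneg _)
  have hint : ∀ i, Integrable fun x => |fderiv ℝ g x (Pi.single i 1)| := fun i => by
    have h1 : Continuous fun x => fderiv ℝ g x (Pi.single i 1) := by fun_prop
    exact (h1.integrable_of_hasCompactSupport (hgc.fderiv_apply ℝ _)).abs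
  have hGl : ∫⁻ x, ENNReal.ofReal (∑ i, L i * |fderiv ℝ g x (Pi.single i 1)|)
      = ENNReal.ofReal G := by
    rw [← ofReal_integral_eq_lintegral_ofReal
      (integrable_finsetSum _ fun i _ => (hint i).const_mul _)
      (Eventually.of_forall fun x => Finset.sum_nonneg fun i _ =>
        mul_nonneg (hL i).le (abs_nonneg _))]
    rw [integral_finsetSum _ fun i _ => (hint i).const_mul _]
    simp only [integral_const_mul, hG]
  have hgq : Integrable fun x => g x ^ q :=
    (hgcont.rpow_const fun _ => Or.inr hq0.le).integrable_of_hasCompactSupport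
      (hgc.comp_left (g := fun r : ℝ => r ^ q) (Real.zero_rpow hq0.ne'))
  have hbound : ∫ x, g x ^ q ≤ P * (P⁻¹ * G) ^ q := by
    have h := lintegral_rpow_le_of_weights hq hg hgc hL
    rw [hGl, ← ENNReal.ofReal_mul (by positivity), ENNReal.ofReal_rpow_of_nonneg (by positivity)
      hq0.le, ← ENNReal.ofReal_mul (by positivity)] at h
    have h2 : ∫⁻ x, ‖g x‖ₑ ^ q = ENNReal.ofReal (∫ x, g x ^ q) := by
      rw [ofReal_integral_eq_lintegral_ofReal hgq
        (Eventually.of_forall fun x => Real.rpow_nonneg (hg0 x) _)]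
      refine lintegral_congr fun x => ?_
      rw [Real.enorm_eq_ofReal (hg0 x), ENNReal.ofReal_rpow_of_nonneg (hg0 x) hq0.le]
    rw [h2] at h
    exact (ENNReal.ofReal_le_ofReal_iff (by positivity)).1 h
  have hroot : (∫ x, g x ^ q) ^ (1 / q) ≤ P ^ (-(1 / (n : ℝ))) * G := by
    have h0 : 0 ≤ ∫ x, g x ^ q := integral_nonneg fun x => Real.rpow_nonneg (hg0 x) _
    refine (Real.rpow_le_rpow h0 hbound (by positivity)).trans (le_of_eq ?_)
    rw [Real.mul_rpow hP0.le (by positivity), ← Real.rpow_mul (by positivity),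
      mul_one_div_cancel hq0.ne', Real.rpow_one, ← mul_assoc, ← Real.rpow_neg_one,
      ← Real.rpow_add hP0, hqi]
    congr 2; ring
  have hhold := integral_mul_le_Lp_mul_Lq_of_nonneg (μ := (volume : Measure (Fin n → ℝ))) hq
    (f := fun x => g x ^ (1 / (n : ℝ))) (g := g)
    (Eventually.of_forall fun x => Real.rpow_nonneg (hg0 x) _) (Eventually.of_forall hg0)
    ((hgcont.rpow_const fun _ => Or.inr (by positivity)).memLp_of_hasCompactSupport
      (hgc.comp_left (g := fun r : ℝ => r ^ (1 / (n : ℝ)))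
        (Real.zero_rpow (by positivity))))
    (hgcont.memLp_of_hasCompactSupport hgc)
  have e1 : ∀ x, (g x ^ (1 / (n : ℝ))) ^ (n : ℝ) = g x := fun x => by
    rw [← Real.rpow_mul (hg0 x), one_div_mul_cancel hn0.ne', Real.rpow_one]
  have e2 : ∀ x, g x ^ (1 / (n : ℝ)) * g x = g x ^ (1 + 1 / (n : ℝ)) := fun x => by
    rw [Real.rpow_one_add' (hg0 x) (by positivity), mul_comm]
  simp only [e1, e2] at hhold
  exact hhold.trans (mul_le_mul_of_nonneg_left hroot
    (Real.rpow_nonneg (integral_nonneg fun x => hg0 x) _))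

/-! ### Superlinear recursions and powers of the positive part -/

/-- Fast geometric convergence. -/
theorem tendsto_zero_of_superlinear {C b α : ℝ} (hC : 0 ≤ C) (hb : 1 < b) (hα : 0 < α) {ν : ℝ}
    (hν : 0 ≤ ν) (hνC : C * ν ^ α ≤ b ^ (-(1 / α))) {Y : ℕ → ℝ} (hY0 : ∀ j, 0 ≤ Y j)
    (hYν : Y 0 ≤ ν) (hY : ∀ j, Y (j + 1) ≤ C * b ^ j * Y j * Y j ^ α) :
    Tendsto Y atTop (𝓝 0) := by
  have hb0 : 0 < b := by linarith
  -- The ratio solves `b * r ^ α = 1`, so in the induction the growth of `b ^ j` is cancelled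
  -- exactly by `(r ^ α) ^ j`.
  set r : ℝ := b ^ (-(1 / α)) with hr
  have hr0 : 0 < r := Real.rpow_pos_of_pos hb0 _
  have hr1 : r < 1 := Real.rpow_lt_one_of_one_lt_of_neg hb (by simpa using hα)
  have hrα : b * r ^ α = 1 := by
    rw [hr, ← Real.rpow_mul hb0.le, neg_mul, one_div_mul_cancel hα.ne', Real.rpow_neg_one,
      mul_inv_cancel₀ hb0.ne']
  have key : ∀ j, Y j ≤ ν * r ^ j := by
    intro j
    induction j with
    | zero => simpa using hYν
    | succ j ih =>
      have h1 : Y j ^ α ≤ ν ^ α * (r ^ α) ^ j := by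
        refine (Real.rpow_le_rpow (hY0 j) ih hα.le).trans (le_of_eq ?_)
        rw [Real.mul_rpow hν (by positivity), ← Real.rpow_natCast, ← Real.rpow_natCast,
          ← Real.rpow_mul hr0.le, ← Real.rpow_mul hr0.le, mul_comm (j : ℝ)]
      calc Y (j + 1) ≤ C * b ^ j * Y j * Y j ^ α := hY j
        _ ≤ C * b ^ j * (ν * r ^ j) * (ν ^ α * (r ^ α) ^ j) := by
            gcongr
            exact Real.rpow_nonneg (hY0 j) _
        _ = (C * ν ^ α) * (ν * r ^ j) * (b * r ^ α) ^ j := by rw [mul_pow]; ring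
        _ ≤ r * (ν * r ^ j) * 1 := by rw [hrα, one_pow]; gcongr
        _ = ν * r ^ (j + 1) := by ring
  refine squeeze_zero hY0 key ?_
  simpa using (tendsto_pow_atTop_nhds_zero_of_lt_one hr0.le hr1).const_mul ν

theorem hasDerivAt_max_zero_pow (m : ℕ) (r : ℝ) :
    HasDerivAt (fun r : ℝ => max r 0 ^ (m + 2)) ((m + 2 : ℕ) * max r 0 ^ (m + 1)) r := by
  rcases lt_trichotomy r 0 with h | h | h
  · have : (fun r : ℝ => max r 0 ^ (m + 2)) =ᶠ[𝓝 r] fun _ => 0 := by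
      filter_upwards [Iio_mem_nhds h] with x hx
      simp [max_eq_right (le_of_lt (mem_Iio.1 hx))]
    rw [max_eq_right h.le]
    simpa using (hasDerivAt_const r (0:ℝ)).congr_of_eventuallyEq this
  · subst h
    simp only [max_self, ne_eq, Nat.add_eq_zero_iff, one_ne_zero, and_false, not_false_eq_true,
      zero_pow, mul_zero]
    rw [hasDerivAt_iff_isLittleO]
    simp only [max_self, ne_eq, Nat.add_eq_zero_iff, OfNat.ofNat_ne_zero, and_false,
      not_false_eq_true, zero_pow, sub_zero, smul_zero]
    have h1 : (fun x : ℝ => max x 0 ^ (m + 2)) =O[𝓝 0] fun x : ℝ => x ^ (m + 2) := by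
      refine Asymptotics.IsBigO.of_bound 1 (Eventually.of_forall fun x => ?_)
      rw [one_mul, norm_pow, norm_pow]
      gcongr
      rw [Real.norm_eq_abs, Real.norm_eq_abs, abs_of_nonneg (le_max_right _ _)]
      exact max_le (le_abs_self _) (abs_nonneg _)
    refine h1.trans_isLittleO ?_
    simpa using Asymptotics.isLittleO_pow_pow (𝕜 := ℝ) (m := 1) (n := m + 2) (by omega)
  · have : (fun r : ℝ => max r 0 ^ (m + 2)) =ᶠ[𝓝 r] fun r => r ^ (m + 2) := by
      filter_upwards [Ioi_mem_nhds h] with x hx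
      simp [max_eq_left (le_of_lt (mem_Ioi.1 hx))]
    rw [max_eq_left h.le]
    simpa using (hasDerivAt_pow (m + 2) r).congr_of_eventuallyEq this

/-- Exponent two is the smallest natural exponent for which this holds. It dictates the square of
the truncation in the test function and the cube in the energy. -/
theorem contDiff_max_zero_pow (m : ℕ) : ContDiff ℝ 1 (fun r : ℝ => max r 0 ^ (m + 2)) := by
  rw [contDiff_one_iff_deriv]
  refine ⟨fun r => (hasDerivAt_max_zero_pow m r).differentiableAt, ?_⟩
  have : deriv (fun r : ℝ => max r 0 ^ (m + 2)) = fun r => ((m + 2 : ℕ) : ℝ) * max r 0 ^ (m + 1) :=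
    funext fun r => (hasDerivAt_max_zero_pow m r).deriv
  rw [this]
  fun_prop

/-! ### Truncations, energy densities and calculus on space-time slices -/

/-- The spatial partial derivative `∂_{x_i} φ`. -/
noncomputable def dx {n : ℕ} (i : Fin n) (φ : SpaceTime n → ℝ) (z : SpaceTime n) : ℝ :=
  fderiv ℝ φ z (Pi.single i 1, 0)

/-- The time derivative `∂_t φ`. -/
noncomputable def dt {n : ℕ} (φ : SpaceTime n → ℝ) (z : SpaceTime n) : ℝ := fderiv ℝ φ z (0, 1)

/-- The truncation `(k - w)_+`. -/
noncomputable def defect {n : ℕ} (k : ℝ) (w : SpaceTime n → ℝ) (z : SpaceTime n) : ℝ := max (k - w z) 0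

/-- The integrand obtained by testing with `3 (k - w)_+² ζ` and integrating by parts. -/
noncomputable def energyDensity {n : ℕ} (k : ℝ) (ζ w : SpaceTime n → ℝ) (v f : Fin n → SpaceTime n → ℝ)
    (z : SpaceTime n) : ℝ :=
  ∑ i, f i z * (3 * defect k w z ^ 2 * dx i ζ z - 6 * defect k w z * v i z * ζ z)
    + defect k w z ^ 3 * dt ζ z

/-- The partial derivative of `(k - w)_+³ ζ`, with `v` in place of `∂_{x_i} w`. -/
noncomputable def gradDensity {n : ℕ} (k : ℝ) (ζ w v : SpaceTime n → ℝ) (i : Fin n) (z : SpaceTime n) : ℝ :=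
  defect k w z ^ 3 * dx i ζ z - 3 * defect k w z ^ 2 * v z * ζ z

/-- The half space `{t ≤ t₁}`. -/
def past (n : ℕ) (t₁ : ℝ) : Set (SpaceTime n) := univ ×ˢ Iic t₁

theorem measurableSet_past (n : ℕ) (t₁ : ℝ) : MeasurableSet (past n t₁) :=
  MeasurableSet.univ.prod measurableSet_Iic

theorem setIntegral_past {n : ℕ} (t₁ : ℝ) {H : SpaceTime n → ℝ} (hH : Integrable H) :
    ∫ z in past n t₁, H z = ∫ x, ∫ t in Iic t₁, H (x, t) := by
  have := setIntegral_prod (μ := (volume : Measure (Fin n → ℝ))) (ν := (volume : Measure ℝ))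
    (s := univ) (t := Iic t₁) H hH.integrableOn
  simpa [past, Measure.volume_eq_prod] using this

theorem setIntegral_past_symm {n : ℕ} (t₁ : ℝ) {H : SpaceTime n → ℝ} (hH : Integrable H) :
    ∫ z in past n t₁, H z = ∫ t in Iic t₁, ∫ x, H (x, t) := by
  have h := hH.integrableOn (s := past n t₁)
  rw [IntegrableOn, past, Measure.volume_eq_prod, ← Measure.prod_restrict] at h
  rw [past, Measure.volume_eq_prod, ← Measure.prod_restrict, integral_prod_symm _ h]
  simp

theorem continuous_dx {n : ℕ} (i : Fin n) {φ : SpaceTime n → ℝ} (hφ : ContDiff ℝ 1 φ) :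
    Continuous (dx i φ) := by
  have := hφ.continuous_fderiv one_ne_zero
  unfold dx; fun_prop

theorem continuous_dt {n : ℕ} {φ : SpaceTime n → ℝ} (hφ : ContDiff ℝ 1 φ) :
    Continuous (dt φ) := by
  have := hφ.continuous_fderiv one_ne_zero
  unfold dt; fun_prop

theorem hasCompactSupport_dx {n : ℕ} (i : Fin n) {φ : SpaceTime n → ℝ}
    (hφ : HasCompactSupport φ) : HasCompactSupport (dx i φ) := hφ.fderiv_apply ℝ _

theorem hasCompactSupport_dt {n : ℕ} {φ : SpaceTime n → ℝ}
    (hφ : HasCompactSupport φ) : HasCompactSupport (dt φ) := hφ.fderiv_apply ℝ _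

theorem dx_eq_zero {n : ℕ} (i : Fin n) {φ : SpaceTime n → ℝ} {z : SpaceTime n}
    (hz : z ∉ tsupport φ) : dx i φ z = 0 := by
  rw [dx, fderiv_of_notMem_tsupport _ hz]; rfl

theorem dt_eq_zero {n : ℕ} {φ : SpaceTime n → ℝ} {z : SpaceTime n}
    (hz : z ∉ tsupport φ) : dt φ z = 0 := by
  rw [dt, fderiv_of_notMem_tsupport _ hz]; rfl

theorem hasCompactSupport_timeSlice {n : ℕ} {G : SpaceTime n → ℝ} (hGc : HasCompactSupport G)
    (t : ℝ) : HasCompactSupport fun x => G (x, t) := by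
  have : IsClosedEmbedding fun x : Fin n → ℝ => (x, t) :=
    Function.LeftInverse.isClosedEmbedding (f := Prod.fst) (fun _ => rfl) (by fun_prop)
      (by fun_prop)
  exact hGc.comp_isClosedEmbedding this

theorem hasCompactSupport_spaceSlice {n : ℕ} {G : SpaceTime n → ℝ} (hGc : HasCompactSupport G)
    (x : Fin n → ℝ) : HasCompactSupport fun t => G (x, t) := by
  have : IsClosedEmbedding fun t : ℝ => (x, t) :=
    Function.LeftInverse.isClosedEmbedding (f := Prod.snd) (fun _ => rfl) (by fun_prop)
      (by fun_prop)
  exact hGc.comp_isClosedEmbedding this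

theorem fderiv_timeSlice {n : ℕ} {G : SpaceTime n → ℝ} (hG : Differentiable ℝ G) (t : ℝ)
    (x : Fin n → ℝ) (i : Fin n) :
    fderiv ℝ (fun x => G (x, t)) x (Pi.single i 1) = dx i G (x, t) := by
  have h2 : HasFDerivAt (fun x : Fin n → ℝ => (x, t))
      (ContinuousLinearMap.inl ℝ (Fin n → ℝ) ℝ) x := by
    simpa using! (hasFDerivAt_id x).prodMk (hasFDerivAt_const t x)
  have := ((hG (x, t)).hasFDerivAt.comp x h2).fderiv
  change fderiv ℝ (G ∘ fun x => (x, t)) x (Pi.single i 1) = _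
  rw [this]; rfl

theorem deriv_spaceSlice {n : ℕ} {G : SpaceTime n → ℝ} (hG : Differentiable ℝ G) (x : Fin n → ℝ)
    (t : ℝ) : deriv (fun t => G (x, t)) t = dt G (x, t) := by
  have h2 : HasDerivAt (fun t : ℝ => (x, t)) ((0 : Fin n → ℝ), (1 : ℝ)) t :=
    (hasDerivAt_const t x).prodMk (hasDerivAt_id t)
  exact ((hG (x, t)).hasFDerivAt.comp_hasDerivAt t h2).deriv

/-- The fundamental theorem of calculus on each time line; compact support removes the contribution
at time minus infinity. -/
theorem integral_slice_eq {n : ℕ} {G : SpaceTime n → ℝ} (hG : ContDiff ℝ 1 G)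
    (hGc : HasCompactSupport G) (t₁ : ℝ) :
    ∫ x, G (x, t₁) = ∫ z in past n t₁, dt G z := by
  rw [setIntegral_past _ ((continuous_dt hG).integrable_of_hasCompactSupport
    (hasCompactSupport_dt hGc))]
  refine integral_congr_ae (Eventually.of_forall fun x => ?_)
  have h1 : ContDiff ℝ 1 fun t => G (x, t) := hG.comp (by fun_prop)
  have := (hasCompactSupport_spaceSlice hGc x).integral_Iic_deriv_eq h1 t₁
  simp only [deriv_spaceSlice (hG.differentiable one_ne_zero)] at this
  exact this.symm

theorem setIntegral_past_dx_mul {n : ℕ} {f η : SpaceTime n → ℝ} (hf : ContDiff ℝ 1 f)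
    (hη : ContDiff ℝ 1 η) (hηc : HasCompactSupport η) (t₁ : ℝ) (i : Fin n) :
    ∫ z in past n t₁, dx i f z * η z = -∫ z in past n t₁, f z * dx i η z := by
  have i1 : Integrable fun z => dx i f z * η z :=
    ((continuous_dx i hf).mul hη.continuous).integrable_of_hasCompactSupport hηc.mul_left
  have i2 : Integrable fun z => f z * dx i η z :=
    (hf.continuous.mul (continuous_dx i hη)).integrable_of_hasCompactSupport
      (hasCompactSupport_dx i hηc).mul_left
  rw [setIntegral_past_symm _ i1, setIntegral_past_symm _ i2, ← integral_neg]
  refine integral_congr_ae (Eventually.of_forall fun t => ?_)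
  have hf' : ContDiff ℝ 1 fun x => f (x, t) := hf.comp (by fun_prop)
  have hη' : ContDiff ℝ 1 fun x => η (x, t) := hη.comp (by fun_prop)
  have hηc' := hasCompactSupport_timeSlice hηc t
  have hcf := (continuous_dx i hf).comp (f := fun x : Fin n → ℝ => (x, t)) (by fun_prop)
  have hcη := (continuous_dx i hη).comp (f := fun x : Fin n → ℝ => (x, t)) (by fun_prop)
  have := integral_mul_fderiv_eq_neg_fderiv_mul_of_integrable (μ := (volume : Measure (Fin n → ℝ)))
    (f := fun x => f (x, t)) (g := fun x => η (x, t)) (v := Pi.single i 1) ?_ ?_ ?_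
    (fun x _ => hf'.differentiable one_ne_zero x) (fun x _ => hη'.differentiable one_ne_zero x)
  · simp only [fderiv_timeSlice (hf.differentiable one_ne_zero),
      fderiv_timeSlice (hη.differentiable one_ne_zero)] at this
    simp only
    linarith
  · simp only [fderiv_timeSlice (hf.differentiable one_ne_zero)]
    exact (hcf.mul hη'.continuous).integrable_of_hasCompactSupport hηc'.mul_left
  · simp only [fderiv_timeSlice (hη.differentiable one_ne_zero)]
    exact (hf'.continuous.mul hcη).integrable_of_hasCompactSupport
      (hasCompactSupport_timeSlice (hasCompactSupport_dx i hηc) t).mul_left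
  · exact (hf'.continuous.mul hη'.continuous).integrable_of_hasCompactSupport hηc'.mul_left

theorem contDiff_defect_pow {n : ℕ} (m : ℕ) (k : ℝ) {w : SpaceTime n → ℝ} (hw : ContDiff ℝ 1 w) :
    ContDiff ℝ 1 fun z => defect k w z ^ (m + 2) :=
  (contDiff_max_zero_pow m).comp (contDiff_const.sub hw)

theorem fderiv_defect_pow_mul {n : ℕ} (m : ℕ) (k : ℝ) {w ζ : SpaceTime n → ℝ}
    (hw : Differentiable ℝ w) (hζ : Differentiable ℝ ζ) (z e : SpaceTime n) :
    fderiv ℝ (fun z => defect k w z ^ (m + 2) * ζ z) z e =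
      defect k w z ^ (m + 2) * fderiv ℝ ζ z e
        - (m + 2 : ℕ) * defect k w z ^ (m + 1) * fderiv ℝ w z e * ζ z := by
  have h1 : HasFDerivAt (fun z => defect k w z ^ (m + 2))
      (((m + 2 : ℕ) * defect k w z ^ (m + 1)) • (-fderiv ℝ w z)) z := by
    have := (hasDerivAt_max_zero_pow m (k - w z)).comp_hasFDerivAt z
      ((hw z).hasFDerivAt.const_sub k)
    exact this
  change fderiv ℝ ((fun z => defect k w z ^ (m + 2)) * ζ) z e = _
  rw [(h1.mul (hζ z).hasFDerivAt).fderiv]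
  simp only [add_apply, smul_apply, neg_apply, smul_eq_mul]
  ring

theorem continuous_defect {n : ℕ} (k : ℝ) {w : SpaceTime n → ℝ} (hw : Continuous w) :
    Continuous (defect k w) := by unfold defect; fun_prop

theorem defect_nonneg {n : ℕ} (k : ℝ) (w : SpaceTime n → ℝ) (z : SpaceTime n) :
    0 ≤ defect k w z := le_max_right _ _

theorem energyDensity_eq_zero {n : ℕ} {k : ℝ} {ζ w : SpaceTime n → ℝ}
    {v f : Fin n → SpaceTime n → ℝ} {z : SpaceTime n} (hz : z ∉ tsupport ζ) :
    energyDensity k ζ w v f z = 0 := by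
  simp [energyDensity, dx_eq_zero _ hz, dt_eq_zero hz, image_eq_zero_of_notMem_tsupport hz]

theorem gradDensity_eq_zero {n : ℕ} {k : ℝ} {ζ w v : SpaceTime n → ℝ} {i : Fin n}
    {z : SpaceTime n} (hz : z ∉ tsupport ζ) : gradDensity k ζ w v i z = 0 := by
  simp [gradDensity, dx_eq_zero _ hz, image_eq_zero_of_notMem_tsupport hz]

/-! ### Energy and Sobolev estimates for classical supersolutions -/

section SmoothSupersolution

variable {n : ℕ} {w ζ : SpaceTime n → ℝ} {v f : Fin n → SpaceTime n → ℝ}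

theorem continuous_energyDensity (k : ℝ) (hw : Continuous w) (hv : ∀ i, Continuous (v i))
    (hf : ∀ i, Continuous (f i)) (hζ : ContDiff ℝ 1 ζ) :
    Continuous (energyDensity k ζ w v f) := by
  have h1 := continuous_defect k hw
  have h2 := continuous_dt hζ
  have h3 := fun i => continuous_dx i hζ
  have h4 := hζ.continuous
  unfold energyDensity
  fun_prop

theorem continuous_gradDensity (k : ℝ) (hw : Continuous w) (i : Fin n) {v : SpaceTime n → ℝ}
    (hv : Continuous v) (hζ : ContDiff ℝ 1 ζ) : Continuous (gradDensity k ζ w v i) := by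
  have h1 := continuous_defect k hw
  have h3 := continuous_dx i hζ
  have h4 := hζ.continuous
  unfold gradDensity
  fun_prop

theorem hasCompactSupport_energyDensity (k : ℝ) (hζc : HasCompactSupport ζ) :
    HasCompactSupport (energyDensity k ζ w v f) :=
  HasCompactSupport.intro hζc fun _ hz => energyDensity_eq_zero hz

theorem hasCompactSupport_gradDensity (k : ℝ) (i : Fin n) {v : SpaceTime n → ℝ}
    (hζc : HasCompactSupport ζ) :
    HasCompactSupport (gradDensity k ζ w v i) :=
  HasCompactSupport.intro hζc fun _ hz => gradDensity_eq_zero hz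

/-- Energy inequality for classical supersolutions. -/
theorem slice_energy_le (hw : ContDiff ℝ 1 w)
    (hf : ∀ i, ContDiff ℝ 1 (f i)) (hζ : ContDiff ℝ 1 ζ) (hζc : HasCompactSupport ζ)
    (hζ0 : ∀ z, 0 ≤ ζ z) (hgrad : ∀ z ∈ tsupport ζ, ∀ i, dx i w z = v i z)
    (hsup : ∀ z ∈ tsupport ζ, ∑ i, dx i (f i) z ≤ dt w z) (k t₁ : ℝ) :
    ∫ x, defect k w (x, t₁) ^ 3 * ζ (x, t₁) ≤
      ∫ z in past n t₁, energyDensity k ζ w v f z := by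
  have hwd := hw.differentiable one_ne_zero
  have hζd := hζ.differentiable one_ne_zero
  have hG : ContDiff ℝ 1 fun z => defect k w z ^ 3 * ζ z := (contDiff_defect_pow 1 k hw).mul hζ
  have hη : ContDiff ℝ 1 fun z => defect k w z ^ 2 * ζ z := (contDiff_defect_pow 0 k hw).mul hζ
  have hGc : HasCompactSupport fun z => defect k w z ^ 3 * ζ z := hζc.mul_left
  have hηc : HasCompactSupport fun z => defect k w z ^ 2 * ζ z := hζc.mul_left
  have hd := continuous_defect k hw.continuous
  have hζt := continuous_dt hζ
  have hζcont := hζ.continuous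
  rw [integral_slice_eq hG hGc]
  have i1 : Integrable (dt fun z => defect k w z ^ 3 * ζ z) :=
    (continuous_dt hG).integrable_of_hasCompactSupport (hasCompactSupport_dt hGc)
  have i2 : ∀ i, Integrable fun z => dx i (f i) z * (defect k w z ^ 2 * ζ z) := fun i =>
    ((continuous_dx i (hf i)).mul hη.continuous).integrable_of_hasCompactSupport hηc.mul_left
  have i3 : Integrable fun z => defect k w z ^ 3 * dt ζ z :=
    ((hd.pow 3).mul hζt).integrable_of_hasCompactSupport (hasCompactSupport_dt hζc).mul_left
  have i4 : ∀ i, Integrable fun z => f i z * dx i (fun z => defect k w z ^ 2 * ζ z) z := fun i =>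
    ((hf i).continuous.mul (continuous_dx i hη)).integrable_of_hasCompactSupport
      (hasCompactSupport_dx i hηc).mul_left
  -- The truncation decreases in `w`, so `∂_t w` enters with a minus sign and the supersolution
  -- inequality gives an upper bound. Off the support of `ζ`, where that inequality is not
  -- available, the two integrands agree.
  have step1 : ∫ z in past n t₁, dt (fun z => defect k w z ^ 3 * ζ z) z ≤
      ∫ z in past n t₁, (-3 * ∑ i, dx i (f i) z * (defect k w z ^ 2 * ζ z)
        + defect k w z ^ 3 * dt ζ z) := by
    refine integral_mono i1.integrableOn
      (((integrable_finsetSum _ fun i _ => i2 i).const_mul _).add i3).integrableOn fun z => ?_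
    have hz := fderiv_defect_pow_mul 1 k hwd hζd z (0, 1)
    simp only [dt]
    rw [hz]
    by_cases hzs : z ∈ tsupport ζ
    · have h := hsup z hzs
      have h2 : 0 ≤ 3 * defect k w z ^ 2 * ζ z :=
        mul_nonneg (mul_nonneg (by norm_num) (sq_nonneg _)) (hζ0 z)
      have h3 := mul_le_mul_of_nonneg_left h h2
      rw [← Finset.sum_mul]
      simp only [dt] at h3
      push_cast
      norm_num
      linarith
    · have h0 : ζ z = 0 := image_eq_zero_of_notMem_tsupport hzs
      simp [h0]
  refine step1.trans (le_of_eq ?_)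
  have i5 : Integrable fun z => -3 * ∑ i, dx i (f i) z * (defect k w z ^ 2 * ζ z) :=
    (integrable_finsetSum _ fun i _ => i2 i).const_mul _
  rw [integral_add i5.integrableOn i3.integrableOn, integral_const_mul,
    integral_finsetSum _ fun i _ => (i2 i).integrableOn]
  simp only [setIntegral_past_dx_mul (hf _) hη hηc]
  have i6 : Integrable fun z => ∑ i, 3 * (f i z * dx i (fun z => defect k w z ^ 2 * ζ z) z) :=
    integrable_finsetSum _ fun i _ => (i4 i).const_mul _
  have e1 : (-3 : ℝ) * ∑ i, -∫ z in past n t₁, f i z * dx i (fun z => defect k w z ^ 2 * ζ z) z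
      = ∫ z in past n t₁, ∑ i, 3 * (f i z * dx i (fun z => defect k w z ^ 2 * ζ z) z) := by
    rw [integral_finsetSum _ fun i _ => ((i4 i).const_mul 3).integrableOn, Finset.mul_sum]
    refine Finset.sum_congr rfl fun i _ => ?_
    rw [integral_const_mul]; ring
  rw [e1, ← integral_add i6.integrableOn i3.integrableOn]
  refine integral_congr_ae (Eventually.of_forall fun z => ?_)
  simp only [energyDensity]
  congr 1
  refine Finset.sum_congr rfl fun i _ => ?_
  have hz := fderiv_defect_pow_mul 0 k hwd hζd z (Pi.single i 1, 0)
  have hx : dx i (fun z => defect k w z ^ 2 * ζ z) z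
      = defect k w z ^ 2 * dx i ζ z - 2 * defect k w z * v i z * ζ z := by
    simp only [dx]
    rw [hz]
    by_cases hzs : z ∈ tsupport ζ
    · rw [← hgrad z hzs i]; simp [dx]
    · have h0 : ζ z = 0 := image_eq_zero_of_notMem_tsupport hzs
      simp [h0]
  rw [hx]; ring

/-- Parabolic Sobolev inequality for truncations of classical supersolutions. -/
theorem integral_defect_rpow_le (hn : 2 ≤ n) (hw : ContDiff ℝ 1 w) (hv : ∀ i, Continuous (v i))
    (hf : ∀ i, ContDiff ℝ 1 (f i)) (hζ : ContDiff ℝ 1 ζ) (hζc : HasCompactSupport ζ)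
    (hζ0 : ∀ z, 0 ≤ ζ z) (hgrad : ∀ z ∈ tsupport ζ, ∀ i, dx i w z = v i z)
    (hsup : ∀ z ∈ tsupport ζ, ∑ i, dx i (f i) z ≤ dt w z) (k t₁ : ℝ)
    {L : Fin n → ℝ} (hL : ∀ i, 0 < L i) :
    ∫ z in past n t₁, (defect k w z ^ 3 * ζ z) ^ (1 + 1 / (n : ℝ)) ≤
      (∫ z in past n t₁, max (energyDensity k ζ w v f z) 0) ^ (1 / (n : ℝ)) *
      ((∏ i, L i) ^ (-(1 / (n : ℝ))) *
        ∑ i, L i * ∫ z in past n t₁, |gradDensity k ζ w (v i) i z|) := by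
  set G : SpaceTime n → ℝ := fun z => defect k w z ^ 3 * ζ z with hGdef
  have hwd := hw.differentiable one_ne_zero
  have hζd := hζ.differentiable one_ne_zero
  have hG : ContDiff ℝ 1 G := (contDiff_defect_pow 1 k hw).mul hζ
  have hGc : HasCompactSupport G := hζc.mul_left
  have hG0 : ∀ z, 0 ≤ G z := fun z => mul_nonneg (pow_nonneg (defect_nonneg _ _ _) _) (hζ0 z)
  set R := ∫ z in past n t₁, max (energyDensity k ζ w v f z) 0 with hR
  set Pn := (∏ i, L i) ^ (-(1 / (n : ℝ))) with hPn
  have hPn0 : 0 ≤ Pn := Real.rpow_nonneg (Finset.prod_nonneg fun i _ => (hL i).le) _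
  have hEi : Integrable (energyDensity k ζ w v f) :=
    (continuous_energyDensity k hw.continuous hv (fun i => (hf i).continuous)
      hζ).integrable_of_hasCompactSupport (hasCompactSupport_energyDensity k hζc)
  -- Taking the positive part makes the bound monotone in the upper time limit, hence uniform over
  -- all slices up to `t₁`. It replaces a supremum in time, which would not pass directly to the
  -- limit.
  have hslice : ∀ t ≤ t₁, ∫ x, G (x, t) ≤ R := by
    intro t ht
    refine (slice_energy_le hw hf hζ hζc hζ0 hgrad hsup k t).trans ?_
    refine (integral_mono hEi.integrableOn hEi.pos_part.integrableOn
      fun z => le_max_left _ _).trans ?_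
    exact setIntegral_mono_set hEi.pos_part.integrableOn
      (Eventually.of_forall fun z => le_max_right _ _)
      (LE.le.eventuallyLE (prod_mono_right (Iic_subset_Iic.2 ht)))
  have hdG : ∀ i z, dx i G z = gradDensity k ζ w (v i) i z := by
    intro i z
    have hz := fderiv_defect_pow_mul 1 k hwd hζd z (Pi.single i 1, 0)
    simp only [dx, hGdef]
    rw [hz]
    by_cases hzs : z ∈ tsupport ζ
    · rw [gradDensity, ← hgrad z hzs i]; simp [dx]
    · rw [gradDensity_eq_zero hzs]
      have h0 : ζ z = 0 := image_eq_zero_of_notMem_tsupport hzs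
      have h1 := dx_eq_zero i hzs
      rw [dx] at h1
      simp [h0, h1]
  have hgi : ∀ i, Integrable fun z => |gradDensity k ζ w (v i) i z| := fun i =>
    ((continuous_gradDensity k hw.continuous i (hv i) hζ).integrable_of_hasCompactSupport
      (hasCompactSupport_gradDensity k i hζc)).abs
  have hα : (0 : ℝ) < 1 + 1 / (n : ℝ) := by positivity
  have hGp : Integrable fun z => G z ^ (1 + 1 / (n : ℝ)) :=
    (hG.continuous.rpow_const fun _ => Or.inr hα.le).integrable_of_hasCompactSupport
      (hGc.comp_left (g := fun r : ℝ => r ^ (1 + 1 / (n : ℝ))) (Real.zero_rpow hα.ne'))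
  have hslice2 : ∀ t ∈ Iic t₁, ∫ x, G (x, t) ^ (1 + 1 / (n : ℝ)) ≤
      R ^ (1 / (n : ℝ)) * (Pn * ∑ i, L i * ∫ x, |gradDensity k ζ w (v i) i (x, t)|) := by
    intro t ht
    have h1 : ContDiff ℝ 1 fun x => G (x, t) := hG.comp (by fun_prop)
    have := integral_rpow_le_weighted_gradient hn h1 (hasCompactSupport_timeSlice hGc t)
      (fun x => hG0 _) hL
    simp only [fderiv_timeSlice (hG.differentiable one_ne_zero), hdG] at this
    refine this.trans ?_
    refine mul_le_mul_of_nonneg_right (Real.rpow_le_rpow (integral_nonneg fun x => hG0 _)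
      (hslice t ht) (by positivity)) (mul_nonneg hPn0 (Finset.sum_nonneg fun i _ =>
        mul_nonneg (hL i).le (integral_nonneg fun x => abs_nonneg _)))
  have hti : ∀ i, Integrable fun t => ∫ x, |gradDensity k ζ w (v i) i (x, t)| := fun i => by
    have := hgi i
    rw [Measure.volume_eq_prod] at this
    exact this.integral_prod_right
  have htG : Integrable fun t => ∫ x, G (x, t) ^ (1 + 1 / (n : ℝ)) := by
    rw [Measure.volume_eq_prod] at hGp
    exact hGp.integral_prod_right
  rw [setIntegral_past_symm _ hGp]
  refine (setIntegral_mono_on htG.integrableOn (((integrable_finsetSum _ fun i _ =>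
    (hti i).const_mul (L i)).const_mul Pn).const_mul _).integrableOn measurableSet_Iic
      hslice2).trans (le_of_eq ?_)
  rw [integral_const_mul, integral_const_mul,
    integral_finsetSum _ fun i _ => ((hti i).const_mul (L i)).integrableOn]
  congr 2
  refine Finset.sum_congr rfl fun i _ => ?_
  rw [integral_const_mul, setIntegral_past_symm _ (hgi i)]

end SmoothSupersolution

/-! ### Mollification -/

theorem fderiv_bump_sub {G : Type*} [NormedAddCommGroup G] [NormedSpace ℝ G]
    [FiniteDimensional ℝ G] [MeasureSpace G] (φ : ContDiffBump (0 : G)) (z w e : G) :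
    fderiv ℝ (fun w => φ.normed volume (z - w)) w e = -fderiv ℝ (φ.normed volume) (z - w) e := by
  have h1 : HasFDerivAt (fun w : G => z - w) (-ContinuousLinearMap.id ℝ G) w :=
    (hasFDerivAt_id w).const_sub z
  have h2 := ((φ.contDiff_normed (n := 1) (μ := volume)).differentiable one_ne_zero
    (z - w)).hasFDerivAt.comp w h1
  change fderiv ℝ ((φ.normed volume) ∘ fun w => z - w) w e = _
  rw [h2.fderiv]
  simp

section Mollify

variable {G : Type*} [NormedAddCommGroup G] [NormedSpace ℝ G] [FiniteDimensional ℝ G]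
  [MeasureSpace G]

/-- Convolution with a normalized bump function. -/
noncomputable def mollify (φ : ContDiffBump (0 : G)) (g : G → ℝ) (z : G) : ℝ :=
  ∫ w, φ.normed volume (z - w) * g w

theorem abs_mollify_le (φ : ContDiffBump (0 : G)) (g : G → ℝ) (z : G) :
    |mollify φ g z| ≤ mollify φ (fun z => |g z|) z := by
  simp only [mollify]
  rw [← Real.norm_eq_abs]
  refine (norm_integral_le_integral_norm _).trans (le_of_eq (integral_congr_ae
    (Eventually.of_forall fun w => ?_)))
  simp only [norm_mul, Real.norm_eq_abs, abs_of_nonneg (φ.nonneg_normed _)]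

variable [BorelSpace G] [(volume : Measure G).IsAddHaarMeasure] (φ : ContDiffBump (0 : G)) {g h : G → ℝ}

theorem mollify_eq_convolution (g : G → ℝ) : mollify φ g =
    convolution (φ.normed volume) g (ContinuousLinearMap.lsmul ℝ ℝ) volume := by
  ext z
  rw [convolution_eq_swap]
  rfl

theorem contDiff_mollify (hg : LocallyIntegrable g) : ContDiff ℝ 1 (mollify φ g) := by
  rw [mollify_eq_convolution]
  exact (φ.hasCompactSupport_normed).contDiff_convolution_left _ φ.contDiff_normed hg

theorem fderiv_mollify (hg : LocallyIntegrable g) (z e : G) :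
    fderiv ℝ (mollify φ g) z e = ∫ w, fderiv ℝ (φ.normed volume) (z - w) e * g w := by
  rw [mollify_eq_convolution, ← convolution_flip]
  have h1 := (φ.hasCompactSupport_normed (μ := volume)).hasFDerivAt_convolution_right
    (ContinuousLinearMap.lsmul ℝ ℝ).flip hg φ.contDiff_normed z
  rw [h1.fderiv, convolution_precompR_apply _ hg (φ.hasCompactSupport_normed.fderiv ℝ)
    ((φ.contDiff_normed (n := 1)).continuous_fderiv one_ne_zero)]
  rfl

theorem integrable_mollify (hg : Integrable g) : Integrable (mollify φ g) := by
  rw [mollify_eq_convolution]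
  exact φ.integrable_normed.integrable_convolution _ hg

theorem integral_mollify (hg : Integrable g) : ∫ z, mollify φ g z = ∫ z, g z := by
  rw [mollify_eq_convolution, integral_convolution _ φ.integrable_normed hg, φ.integral_normed]
  simp

theorem integrable_bump_mul (hg : Integrable g) (z : G) :
    Integrable fun w => φ.normed volume (z - w) * g w := by
  obtain ⟨C, hC⟩ := (φ.hasCompactSupport_normed (μ := volume)).exists_bound_of_continuous
    φ.continuous_normed
  exact hg.bdd_mul (φ.continuous_normed.comp (by fun_prop)).aestronglyMeasurable
    (Eventually.of_forall fun w => hC (z - w))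

theorem integral_bump_sub (z : G) : ∫ w, φ.normed volume (z - w) = 1 := by
  rw [integral_sub_left_eq_self (fun w => φ.normed volume w), φ.integral_normed]

theorem integrable_bump_sub (z : G) : Integrable fun w => φ.normed volume (z - w) :=
  φ.integrable_normed.comp_sub_left z

theorem mollify_mono (hg : Integrable g) (hh : Integrable h) (hgh : ∀ z, g z ≤ h z) (z : G) :
    mollify φ g z ≤ mollify φ h z :=
  integral_mono (integrable_bump_mul φ hg z) (integrable_bump_mul φ hh z) fun w =>
    mul_le_mul_of_nonneg_left (hgh w) (φ.nonneg_normed _)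

theorem mollify_add (hg : Integrable g) (hh : Integrable h) (z : G) :
    mollify φ (fun z => g z + h z) z = mollify φ g z + mollify φ h z := by
  simp only [mollify, mul_add]
  exact integral_add (integrable_bump_mul φ hg z) (integrable_bump_mul φ hh z)

/-- The product is at most a double average of `|g w| * |h w'|` against two copies of the bump.
Young's inequality separates the variables and the spare copy integrates to one. The mollified
exponents on the right then give domination of flux times gradient by an `L¹`-convergent sequence.
-/
theorem abs_mollify_mul_mollify_le {p q : ℝ} (hpq : p.HolderConjugate q) (hg : Integrable g)
    (hh : Integrable h) (hgp : Integrable fun z => |g z| ^ p)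
    (hhq : Integrable fun z => |h z| ^ q) (z : G) :
    |mollify φ g z * mollify φ h z| ≤
      mollify φ (fun z => |g z| ^ p + |h z| ^ q) z := by
  rw [mollify_add φ hgp hhq, abs_mul]
  refine (mul_le_mul (abs_mollify_le φ g z) (abs_mollify_le φ h z) (abs_nonneg _)
    ((abs_nonneg _).trans (abs_mollify_le φ g z))).trans ?_
  -- First average, with a frozen number `b` in the role of the second function; the Young weights
  -- `1 / p` and `1 / q` are dropped since they are at most one.
  have h1 : ∀ b : ℝ, mollify φ (fun z => |g z|) z * |b| ≤
      mollify φ (fun z => |g z| ^ p) z + |b| ^ q := by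
    intro b
    have e1 : mollify φ (fun z => |g z|) z * |b|
        = ∫ w, φ.normed volume (z - w) * |g w| * |b| := by rw [integral_mul_const]; rfl
    have e2 : mollify φ (fun z => |g z| ^ p) z + |b| ^ q
        = ∫ w, (φ.normed volume (z - w) * |g w| ^ p + φ.normed volume (z - w) * |b| ^ q) := by
      rw [integral_add (integrable_bump_mul φ hgp z) ((integrable_bump_sub φ z).mul_const _),
        integral_mul_const, integral_bump_sub, one_mul]
      rfl
    rw [e1, e2]
    refine integral_mono ((integrable_bump_mul φ hg.abs z).mul_const _)
      ((integrable_bump_mul φ hgp z).add ((integrable_bump_sub φ z).mul_const _)) fun w => ?_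
    have hy := Real.young_inequality_of_nonneg (abs_nonneg (g w)) (abs_nonneg b) hpq
    have hy1 : |g w| ^ p / p ≤ |g w| ^ p :=
      div_le_self (Real.rpow_nonneg (abs_nonneg _) _) hpq.lt.le
    have hy2 : |b| ^ q / q ≤ |b| ^ q :=
      div_le_self (Real.rpow_nonneg (abs_nonneg _) _) hpq.symm.lt.le
    rw [mul_assoc, ← mul_add]
    exact mul_le_mul_of_nonneg_left (by linarith) (φ.nonneg_normed _)
  set c := mollify φ (fun z => |g z|) z
  set d := mollify φ (fun z => |g z| ^ p) z
  have e3 : c * mollify φ (fun z => |h z|) z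
      = ∫ w, φ.normed volume (z - w) * (c * |h w|) := by
    rw [mollify, ← integral_const_mul]; congr 1; ext w; ring
  have e4 : d + mollify φ (fun z => |h z| ^ q) z
      = ∫ w, (φ.normed volume (z - w) * d + φ.normed volume (z - w) * |h w| ^ q) := by
    rw [integral_add ((integrable_bump_sub φ z).mul_const _) (integrable_bump_mul φ hhq z),
      integral_mul_const, integral_bump_sub, one_mul]
    rfl
  rw [e3, e4]
  refine integral_mono (integrable_bump_mul φ (hh.abs.const_mul c) z)
    (((integrable_bump_sub φ z).mul_const _).add (integrable_bump_mul φ hhq z)) fun w => ?_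
  simp only
  rw [← mul_add]
  exact mul_le_mul_of_nonneg_left (h1 (h w)) (φ.nonneg_normed _)

theorem le_mollify {c : ℝ} (hg : Integrable g) {z : G}
    (hc : ∀ᵐ w, w ∈ Metric.closedBall z φ.rOut → c ≤ g w) : c ≤ mollify φ g z := by
  have e : c = ∫ w, φ.normed volume (z - w) * c := by
    rw [integral_mul_const, integral_bump_sub, one_mul]
  rw [e]
  refine integral_mono_ae ((integrable_bump_sub φ z).mul_const _) (integrable_bump_mul φ hg z) ?_
  filter_upwards [hc] with w hw
  by_cases h : w ∈ Metric.closedBall z φ.rOut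
  · exact mul_le_mul_of_nonneg_left (hw h) (φ.nonneg_normed _)
  · have : φ.normed volume (z - w) = 0 := by
      rw [← Function.notMem_support, φ.support_normed_eq]
      intro h2
      apply h
      rw [mem_ball_zero_iff, ← dist_eq_norm, dist_comm] at h2
      exact h2.le
    simp [this]

/-- With these test functions the weak formulation becomes a pointwise statement about mollified
functions. -/
theorem isTestFunction_bump_sub {Q : Set G} {z : G} (hz : Metric.closedBall z φ.rOut ⊆ Q) :
    IsTestFunction (fun w => φ.normed volume (z - w)) Q := by
  have hsupp : Function.support (fun w => φ.normed volume (z - w)) ⊆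
      Metric.closedBall z φ.rOut := by
    intro w hw
    have : z - w ∈ Function.support (φ.normed volume) := hw
    rw [φ.support_normed_eq, mem_ball_zero_iff, ← dist_eq_norm, dist_comm] at this
    exact this.le
  refine ⟨φ.contDiff_normed.comp (contDiff_const.sub contDiff_id), ?_, ?_⟩
  · exact HasCompactSupport.of_support_subset_isCompact (isCompact_closedBall z _) hsupp
  · exact (closure_minimal hsupp Metric.isClosed_closedBall).trans hz

/-- Bump functions with supports shrinking to the origin. -/
noncomputable def shrinkingBump (G : Type*) [NormedAddCommGroup G] (m : ℕ) :
    ContDiffBump (0 : G) where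
  rIn := 1 / (m + 1)
  rOut := 2 / (m + 1)
  rIn_pos := by positivity
  rIn_lt_rOut := by gcongr; norm_num

theorem tendsto_rOut_shrinkingBump (G : Type*) [NormedAddCommGroup G] :
    Tendsto (fun m => (shrinkingBump G m).rOut) atTop (𝓝 0) := by
  have := (tendsto_one_div_add_atTop_nhds_zero_nat (𝕜 := ℝ)).const_mul 2
  rw [mul_zero] at this
  refine this.congr fun m => ?_
  simp only [shrinkingBump]; ring

theorem ae_tendsto_mollify (hg : LocallyIntegrable g) :
    ∀ᵐ z, Tendsto (fun m => mollify (shrinkingBump G m) g z) atTop (𝓝 (g z)) := by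
  have := ContDiffBump.ae_convolution_tendsto_right_of_locallyIntegrable (μ := volume) (K := 2)
    (tendsto_rOut_shrinkingBump G)
    (Eventually.of_forall fun m => le_of_eq (by simp only [shrinkingBump]; ring)) hg
  simpa only [mollify_eq_convolution] using this

end Mollify

/-! ### Weak supersolutions and their smooth approximation -/

variable {n : ℕ}

instance : (volume : Measure (SpaceTime n)).IsAddHaarMeasure := by
  rw [Measure.volume_eq_prod]; infer_instance

/-- `∂_t U ≥ ∑ ∂_i F_i` weakly in `Q` with `V_i = ∂_i U` weakly in `Q`, for globally integrable
functions. -/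
structure WeakSupersolution (Q : Set (SpaceTime n)) (U : SpaceTime n → ℝ)
    (V F : Fin n → SpaceTime n → ℝ) : Prop where
  integrable : Integrable U
  integrable_grad : ∀ i, Integrable (V i)
  integrable_flux : ∀ i, Integrable (F i)
  weak_grad : ∀ i φ, IsTestFunction φ Q → ∫ z, U z * dx i φ z = -∫ z, V i z * φ z
  weak_super : ∀ φ, IsTestFunction φ Q → (∀ z, 0 ≤ φ z) →
    ∫ z, (U z * dt φ z - ∑ i, F i z * dx i φ z) ≤ 0

/-- Smooth classical supersolutions `u m` with gradients `v m` and fluxes `f m` that approximate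
`(U, V, F)` and are controlled by an `L¹`-convergent sequence `D m`. -/
structure SmoothApproximation (Q : Set (SpaceTime n)) (μ : ℝ) (U : SpaceTime n → ℝ)
    (V F : Fin n → SpaceTime n → ℝ) (u : ℕ → SpaceTime n → ℝ)
    (v f : ℕ → Fin n → SpaceTime n → ℝ) (D : ℕ → SpaceTime n → ℝ) (D₀ : SpaceTime n → ℝ) :
    Prop where
  contDiff : ∀ m, ContDiff ℝ 1 (u m)
  continuous_grad : ∀ m i, Continuous (v m i)
  contDiff_flux : ∀ m i, ContDiff ℝ 1 (f m i)
  classical : ∀ C, IsCompact C → C ⊆ Q → ∀ᶠ m in atTop, ∀ z ∈ C,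
    μ ≤ u m z ∧ (∀ i, dx i (u m) z = v m i z) ∧ ∑ i, dx i (f m i) z ≤ dt (u m) z
  tendsto : ∀ᵐ z, Tendsto (fun m => u m z) atTop (𝓝 (U z))
  tendsto_grad : ∀ᵐ z, ∀ i, Tendsto (fun m => v m i z) atTop (𝓝 (V i z))
  tendsto_flux : ∀ᵐ z, ∀ i, Tendsto (fun m => f m i z) atTop (𝓝 (F i z))
  integrable_dom : ∀ m, Integrable (D m)
  integrable_dom_lim : Integrable D₀
  tendsto_dom : ∀ᵐ z, Tendsto (fun m => D m z) atTop (𝓝 (D₀ z))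
  tendsto_integral_dom : Tendsto (fun m => ∫ z, D m z) atTop (𝓝 (∫ z, D₀ z))
  grad_le : ∀ m i z, |v m i z| ≤ D m z
  flux_le : ∀ m i z, |f m i z| ≤ D m z
  flux_mul_grad_le : ∀ m i z, |f m i z * v m i z| ≤ D m z

/-- Both weak relations are linear in `(U, V, F)`, so mollifying each function separately yields
classical relations, although the mollified flux is no longer a function of the mollified gradient.
The dominating functions are mollifications of one integrable function; their integrals do not
depend on `m`. -/
theorem WeakSupersolution.exists_smoothApproximation {Q : Set (SpaceTime n)} (hQ : IsOpen Q)
    {μ : ℝ} {U : SpaceTime n → ℝ} {V F : Fin n → SpaceTime n → ℝ}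
    (hU : WeakSupersolution Q U V F) (hμ : ∀ᵐ z, z ∈ Q → μ ≤ U z) {p : Fin n → ℝ}
    (hp : ∀ i, 1 < p i) (hVp : ∀ i, Integrable fun z => |V i z| ^ p i)
    (hFp : ∀ i, Integrable fun z => |F i z| ^ (p i).conjExponent) :
    ∃ u v f D D₀, SmoothApproximation Q μ U V F u v f D D₀ := by
  set b := shrinkingBump (SpaceTime n) with hb
  set D₀ : SpaceTime n → ℝ := fun z =>
    ∑ i, (|V i z| + |F i z| + (|F i z| ^ (p i).conjExponent + |V i z| ^ p i)) with hD₀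
  have hDi : Integrable D₀ := integrable_finsetSum _ fun i _ =>
    ((hU.integrable_grad i).abs.add (hU.integrable_flux i).abs).add ((hFp i).add (hVp i))
  have hterm : ∀ i z, |V i z| + |F i z| + (|F i z| ^ (p i).conjExponent + |V i z| ^ p i)
      ≤ D₀ z := fun i z =>
    Finset.single_le_sum (f := fun i => |V i z| + |F i z| +
      (|F i z| ^ (p i).conjExponent + |V i z| ^ p i)) (fun j _ => by positivity)
      (Finset.mem_univ i)
  refine ⟨fun m => mollify (b m) U, fun m i => mollify (b m) (V i), fun m i => mollify (b m) (F i),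
    fun m => mollify (b m) D₀, D₀, ?_⟩
  constructor
  · exact fun m => contDiff_mollify _ hU.integrable.locallyIntegrable
  · exact fun m i => (contDiff_mollify _ (hU.integrable_grad i).locallyIntegrable).continuous
  · exact fun m i => contDiff_mollify _ (hU.integrable_flux i).locallyIntegrable
  · intro C hC hCQ
    -- Once the mollification radius is below `ε`, the bump centred at any point of `C` is
    -- admissible in `Q`.
    obtain ⟨ε, hε, hεQ⟩ := hC.exists_cthickening_subset_open hQ hCQ
    filter_upwards [(tendsto_rOut_shrinkingBump (SpaceTime n)).eventually (gt_mem_nhds hε)]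
      with m hm z hz
    have hball : Metric.closedBall z (b m).rOut ⊆ Q :=
      ((Metric.closedBall_subset_cthickening hz _).trans
        (Metric.cthickening_mono hm.le C)).trans hεQ
    have htest := isTestFunction_bump_sub (b m) hball
    refine ⟨le_mollify _ hU.integrable (hμ.mono fun w hw h => hw (hball h)), fun i => ?_, ?_⟩
    · have h1 := hU.weak_grad i _ htest
      simp only [dx, fderiv_bump_sub] at h1 ⊢
      rw [fderiv_mollify _ hU.integrable.locallyIntegrable]
      simp only [mul_neg, integral_neg, neg_inj] at h1
      simp only [mollify]
      rw [← integral_congr_ae (Eventually.of_forall fun w => mul_comm _ _), h1]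
      exact integral_congr_ae (Eventually.of_forall fun w => mul_comm _ _)
    · have h1 := hU.weak_super _ htest fun w => (b m).nonneg_normed _
      have hI : ∀ {g : SpaceTime n → ℝ} (_ : Integrable g) (e : SpaceTime n), Integrable fun w =>
          g w * fderiv ℝ (fun w => (b m).normed volume (z - w)) w e := by
        intro g hg e
        have hc : Continuous fun w => fderiv ℝ (fun w => (b m).normed volume (z - w)) w e := by
          have := htest.smooth.continuous_fderiv (by simp)
          fun_prop
        obtain ⟨K, hK⟩ := (htest.compact.fderiv_apply ℝ e).exists_bound_of_continuous hc
        exact hg.mul_bdd hc.aestronglyMeasurable (Eventually.of_forall hK)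
      simp only [dx, dt] at h1 ⊢
      rw [integral_sub (hI hU.integrable _)
        (integrable_finsetSum _ fun i _ => hI (hU.integrable_flux i) _),
        integral_finsetSum _ fun i _ => hI (hU.integrable_flux i) _] at h1
      simp only [fderiv_bump_sub, mul_neg, integral_neg, Finset.sum_neg_distrib] at h1
      rw [fderiv_mollify _ hU.integrable.locallyIntegrable]
      simp only [fderiv_mollify _ (hU.integrable_flux _).locallyIntegrable]
      simp only [mul_comm (fderiv ℝ _ _ _)]
      linarith
  · exact ae_tendsto_mollify hU.integrable.locallyIntegrable
  · exact ae_all_iff.2 fun i => ae_tendsto_mollify (hU.integrable_grad i).locallyIntegrable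
  · exact ae_all_iff.2 fun i => ae_tendsto_mollify (hU.integrable_flux i).locallyIntegrable
  · exact fun m => integrable_mollify _ hDi
  · exact hDi
  · exact ae_tendsto_mollify hDi.locallyIntegrable
  · simp only [integral_mollify _ hDi]
    exact tendsto_const_nhds
  · intro m i z
    refine (abs_mollify_le _ _ z).trans (mollify_mono _ (hU.integrable_grad i).abs hDi
      (fun z => le_trans ?_ (hterm i z)) z)
    have : 0 ≤ |F i z| + (|F i z| ^ (p i).conjExponent + |V i z| ^ p i) := by positivity
    linarith
  · intro m i z
    refine (abs_mollify_le _ _ z).trans (mollify_mono _ (hU.integrable_flux i).abs hDi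
      (fun z => le_trans ?_ (hterm i z)) z)
    have : 0 ≤ |V i z| + (|F i z| ^ (p i).conjExponent + |V i z| ^ p i) := by positivity
    linarith
  · intro m i z
    refine (abs_mollify_mul_mollify_le _ (Real.HolderConjugate.conjExponent (hp i)).symm
      (hU.integrable_flux i) (hU.integrable_grad i) (hFp i) (hVp i) z).trans
      (mollify_mono _ ((hFp i).add (hVp i)) hDi (fun z => le_trans ?_ (hterm i z)) z)
    have : 0 ≤ |V i z| + |F i z| := by positivity
    simp only [Pi.add_apply]
    linarith

theorem exists_bound_derivatives {ζ : SpaceTime n → ℝ} (hζ : ContDiff ℝ 1 ζ)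
    (hζc : HasCompactSupport ζ) :
    ∃ B, 0 ≤ B ∧ (∀ z, |ζ z| ≤ B) ∧ (∀ i z, |dx i ζ z| ≤ B) ∧ ∀ z, |dt ζ z| ≤ B := by
  obtain ⟨b, hb⟩ := hζc.exists_bound_of_continuous hζ.continuous
  choose c hc using fun i =>
    (hasCompactSupport_dx i hζc).exists_bound_of_continuous (continuous_dx i hζ)
  obtain ⟨d, hd⟩ := (hasCompactSupport_dt hζc).exists_bound_of_continuous (continuous_dt hζ)
  have hb0 : 0 ≤ b := (norm_nonneg _).trans (hb 0)
  have hc0 : ∀ i, 0 ≤ c i := fun i => (norm_nonneg _).trans (hc i 0)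
  have hd0 : 0 ≤ d := (norm_nonneg _).trans (hd 0)
  have hs0 : 0 ≤ ∑ i, c i := Finset.sum_nonneg fun i _ => hc0 i
  refine ⟨b + ∑ i, c i + d, by positivity, fun z => ?_, fun i z => ?_, fun z => ?_⟩
  · have := hb z; rw [Real.norm_eq_abs] at this; linarith
  · have := hc i z; rw [Real.norm_eq_abs] at this
    have := Finset.single_le_sum (f := c) (fun j _ => hc0 j) (Finset.mem_univ i)
    linarith
  · have := hd z; rw [Real.norm_eq_abs] at this; linarith

/-! ### Passage to the limit in the energy and Sobolev inequalities -/

namespace SmoothApproximation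

variable {Q : Set (SpaceTime n)} {μ : ℝ} {U : SpaceTime n → ℝ} {V F : Fin n → SpaceTime n → ℝ}
  {u : ℕ → SpaceTime n → ℝ} {v f : ℕ → Fin n → SpaceTime n → ℝ} {D : ℕ → SpaceTime n → ℝ}
  {D₀ : SpaceTime n → ℝ}

/-- The truncation is bounded on the support of the cut-off, so every integrand below is controlled
there by a constant plus a multiple of `D m`, and it vanishes elsewhere. This is the form in which
the generalized dominated convergence theorem is used. -/
theorem tendsto_setIntegral (S : SmoothApproximation Q μ U V F u v f D D₀)
    {Φ : ℕ → SpaceTime n → ℝ} {Φ₀ : SpaceTime n → ℝ} {K : ℝ} {C A : Set (SpaceTime n)}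
    (hC : IsCompact C) (hA : MeasurableSet A) (hΦ : ∀ m, Continuous (Φ m))
    (hK : ∀ᶠ m in atTop, ∀ z, |Φ m z| ≤ K * (C.indicator 1 z + D m z))
    (hlim : ∀ᵐ z, Tendsto (fun m => Φ m z) atTop (𝓝 (Φ₀ z))) :
    Tendsto (fun m => ∫ z in A, Φ m z) atTop (𝓝 (∫ z in A, Φ₀ z)) := by
  have hΦ₀ : AEStronglyMeasurable Φ₀ :=
    aestronglyMeasurable_of_tendsto_ae atTop (fun m => (hΦ m).aestronglyMeasurable) hlim
  have hCi : Integrable (C.indicator (1 : SpaceTime n → ℝ)) :=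
    (integrable_indicator_iff hC.measurableSet).2 (integrableOn_const hC.measure_ne_top)
  simp only [← integral_indicator hA]
  refine tendsto_integral_of_tendsto_dominating
    (D := fun m z => K * (C.indicator 1 z + D m z)) (D₀ := fun z => K * (C.indicator 1 z + D₀ z))
    (Eventually.of_forall fun m => (hΦ m).aestronglyMeasurable.indicator hA)
    (hΦ₀.indicator hA) (fun m => (hCi.add (S.integrable_dom m)).const_mul K)
    ((hCi.add S.integrable_dom_lim).const_mul K) ?_ ?_ ?_ ?_
  · filter_upwards [hK] with m hm
    refine Eventually.of_forall fun z => ?_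
    by_cases hz : z ∈ A
    · rw [indicator_of_mem hz]; exact hm z
    · rw [indicator_of_notMem hz, abs_zero]; exact (abs_nonneg _).trans (hm z)
  · filter_upwards [hlim] with z hz
    by_cases h : z ∈ A
    · simpa only [indicator_of_mem h] using hz
    · simp only [indicator_of_notMem h]; exact tendsto_const_nhds
  · filter_upwards [S.tendsto_dom] with z hz
    exact (tendsto_const_nhds.add hz).const_mul K
  · have h1 : ∀ g : SpaceTime n → ℝ, Integrable g → ∫ z, K * (C.indicator 1 z + g z)
        = K * ((∫ z, C.indicator 1 z) + ∫ z, g z) := fun g hg => by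
      rw [integral_const_mul, integral_add hCi hg]
    simp only [h1 _ (S.integrable_dom _), h1 _ S.integrable_dom_lim]
    exact (tendsto_const_nhds.add S.tendsto_integral_dom).const_mul K

theorem integrable_of_tendsto (S : SmoothApproximation Q μ U V F u v f D D₀)
    {Φ : ℕ → SpaceTime n → ℝ} {Φ₀ : SpaceTime n → ℝ} {K : ℝ} {C : Set (SpaceTime n)}
    (hC : IsCompact C) (hΦ : ∀ m, Continuous (Φ m))
    (hK : ∀ᶠ m in atTop, ∀ z, |Φ m z| ≤ K * (C.indicator 1 z + D m z))
    (hlim : ∀ᵐ z, Tendsto (fun m => Φ m z) atTop (𝓝 (Φ₀ z))) : Integrable Φ₀ := by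
  have hCi : Integrable (C.indicator (1 : SpaceTime n → ℝ)) :=
    (integrable_indicator_iff hC.measurableSet).2 (integrableOn_const hC.measure_ne_top)
  refine ((hCi.add S.integrable_dom_lim).const_mul K).mono'
    (aestronglyMeasurable_of_tendsto_ae atTop (fun m => (hΦ m).aestronglyMeasurable) hlim) ?_
  filter_upwards [hlim, S.tendsto_dom] with z h1 h2
  exact le_of_tendsto_of_tendsto h1.abs ((tendsto_const_nhds.add h2).const_mul K)
    (hK.mono fun m hm => hm z)

theorem tendsto_defect (k : ℝ) {z : SpaceTime n}
    (hz : Tendsto (fun m => u m z) atTop (𝓝 (U z))) :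
    Tendsto (fun m => defect k (u m) z) atTop (𝓝 (defect k U z)) :=
  (tendsto_const_nhds.sub hz).max tendsto_const_nhds

theorem defect_le {k : ℝ} {w : SpaceTime n → ℝ} {z : SpaceTime n} (h : μ ≤ w z) :
    defect k w z ≤ max (k - μ) 0 := max_le_max (by linarith) le_rfl

variable {ζ : SpaceTime n → ℝ}

theorem dom_nonneg (S : SmoothApproximation Q μ U V F u v f D D₀) (hn : 2 ≤ n) (m : ℕ)
    (z : SpaceTime n) : 0 ≤ D m z :=
  (abs_nonneg _).trans (S.flux_le m ⟨0, by omega⟩ z)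

theorem abs_energyDensity_le (S : SmoothApproximation Q μ U V F u v f D D₀) (hn : 2 ≤ n)
    {B H k : ℝ} (hB : 0 ≤ B) (hH0 : 0 ≤ H) (hζB : ∀ z, |ζ z| ≤ B) (hdx : ∀ i z, |dx i ζ z| ≤ B)
    (hdt : ∀ z, |dt ζ z| ≤ B) (m : ℕ) (hH : ∀ z ∈ tsupport ζ, defect k (u m) z ≤ H)
    (z : SpaceTime n) :
    |energyDensity k ζ (u m) (v m) (f m) z| ≤
      (n * (3 * H ^ 2 * B + 6 * H * B) + H ^ 3 * B) * ((tsupport ζ).indicator 1 z + D m z) := by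
  have hD := S.dom_nonneg hn m z
  by_cases hz : z ∈ tsupport ζ
  · have hd0 := defect_nonneg k (u m) z
    have hdH := hH z hz
    have h1 : ∀ i, |f m i z * (3 * defect k (u m) z ^ 2 * dx i ζ z
        - 6 * defect k (u m) z * v m i z * ζ z)| ≤ (3 * H ^ 2 * B + 6 * H * B) * D m z := by
      intro i
      have e : f m i z * (3 * defect k (u m) z ^ 2 * dx i ζ z
          - 6 * defect k (u m) z * v m i z * ζ z)
          = 3 * defect k (u m) z ^ 2 * (f m i z * dx i ζ z)
            - 6 * defect k (u m) z * (f m i z * v m i z * ζ z) := by ring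
      rw [e]
      refine (abs_sub _ _).trans ?_
      rw [abs_mul (3 * _), abs_mul (6 * _), abs_mul (f m i z), abs_mul (f m i z * v m i z),
        abs_of_nonneg (by positivity : 0 ≤ 3 * defect k (u m) z ^ 2),
        abs_of_nonneg (by positivity : 0 ≤ 6 * defect k (u m) z)]
      have a1 : |f m i z| * |dx i ζ z| ≤ D m z * B :=
        mul_le_mul (S.flux_le m i z) (hdx i z) (abs_nonneg _) hD
      have a2 : |f m i z * v m i z| * |ζ z| ≤ D m z * B :=
        mul_le_mul (S.flux_mul_grad_le m i z) (hζB z) (abs_nonneg _) hD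
      calc _ ≤ 3 * H ^ 2 * (D m z * B) + 6 * H * (D m z * B) := by gcongr
        _ = _ := by ring
    have h2 : |∑ i, f m i z * (3 * defect k (u m) z ^ 2 * dx i ζ z
        - 6 * defect k (u m) z * v m i z * ζ z)| ≤
        n * ((3 * H ^ 2 * B + 6 * H * B) * D m z) := by
      refine (Finset.abs_sum_le_sum_abs _ _).trans ((Finset.sum_le_sum fun i _ => h1 i).trans ?_)
      simp
    have h3 : |defect k (u m) z ^ 3 * dt ζ z| ≤ H ^ 3 * B := by
      rw [abs_mul, abs_of_nonneg (pow_nonneg hd0 3)]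
      exact mul_le_mul (pow_le_pow_left₀ hd0 hdH 3) (hdt z) (abs_nonneg _) (by positivity)
    rw [indicator_of_mem hz, Pi.one_apply]
    refine (abs_add_le _ _).trans ((add_le_add h2 h3).trans ?_)
    have h4 : 0 ≤ (n : ℝ) * (3 * H ^ 2 * B + 6 * H * B) := by positivity
    have h5 : 0 ≤ H ^ 3 * B * D m z := by positivity
    nlinarith
  · rw [energyDensity_eq_zero hz, abs_zero, indicator_of_notMem hz, zero_add]
    positivity

theorem abs_gradDensity_le (S : SmoothApproximation Q μ U V F u v f D D₀) (hn : 2 ≤ n)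
    {B H k : ℝ} (hB : 0 ≤ B) (hH0 : 0 ≤ H) (hζB : ∀ z, |ζ z| ≤ B) (hdx : ∀ i z, |dx i ζ z| ≤ B)
    (m : ℕ) (hH : ∀ z ∈ tsupport ζ, defect k (u m) z ≤ H) (i : Fin n) (z : SpaceTime n) :
    |gradDensity k ζ (u m) (v m i) i z| ≤
      (3 * H ^ 2 * B + H ^ 3 * B) * ((tsupport ζ).indicator 1 z + D m z) := by
  have hD := S.dom_nonneg hn m z
  by_cases hz : z ∈ tsupport ζ
  · have hd0 := defect_nonneg k (u m) z
    have hdH := hH z hz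
    rw [indicator_of_mem hz, Pi.one_apply, gradDensity, mul_assoc (3 * _)]
    refine (abs_sub _ _).trans ?_
    rw [abs_mul, abs_mul (3 * _), abs_mul (v m i z), abs_of_nonneg (pow_nonneg hd0 3),
      abs_of_nonneg (by positivity : 0 ≤ 3 * defect k (u m) z ^ 2)]
    have a1 : |v m i z| * |ζ z| ≤ D m z * B :=
      mul_le_mul (S.grad_le m i z) (hζB z) (abs_nonneg _) hD
    have a2 := hdx i z
    calc _ ≤ H ^ 3 * B + 3 * H ^ 2 * (D m z * B) := by gcongr
      _ ≤ _ := by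
        have h4 : 0 ≤ 3 * H ^ 2 * B := by positivity
        have h5 : 0 ≤ H ^ 3 * B * D m z := by positivity
        nlinarith
  · rw [gradDensity_eq_zero hz, abs_zero, indicator_of_notMem hz, zero_add]
    positivity

/-- Energy and parabolic Sobolev inequalities for the limit of a smooth approximation. -/
theorem energy_inequalities (S : SmoothApproximation Q μ U V F u v f D D₀) (hn : 2 ≤ n)
    (hζ : ContDiff ℝ 1 ζ) (hζc : HasCompactSupport ζ) (hζ0 : ∀ z, 0 ≤ ζ z) (hζQ : tsupport ζ ⊆ Q)
    (k t₁ : ℝ) {L : Fin n → ℝ} (hL : ∀ i, 0 < L i) :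
    Integrable (energyDensity k ζ U V F) ∧
    Integrable (fun z => (defect k U z ^ 3 * ζ z) ^ (1 + 1 / (n : ℝ))) ∧
    0 ≤ ∫ z in past n t₁, energyDensity k ζ U V F z ∧
    ∫ z in past n t₁, (defect k U z ^ 3 * ζ z) ^ (1 + 1 / (n : ℝ)) ≤
      (∫ z in past n t₁, max (energyDensity k ζ U V F z) 0) ^ (1 / (n : ℝ)) *
      ((∏ i, L i) ^ (-(1 / (n : ℝ))) *
        ∑ i, L i * ∫ z in past n t₁, |gradDensity k ζ U (V i) i z|) := by
  obtain ⟨B, hB, hζB, hdx, hdt⟩ := exists_bound_derivatives hζ hζc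
  -- The lower bound `μ` survives mollification on the support of `ζ`, so `H` bounds the truncations
  -- of all late approximations there.
  set H := max (k - μ) 0 with hH
  have hH0 : 0 ≤ H := le_max_right _ _
  have hn0 : (0 : ℝ) < n := by exact_mod_cast (by omega : 0 < n)
  have hα : (0 : ℝ) < 1 + 1 / (n : ℝ) := by positivity
  have hC : IsCompact (tsupport ζ) := hζc
  have hev := S.classical _ hC hζQ
  have hA := measurableSet_past n t₁
  have hdl : ∀ m, (∀ z ∈ tsupport ζ, μ ≤ u m z) → ∀ z ∈ tsupport ζ, defect k (u m) z ≤ H :=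
    fun m h z hz => defect_le (h z hz)
  have hcE : ∀ m, Continuous (energyDensity k ζ (u m) (v m) (f m)) := fun m =>
    continuous_energyDensity k (S.contDiff m).continuous (S.continuous_grad m)
      (fun i => (S.contDiff_flux m i).continuous) hζ
  have hlimE : ∀ᵐ z, Tendsto (fun m => energyDensity k ζ (u m) (v m) (f m) z) atTop
      (𝓝 (energyDensity k ζ U V F z)) := by
    filter_upwards [S.tendsto, S.tendsto_grad, S.tendsto_flux] with z h1 h2 h3
    have hd := tendsto_defect k h1
    refine (tendsto_finsetSum _ fun i _ => (h3 i).mul ?_).add ((hd.pow 3).mul_const _)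
    exact (((hd.pow 2).const_mul 3).mul_const _).sub (((hd.const_mul 6).mul (h2 i)).mul_const _)
  have hboundE : ∀ᶠ m in atTop, ∀ z, |energyDensity k ζ (u m) (v m) (f m) z| ≤
      (n * (3 * H ^ 2 * B + 6 * H * B) + H ^ 3 * B) * ((tsupport ζ).indicator 1 z + D m z) := by
    filter_upwards [hev] with m hm z
    exact S.abs_energyDensity_le hn hB hH0 hζB hdx hdt m (hdl m fun z hz => (hm z hz).1) z
  have l1 := S.tendsto_setIntegral hC hA hcE hboundE hlimE
  have l2 := S.tendsto_setIntegral (Φ := fun m z => max (energyDensity k ζ (u m) (v m) (f m) z) 0)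
    (Φ₀ := fun z => max (energyDensity k ζ U V F z) 0) hC hA
    (fun m => (hcE m).max continuous_const)
    (hboundE.mono fun m hm z => by
      rw [abs_of_nonneg (le_max_right _ _)]
      exact (max_le (le_abs_self _) (abs_nonneg _)).trans (hm z))
    (hlimE.mono fun z hz => hz.max tendsto_const_nhds)
  have l3 : ∀ i, Tendsto (fun m => ∫ z in past n t₁, |gradDensity k ζ (u m) (v m i) i z|) atTop
      (𝓝 (∫ z in past n t₁, |gradDensity k ζ U (V i) i z|)) := by
    intro i
    refine S.tendsto_setIntegral (K := 3 * H ^ 2 * B + H ^ 3 * B) hC hA (fun m =>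
      (continuous_gradDensity k (S.contDiff m).continuous i (S.continuous_grad m i) hζ).abs) ?_ ?_
    · filter_upwards [hev] with m hm z
      rw [abs_abs]
      exact S.abs_gradDensity_le hn hB hH0 hζB hdx m (hdl m fun z hz => (hm z hz).1) i z
    · filter_upwards [S.tendsto, S.tendsto_grad] with z h1 h2
      have hd := tendsto_defect k h1
      exact (((hd.pow 3).mul_const _).sub ((((hd.pow 2).const_mul 3).mul (h2 i)).mul_const _)).abs
  have c4 : ∀ m, Continuous fun z => (defect k (u m) z ^ 3 * ζ z) ^ (1 + 1 / (n : ℝ)) := fun m =>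
    (((continuous_defect k (S.contDiff m).continuous).pow 3).mul
      hζ.continuous).rpow_const fun _ => Or.inr hα.le
  have b4 : ∀ᶠ m in atTop, ∀ z, |(defect k (u m) z ^ 3 * ζ z) ^ (1 + 1 / (n : ℝ))| ≤
      (H ^ 3 * B) ^ (1 + 1 / (n : ℝ)) * ((tsupport ζ).indicator 1 z + D m z) := by
    filter_upwards [hev] with m hm z
    have hD := S.dom_nonneg hn m z
    have hd0 := defect_nonneg k (u m) z
    have hg0 : 0 ≤ defect k (u m) z ^ 3 * ζ z := mul_nonneg (pow_nonneg hd0 3) (hζ0 z)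
    rw [abs_of_nonneg (Real.rpow_nonneg hg0 _)]
    have hK0 : 0 ≤ (H ^ 3 * B) ^ (1 + 1 / (n : ℝ)) := by positivity
    by_cases hz : z ∈ tsupport ζ
    · rw [indicator_of_mem hz, Pi.one_apply]
      have h1 : (defect k (u m) z ^ 3 * ζ z) ^ (1 + 1 / (n : ℝ)) ≤
          (H ^ 3 * B) ^ (1 + 1 / (n : ℝ)) := by
        refine Real.rpow_le_rpow hg0 (mul_le_mul (pow_le_pow_left₀ hd0
          (hdl m (fun z hz => (hm z hz).1) z hz) 3) ((le_abs_self _).trans (hζB z)) (hζ0 z)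
          (by positivity)) hα.le
      have := mul_nonneg hK0 hD
      linarith
    · rw [image_eq_zero_of_notMem_tsupport hz, mul_zero, Real.zero_rpow hα.ne',
        indicator_of_notMem hz, zero_add]
      exact mul_nonneg hK0 hD
  have t4 : ∀ᵐ z, Tendsto (fun m => (defect k (u m) z ^ 3 * ζ z) ^ (1 + 1 / (n : ℝ))) atTop
      (𝓝 ((defect k U z ^ 3 * ζ z) ^ (1 + 1 / (n : ℝ)))) := by
    filter_upwards [S.tendsto] with z h1
    exact (((tendsto_defect k h1).pow 3).mul_const _).rpow_const (Or.inr hα.le)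
  have l4 := S.tendsto_setIntegral hC hA c4 b4 t4
  refine ⟨S.integrable_of_tendsto hC hcE hboundE hlimE, S.integrable_of_tendsto hC c4 b4 t4, ?_⟩
  constructor
  -- Only the sign of the slice term is kept; it suffices to control the coercive part later.
  · refine ge_of_tendsto l1 ?_
    filter_upwards [hev] with m hm
    refine le_trans ?_ (slice_energy_le (S.contDiff m) (S.contDiff_flux m) hζ hζc hζ0
      (fun z hz => (hm z hz).2.1) (fun z hz => (hm z hz).2.2) k t₁)
    exact integral_nonneg fun x => mul_nonneg (pow_nonneg (defect_nonneg _ _ _) 3) (hζ0 _)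
  · refine le_of_tendsto_of_tendsto l4 ((l2.rpow_const (Or.inr (by positivity))).mul
      ((tendsto_finsetSum _ fun i _ => (l3 i).const_mul (L i)).const_mul _)) ?_
    filter_upwards [hev] with m hm
    exact integral_defect_rpow_le hn (S.contDiff m) (S.continuous_grad m) (S.contDiff_flux m) hζ hζc
      hζ0 (fun z hz => (hm z hz).2.1) (fun z hz => (hm z hz).2.2) k t₁ hL

end SmoothApproximation

/-! ### Pointwise Young inequalities in the intrinsic scaling -/

/-- The larger of `X` and `Z` dominates the product, so Young's inequality holds with both constants
equal to one, uniformly in `p`. -/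
theorem rpow_sub_one_mul_le {X Z p : ℝ} (hX : 0 ≤ X) (hZ : 0 ≤ Z) (hp : 1 < p) :
    X ^ (p - 1) * Z ≤ X ^ p + Z ^ p := by
  have e : ∀ r : ℝ, 0 ≤ r → r ^ (p - 1) * r = r ^ p := fun r hr => by
    rw [← Real.rpow_add_one' hr (by linarith), sub_add_cancel]
  have h1 := Real.rpow_nonneg hX p
  have h2 := Real.rpow_nonneg hZ p
  rcases le_total X Z with h | h
  · have : X ^ (p - 1) * Z ≤ Z ^ (p - 1) * Z :=
      mul_le_mul_of_nonneg_right (Real.rpow_le_rpow hX h (by linarith)) hZ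
    rw [e Z hZ] at this; linarith
  · have : X ^ (p - 1) * Z ≤ X ^ (p - 1) * X :=
      mul_le_mul_of_nonneg_left h (Real.rpow_nonneg hX _)
    rw [e X hX] at this; linarith

theorem le_one_add_rpow {x p : ℝ} (hx : 0 ≤ x) (hp : 1 < p) : x ≤ 1 + x ^ p := by
  have h0 := Real.rpow_nonneg hx p
  rcases le_total x 1 with h | h
  · linarith
  · have := Real.rpow_le_rpow_of_exponent_le h hp.le
    rw [Real.rpow_one] at this; linarith

/-- Absorption of the cut-off term into the coercive term. -/
theorem flux_term_le {Λ M L τ p B S X F V ξ d : ℝ} {N : ℕ} (hΛ : 1 ≤ Λ) (hM : 0 < M) (hL : 0 < L)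
    (hτ : 0 < τ) (hp : 1 < p) (hpN : p ≤ N) (hB : 1 ≤ B) (hscale : (M / L) ^ p = M ^ 2 / τ)
    (hS0 : 0 ≤ S) (hSM : S ≤ M) (hX : 0 ≤ X) (hξ0 : 0 ≤ ξ) (hξ1 : ξ ≤ 1) (hd : |d| ≤ B / L)
    (hF : |F| ≤ Λ * X ^ (p - 1)) (hFV : Λ⁻¹ * X ^ p ≤ F * V) :
    F * (3 * S ^ 2 * (N * ξ ^ (N - 1) * d) - 6 * S * V * ξ ^ N) ≤
      -(3 * Λ⁻¹ * (S * X ^ p * ξ ^ N)) + 3 * (Λ ^ 2 * N) ^ N * B ^ N * (M ^ 3 / τ) := by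
  have hΛ0 : 0 < Λ := by linarith
  have hΛi : Λ⁻¹ ≤ 1 := inv_le_one_of_one_le₀ hΛ
  have hN1 : (1 : ℝ) < N := hp.trans_le hpN
  have hN2 : 2 ≤ N := by exact_mod_cast hN1
  have hp0 : 0 < p := by linarith
  have hB0 : 0 < B := by linarith
  have h1 : F * V * (6 * S * ξ ^ N) ≥ Λ⁻¹ * X ^ p * (6 * S * ξ ^ N) :=
    mul_le_mul_of_nonneg_right hFV (by positivity)
  have hΛN : 1 ≤ Λ ^ 2 * N := by nlinarith
  suffices h2 : F * (3 * S ^ 2 * (N * ξ ^ (N - 1) * d)) ≤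
      3 * Λ⁻¹ * (S * X ^ p * ξ ^ N) + 3 * (Λ ^ 2 * N) ^ N * B ^ N * (M ^ 3 / τ) by
    nlinarith
  have h3 : F * (3 * S ^ 2 * (N * ξ ^ (N - 1) * d)) ≤
      Λ * X ^ (p - 1) * (3 * S ^ 2 * (N * ξ ^ (N - 1) * |d|)) := by
    refine (le_abs_self _).trans ?_
    rw [abs_mul]
    refine mul_le_mul hF (le_of_eq ?_) (abs_nonneg _) (by positivity)
    rw [abs_mul (3 * S ^ 2), abs_mul _ d, abs_of_nonneg (by positivity : 0 ≤ 3 * S ^ 2),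
      abs_of_nonneg (by positivity : 0 ≤ N * ξ ^ (N - 1))]
  refine h3.trans ?_
  have hXp : 0 ≤ X ^ p := Real.rpow_nonneg hX _
  rcases hξ0.eq_or_lt with h | hξ
  · rw [← h, zero_pow (by omega : N - 1 ≠ 0)]
    simp only [mul_zero, zero_mul]
    positivity
  -- With this `Z` the cut-off term equals `3 Λ⁻¹ S ξ ^ N X ^ (p - 1) Z`; its `X ^ p` part is then
  -- exactly half of the coercive term `6 Λ⁻¹ S X ^ p ξ ^ N`.
  set Z := Λ ^ 2 * N * (S * |d|) / ξ with hZ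
  have hZ0 : 0 ≤ Z := by positivity
  have e1 : Λ * X ^ (p - 1) * (3 * S ^ 2 * (N * ξ ^ (N - 1) * |d|))
      = 3 * Λ⁻¹ * S * ξ ^ N * (X ^ (p - 1) * Z) := by
    obtain ⟨k, rfl⟩ : ∃ k, N = k + 1 := ⟨N - 1, by omega⟩
    rw [hZ, Nat.add_sub_cancel, pow_succ ξ k]
    field_simp
  have hy := rpow_sub_one_mul_le hX hZ0 hp
  -- The choice `p ≤ N` pays for the division by `ξ` in `Z`, since `ξ ^ N / ξ ^ p ≤ 1`; the scaling
  -- hypothesis turns `(M / L) ^ p` into `M ^ 2 / τ`.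
  have h4 : S * ξ ^ N * Z ^ p ≤ M * ((Λ ^ 2 * N) ^ N * (B ^ N * (M ^ 2 / τ))) := by
    rw [hZ, Real.div_rpow (by positivity) hξ0, Real.mul_rpow (by positivity) (by positivity)]
    have a1 : (Λ ^ 2 * N) ^ p ≤ (Λ ^ 2 * N) ^ N := by
      rw [← Real.rpow_natCast (Λ ^ 2 * N)]
      exact Real.rpow_le_rpow_of_exponent_le hΛN hpN
    have a2 : (S * |d|) ^ p ≤ B ^ N * (M ^ 2 / τ) := by
      have : S * |d| ≤ B * (M / L) := by
        calc S * |d| ≤ M * (B / L) := by gcongr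
          _ = _ := by ring
      refine (Real.rpow_le_rpow (by positivity) this hp0.le).trans ?_
      rw [Real.mul_rpow hB0.le (by positivity), hscale]
      refine mul_le_mul_of_nonneg_right ?_ (by positivity)
      rw [← Real.rpow_natCast B]
      exact Real.rpow_le_rpow_of_exponent_le hB hpN
    have a3 : ξ ^ N ≤ ξ ^ p := by
      rw [← Real.rpow_natCast ξ]
      exact Real.rpow_le_rpow_of_exponent_ge hξ hξ1 hpN
    have hξp : 0 < ξ ^ p := Real.rpow_pos_of_pos hξ p
    have a4 : ξ ^ N / ξ ^ p ≤ 1 := (div_le_one hξp).2 a3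
    calc S * ξ ^ N * ((Λ ^ 2 * N) ^ p * (S * |d|) ^ p / ξ ^ p)
        = S * ((Λ ^ 2 * N) ^ p * (S * |d|) ^ p) * (ξ ^ N / ξ ^ p) := by ring
      _ ≤ M * ((Λ ^ 2 * N) ^ N * (B ^ N * (M ^ 2 / τ))) * 1 := by gcongr
      _ = _ := mul_one _
  rw [e1]
  have h5 : 3 * Λ⁻¹ * S * ξ ^ N * (X ^ (p - 1) * Z) ≤
      3 * Λ⁻¹ * S * ξ ^ N * (X ^ p + Z ^ p) :=
    mul_le_mul_of_nonneg_left hy (by positivity)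
  have h6 : 3 * Λ⁻¹ * (S * ξ ^ N * Z ^ p) ≤
      3 * 1 * (M * ((Λ ^ 2 * N) ^ N * (B ^ N * (M ^ 2 / τ)))) := by
    have : 0 ≤ S * ξ ^ N * Z ^ p := by positivity
    gcongr
  have e2 : 3 * 1 * (M * ((Λ ^ 2 * N) ^ N * (B ^ N * (M ^ 2 / τ))))
      = 3 * (Λ ^ 2 * N) ^ N * B ^ N * (M ^ 3 / τ) := by ring
  rw [e2] at h6
  nlinarith

/-- Split `|V| ≤ X + δ`. The part with `δ` is harmless because `δ ≤ M / L`. For the other, `x ≤ 1 +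
x ^ p` at `x = X L / M` becomes `X L ≤ M + X ^ p τ / M` by the scaling. One factor `S` is retained
to match the coercive term, the others are bounded by `M`. -/
theorem weighted_gradient_term_le {M L τ p B S V δ ξ d : ℝ} {N : ℕ} (hM : 0 < M)
    (hL : 0 < L) (hτ : 0 < τ) (hp : 1 < p) (hscale : (M / L) ^ p = M ^ 2 / τ)
    (hS0 : 0 ≤ S) (hSM : S ≤ M) (hδ0 : 0 ≤ δ) (hδ : δ ≤ M / L) (hξ0 : 0 ≤ ξ) (hξ1 : ξ ≤ 1)
    (hd : |d| ≤ B / L) :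
    L * |S ^ 3 * (N * ξ ^ (N - 1) * d) - 3 * S ^ 2 * V * ξ ^ N| ≤
      (6 + N * B) * M ^ 3 + 3 * τ * (S * max (|V| - δ) 0 ^ p * ξ ^ N) := by
  set X := max (|V| - δ) 0 with hX
  have hX0 : 0 ≤ X := le_max_right _ _
  have hVX : |V| ≤ X + δ := by have := le_max_left (|V| - δ) 0; linarith
  have hξN : ξ ^ N ≤ 1 := pow_le_one₀ hξ0 hξ1
  have hξN1 : ξ ^ (N - 1) ≤ 1 := pow_le_one₀ hξ0 hξ1
  have hB : 0 ≤ B := by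
    have := (abs_nonneg d).trans hd
    by_contra h
    have := div_neg_of_neg_of_pos (not_le.1 h) hL
    linarith
  have t1 : L * |S ^ 3 * (N * ξ ^ (N - 1) * d)| ≤ N * B * M ^ 3 := by
    rw [abs_mul (S ^ 3), abs_mul _ d, abs_of_nonneg (by positivity : 0 ≤ S ^ 3),
      abs_of_nonneg (by positivity : 0 ≤ N * ξ ^ (N - 1))]
    calc L * (S ^ 3 * (N * ξ ^ (N - 1) * |d|)) ≤ L * (M ^ 3 * (N * 1 * (B / L))) := by gcongr
      _ = _ := by field_simp
  have t2 : L * |3 * S ^ 2 * V * ξ ^ N| ≤ 6 * M ^ 3 + 3 * τ * (S * X ^ p * ξ ^ N) := by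
    rw [abs_mul _ (ξ ^ N), abs_mul _ V, abs_of_nonneg (by positivity : 0 ≤ 3 * S ^ 2),
      abs_of_nonneg (by positivity : 0 ≤ ξ ^ N)]
    have s1 : L * (3 * S ^ 2 * δ * ξ ^ N) ≤ 3 * M ^ 3 := by
      calc L * (3 * S ^ 2 * δ * ξ ^ N) ≤ L * (3 * M ^ 2 * (M / L) * 1) := by gcongr
        _ = _ := by field_simp
    have s2 : X * L ≤ M + X ^ p * τ / M := by
      have h := le_one_add_rpow (x := X / (M / L)) (by positivity) hp
      rw [Real.div_rpow hX0 (by positivity), hscale] at h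
      have h2 := mul_le_mul_of_nonneg_left h hM.le
      have e1 : M * (X / (M / L)) = X * L := by field_simp
      have e2 : M * (1 + X ^ p / (M ^ 2 / τ)) = M + X ^ p * τ / M := by field_simp
      rwa [e1, e2] at h2
    have hXp : 0 ≤ X ^ p := Real.rpow_nonneg hX0 _
    have s3 : L * (3 * S ^ 2 * X * ξ ^ N) ≤ 3 * M ^ 3 + 3 * τ * (S * X ^ p * ξ ^ N) := by
      calc L * (3 * S ^ 2 * X * ξ ^ N) = 3 * S * S * ξ ^ N * (X * L) := by ring
        _ ≤ 3 * M * S * ξ ^ N * (M + X ^ p * τ / M) := by gcongr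
        _ = 3 * M ^ 2 * (S * ξ ^ N) + 3 * τ * (S * X ^ p * ξ ^ N) := by field_simp
        _ ≤ 3 * M ^ 2 * (M * 1) + 3 * τ * (S * X ^ p * ξ ^ N) := by gcongr
        _ = _ := by ring
    calc L * (3 * S ^ 2 * |V| * ξ ^ N) ≤ L * (3 * S ^ 2 * (X + δ) * ξ ^ N) := by gcongr
      _ = L * (3 * S ^ 2 * X * ξ ^ N) + L * (3 * S ^ 2 * δ * ξ ^ N) := by ring
      _ ≤ _ := by linarith
  calc _ ≤ L * (|S ^ 3 * (N * ξ ^ (N - 1) * d)| + |3 * S ^ 2 * V * ξ ^ N|) := by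
        gcongr; exact abs_sub _ _
    _ ≤ _ := by rw [mul_add]; linarith

/-! ### Decay of level sets between nested cylinders -/

theorem dx_pow (i : Fin n) {ξ : SpaceTime n → ℝ} (hξ : Differentiable ℝ ξ) (N : ℕ)
    (z : SpaceTime n) : dx i (fun z => ξ z ^ N) z = N * ξ z ^ (N - 1) * dx i ξ z := by
  rw [dx, fderiv_fun_pow N (hξ z)]
  simp [dx]

theorem dt_pow {ξ : SpaceTime n → ℝ} (hξ : Differentiable ℝ ξ) (N : ℕ)
    (z : SpaceTime n) : dt (fun z => ξ z ^ N) z = N * ξ z ^ (N - 1) * dt ξ z := by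
  rw [dt, fderiv_fun_pow N (hξ z)]
  simp [dt]

/-- Two-sided structure conditions linking flux and gradient. -/
def FluxBounds (Λ : ℝ) (p δ : Fin n → ℝ) (V F : Fin n → SpaceTime n → ℝ) : Prop :=
  ∀ᵐ z, ∀ i, |F i z| ≤ Λ * max (|V i z| - δ i) 0 ^ (p i - 1) ∧
    Λ⁻¹ * max (|V i z| - δ i) 0 ^ p i ≤ F i z * V i z

/-- The constant of the energy estimate. -/
noncomputable def energyConst (n N : ℕ) (Λ : ℝ) : ℝ := n * (3 * (Λ ^ 2 * N) ^ N) + N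

/-- The constant of the gradient estimate. -/
noncomputable def gradConst (n N : ℕ) (Λ : ℝ) : ℝ := n * (6 + N) + Λ * energyConst n N Λ

/-- From the energy and Sobolev inequalities to decay of level sets. -/
theorem decay_of_integral_bounds (hn : 2 ≤ n) {C₁ C₂ b M τ P Y Y' η : ℝ} (hb : 1 ≤ C₁ * b)
    (hM : 0 < M) (hτ : 0 < τ) (hP : 0 < P) (hY : 0 ≤ Y) (hY' : 0 ≤ Y') (hη : 0 < η) (hη1 : η ≤ 1)
    (hC₂ : 0 ≤ C₂ * b)
    (h : ((η * M) ^ 3) ^ (1 + 1 / (n : ℝ)) * Y' ≤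
      (C₁ * b * (M ^ 3 / τ) * Y) ^ (1 / (n : ℝ)) *
        (P ^ (-(1 / (n : ℝ))) * (C₂ * b * M ^ 3 * Y))) :
    Y' / (τ * P) ≤ C₁ * C₂ * b ^ 2 * (η⁻¹) ^ 6 * (Y / (τ * P)) * (Y / (τ * P)) ^ (1 / (n : ℝ)) := by
  have hn0 : (0 : ℝ) < n := by exact_mod_cast (by omega : 0 < n)
  have hn1 : (1 : ℝ) ≤ n := by exact_mod_cast (by omega : 1 ≤ n)
  have hα1 : 1 / (n : ℝ) ≤ 1 := (div_le_one hn0).2 hn1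
  have hα0 : 0 ≤ 1 / (n : ℝ) := by positivity
  set α := 1 / (n : ℝ) with hα
  set y := Y / (τ * P) with hy
  have hy0 : 0 ≤ y := by positivity
  have hyα : 0 ≤ y ^ α := Real.rpow_nonneg hy0 _
  have hMα : 0 < (M ^ 3) ^ α := Real.rpow_pos_of_pos (by positivity) _
  -- The Sobolev factor `P ^ (-α)` joins `Y / τ` to give the normalized measure `y`; the remaining
  -- power of `M ^ 3` cancels against the left side.
  have e1 : (C₁ * b * (M ^ 3 / τ) * Y) ^ α * P ^ (-α) = (C₁ * b) ^ α * ((M ^ 3) ^ α * y ^ α) := by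
    rw [Real.rpow_neg hP.le, ← Real.inv_rpow hP.le,
      ← Real.mul_rpow (by positivity) (by positivity),
      ← Real.mul_rpow (by positivity) hy0, ← Real.mul_rpow (by linarith) (by positivity), hy]
    congr 1; field_simp
  have e2 : (C₁ * b) ^ α ≤ C₁ * b := by
    have := Real.rpow_le_rpow_of_exponent_le hb hα1
    rwa [Real.rpow_one] at this
  -- Since `η ≤ 1` and `1 + α ≤ 2`, the exponent of `η` may be raised to six, which removes the
  -- dimension from it.
  have e3 : ((η * M) ^ 3) ^ (1 + α) ≥ η ^ 6 * (M ^ 3 * (M ^ 3) ^ α) := by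
    rw [mul_pow, Real.mul_rpow (by positivity) (by positivity),
      Real.rpow_one_add' (x := M ^ 3) (by positivity) (by linarith)]
    refine mul_le_mul_of_nonneg_right ?_ (by positivity)
    have : (η ^ 3) ^ (2 : ℝ) ≤ (η ^ 3) ^ (1 + α) :=
      Real.rpow_le_rpow_of_exponent_ge (by positivity) (pow_le_one₀ hη.le hη1) (by linarith)
    refine le_trans (le_of_eq ?_) this
    rw [Real.rpow_two]; ring
  have h1 : η ^ 6 * (M ^ 3 * (M ^ 3) ^ α) * Y' ≤
      C₁ * b * ((M ^ 3) ^ α * y ^ α) * (C₂ * b * M ^ 3 * Y) := by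
    refine (mul_le_mul_of_nonneg_right e3 hY').trans (h.trans ?_)
    rw [← mul_assoc, e1]
    gcongr
  have h2 : Y' ≤ C₁ * C₂ * b ^ 2 * (η⁻¹) ^ 6 * Y * y ^ α := by
    have hpos : 0 < η ^ 6 * (M ^ 3 * (M ^ 3) ^ α) := by positivity
    rw [← mul_le_mul_iff_right₀ hpos]
    refine h1.trans (le_of_eq ?_)
    field_simp
  calc Y' / (τ * P) ≤ (C₁ * C₂ * b ^ 2 * (η⁻¹) ^ 6 * Y * y ^ α) / (τ * P) := by gcongr
    _ = _ := by rw [hy]; ring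

section Step

variable {Q : Set (SpaceTime n)} {μ : ℝ} {U : SpaceTime n → ℝ} {V F : Fin n → SpaceTime n → ℝ}
  {u : ℕ → SpaceTime n → ℝ} {v f : ℕ → Fin n → SpaceTime n → ℝ} {D : ℕ → SpaceTime n → ℝ}
  {D₀ : SpaceTime n → ℝ} {Λ M τ B k t₁ : ℝ} {p δ L : Fin n → ℝ} {N : ℕ} {ξ : SpaceTime n → ℝ}
  {Bx : Set (SpaceTime n)}

/-- The coercive part of the energy. -/
noncomputable def coercive (p δ : Fin n → ℝ) (k : ℝ) (N : ℕ) (ξ U : SpaceTime n → ℝ)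
    (V : Fin n → SpaceTime n → ℝ) (i : Fin n) (z : SpaceTime n) : ℝ :=
  defect k U z * max (|V i z| - δ i) 0 ^ p i * ξ z ^ N

/-- The densities vanish in the first two cases. In the third, `μ ≤ U` and `k ≤ μ + M` bound the
truncation by `M`; this confines all error terms to the level set. -/
theorem defect_eq_zero_or_mem (hk : k ≤ μ + M) (hsupp : ∀ z ∈ past n t₁, z ∈ tsupport ξ → z ∈ Bx)
    (hξQ : tsupport ξ ⊆ Q) {z : SpaceTime n} (hz : z ∈ past n t₁) (hμ : z ∈ Q → μ ≤ U z) :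
    z ∉ tsupport ξ ∨ defect k U z = 0 ∨ (z ∈ {z | U z < k} ∩ Bx ∧ defect k U z ≤ M) := by
  by_cases h : z ∈ tsupport ξ
  · right
    rcases lt_or_ge (U z) k with h1 | h1
    · right
      refine ⟨⟨h1, hsupp z hz h⟩, ?_⟩
      have := hμ (hξQ h)
      rw [defect, max_eq_left (by linarith)]; linarith
    · left
      exact max_eq_right (by linarith)
  · exact Or.inl h

/-- Half of the coercive term absorbs the spatial cut-off terms, direction by direction. The time
term has a nonnegative factor in front of `dt ξ`, so a one-sided bound on that derivative is enough.
-/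
theorem energyDensity_le (hΛ : 1 ≤ Λ) (hM : 0 < M) (hτ : 0 < τ) (hL : ∀ i, 0 < L i)
    (hp : ∀ i, 1 < p i) (hN : 1 ≤ N) (hpN : ∀ i, p i ≤ N) (hB : 1 ≤ B)
    (hscale : ∀ i, (M / L i) ^ p i = M ^ 2 / τ)
    (hξ : Differentiable ℝ ξ) {z : SpaceTime n} (hξ0 : 0 ≤ ξ z) (hξ1 : ξ z ≤ 1)
    (hdx : ∀ i, |dx i ξ z| ≤ B / L i) (hdt : dt ξ z ≤ B / τ)
    (hF : ∀ i, |F i z| ≤ Λ * max (|V i z| - δ i) 0 ^ (p i - 1) ∧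
      Λ⁻¹ * max (|V i z| - δ i) 0 ^ p i ≤ F i z * V i z)
    {A : Set (SpaceTime n)} (hA : z ∉ tsupport ξ ∨ defect k U z = 0 ∨
      (z ∈ A ∧ defect k U z ≤ M)) :
    energyDensity k (fun z => ξ z ^ N) U V F z ≤ -(3 * Λ⁻¹ * ∑ i, coercive p δ k N ξ U V i z) +
      energyConst n N Λ * B ^ N * (M ^ 3 / τ) * A.indicator 1 z := by
  have hΛ0 : 0 < Λ := by linarith
  have hB0 : 0 < B := by linarith
  have hK0 : 0 ≤ energyConst n N Λ := by unfold energyConst; positivity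
  have hI0 : 0 ≤ A.indicator (1 : SpaceTime n → ℝ) z := indicator_nonneg (fun _ _ => zero_le_one) z
  have hR0 : 0 ≤ energyConst n N Λ * B ^ N * (M ^ 3 / τ) * A.indicator 1 z := by positivity
  rcases hA with h | h | ⟨h, hSM⟩
  · have h0 : ξ z = 0 := image_eq_zero_of_notMem_tsupport h
    have h1 := dt_eq_zero h
    simp only [energyDensity, dx_pow _ hξ, dt_pow hξ, coercive, h0, h1,
      zero_pow (by omega : N ≠ 0), dx_eq_zero _ h]
    simpa using hR0
  · simp only [energyDensity, coercive, h]
    simpa using hR0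
  · have hS0 := defect_nonneg k U z
    rw [indicator_of_mem h, Pi.one_apply, mul_one]
    simp only [energyDensity, dx_pow _ hξ, dt_pow hξ]
    have h1 := Finset.sum_le_sum fun i (_ : i ∈ Finset.univ) =>
      flux_term_le (N := N) hΛ hM (hL i) hτ (hp i) (hpN i) hB (hscale i) hS0 hSM
        (le_max_right (|V i z| - δ i) 0) hξ0 hξ1 (hdx i) (hF i).1 (hF i).2
    rw [Finset.sum_add_distrib, Finset.sum_neg_distrib, ← Finset.mul_sum, Finset.sum_const,
      Finset.card_univ, Fintype.card_fin, nsmul_eq_mul] at h1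
    have h2 : defect k U z ^ 3 * (N * ξ z ^ (N - 1) * dt ξ z) ≤ N * B ^ N * (M ^ 3 / τ) := by
      calc defect k U z ^ 3 * (N * ξ z ^ (N - 1) * dt ξ z)
          ≤ defect k U z ^ 3 * (N * ξ z ^ (N - 1) * (B / τ)) := by gcongr
        _ ≤ M ^ 3 * (N * 1 * (B / τ)) := by gcongr; exact pow_le_one₀ hξ0 hξ1
        _ ≤ M ^ 3 * (N * 1 * (B ^ N / τ)) := by
            gcongr; exact le_self_pow₀ hB (by omega)
        _ = _ := by ring
    refine (add_le_add h1 h2).trans (le_of_eq ?_)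
    simp only [coercive, energyConst]
    ring

theorem mul_abs_gradDensity_le (hM : 0 < M) (hτ : 0 < τ) {i : Fin n} (hL : 0 < L i)
    (hp : 1 < p i) (hN : 2 ≤ N) (hB : 0 ≤ B) (hδ0 : 0 ≤ δ i) (hδ : δ i ≤ M / L i)
    (hscale : (M / L i) ^ p i = M ^ 2 / τ)
    (hξ : Differentiable ℝ ξ) {z : SpaceTime n} (hξ0 : 0 ≤ ξ z) (hξ1 : ξ z ≤ 1)
    (hdx : |dx i ξ z| ≤ B / L i)
    {A : Set (SpaceTime n)} (hA : z ∉ tsupport ξ ∨ defect k U z = 0 ∨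
      (z ∈ A ∧ defect k U z ≤ M)) :
    L i * |gradDensity k (fun z => ξ z ^ N) U (V i) i z| ≤
      (6 + N * B) * M ^ 3 * A.indicator 1 z + 3 * τ * coercive p δ k N ξ U V i z := by
  have hI0 : 0 ≤ A.indicator (1 : SpaceTime n → ℝ) z := indicator_nonneg (fun _ _ => zero_le_one) z
  have hR0 : 0 ≤ (6 + N * B) * M ^ 3 * A.indicator 1 z := by positivity
  rcases hA with h | h | ⟨h, hSM⟩
  · have h0 : ξ z = 0 := image_eq_zero_of_notMem_tsupport h
    simp only [gradDensity, dx_pow _ hξ, coercive, h0,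
      zero_pow (by omega : N ≠ 0), dx_eq_zero _ h]
    simpa using hR0
  · simp only [gradDensity, coercive, h]
    simpa using hR0
  · rw [indicator_of_mem h, Pi.one_apply, mul_one]
    simp only [gradDensity, dx_pow _ hξ]
    exact weighted_gradient_term_le hM hL hτ hp hscale (defect_nonneg k U z) hSM hδ0 hδ hξ0 hξ1 hdx

theorem coercive_nonneg {z : SpaceTime n} (hξ0 : 0 ≤ ξ z) (i : Fin n) :
    0 ≤ coercive p δ k N ξ U V i z :=
  mul_nonneg (mul_nonneg (defect_nonneg _ _ _) (Real.rpow_nonneg (le_max_right _ _) _))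
    (pow_nonneg hξ0 _)

/-- A crude bound that serves only to make the coercive terms integrable. -/
theorem coercive_le (hM : 0 ≤ M) {i : Fin n} (hp : 0 ≤ p i) (hN : N ≠ 0) (hδ0 : 0 ≤ δ i)
    {z : SpaceTime n} (hξ0 : 0 ≤ ξ z) (hξ1 : ξ z ≤ 1)
    (h : z ∉ tsupport ξ ∨ defect k U z ≤ M) :
    coercive p δ k N ξ U V i z ≤ M * |V i z| ^ p i := by
  have h0 : 0 ≤ M * |V i z| ^ p i := by positivity
  rcases h with h | h
  · rw [coercive, image_eq_zero_of_notMem_tsupport h, zero_pow hN, mul_zero]; exact h0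
  · have h1 : max (|V i z| - δ i) 0 ^ p i ≤ |V i z| ^ p i :=
      Real.rpow_le_rpow (le_max_right _ _) (max_le (by linarith) (abs_nonneg _)) hp
    have h2 := Real.rpow_nonneg (le_max_right (|V i z| - δ i) 0) (p i)
    calc coercive p δ k N ξ U V i z ≤ M * |V i z| ^ p i * 1 := by
          unfold coercive
          have := defect_nonneg k U z
          gcongr
          exact pow_le_one₀ hξ0 hξ1
      _ = _ := mul_one _

/-- Decay of the measure of the level sets between two nested cylinders. -/
theorem measure_decay_step (hn : 2 ≤ n) (S : SmoothApproximation Q μ U V F u v f D D₀)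
    (hU : AEMeasurable U) (hV : ∀ i, AEMeasurable (V i))
    (hVp : ∀ i, Integrable fun z => |V i z| ^ p i) (hμ : ∀ᵐ z, z ∈ Q → μ ≤ U z)
    (hFB : FluxBounds Λ p δ V F)
    (hΛ : 1 ≤ Λ) (hM : 0 < M) (hτ : 0 < τ) (hL : ∀ i, 0 < L i)
    (hp : ∀ i, 1 < p i) (hpN : ∀ i, p i ≤ N) (hB : 1 ≤ B) (hδ0 : ∀ i, 0 ≤ δ i)
    (hδ : ∀ i, δ i ≤ M / L i) (hscale : ∀ i, (M / L i) ^ p i = M ^ 2 / τ)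
    (hξ : ContDiff ℝ 1 ξ) (hξc : HasCompactSupport ξ) (hξ0 : ∀ z, 0 ≤ ξ z) (hξ1 : ∀ z, ξ z ≤ 1)
    (hξQ : tsupport ξ ⊆ Q)
    (hdx : ∀ z ∈ past n t₁, ∀ i, |dx i ξ z| ≤ B / L i) (hdt : ∀ z ∈ past n t₁, dt ξ z ≤ B / τ)
    (hBx : MeasurableSet Bx) (hBxfin : volume Bx ≠ ⊤)
    (hsupp : ∀ z ∈ past n t₁, z ∈ tsupport ξ → z ∈ Bx)
    {Bx' : Set (SpaceTime n)} (hBx' : MeasurableSet Bx') (hBxfin' : volume Bx' ≠ ⊤)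
    (hpast : Bx' ⊆ past n t₁) (hone : ∀ z ∈ Bx', ξ z = 1)
    (hk : k ≤ μ + M) {η : ℝ} (hη : 0 < η) (hη1 : η ≤ 1) :
    volume.real ({z | U z < k - η * M} ∩ Bx') / (τ * ∏ i, L i) ≤
      energyConst n N Λ * gradConst n N Λ * (B ^ N) ^ 2 * (η⁻¹) ^ 6 *
        (volume.real ({z | U z < k} ∩ Bx) / (τ * ∏ i, L i)) *
        (volume.real ({z | U z < k} ∩ Bx) / (τ * ∏ i, L i)) ^ (1 / (n : ℝ)) := by
  have hn0 : 0 < n := by omega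
  have hΛ0 : 0 < Λ := by linarith
  have hB0 : 0 < B := by linarith
  have hN2 : 2 ≤ N := by
    have : (1 : ℝ) < N := (hp ⟨0, hn0⟩).trans_le (hpN _)
    exact_mod_cast this
  have hξd := hξ.differentiable one_ne_zero
  set A := {z | U z < k} ∩ Bx with hA
  set A' := {z | U z < k - η * M} ∩ Bx' with hA'
  have hAm : NullMeasurableSet A :=
    (nullMeasurableSet_lt hU aemeasurable_const).inter hBx.nullMeasurableSet
  have hAm' : NullMeasurableSet A' :=
    (nullMeasurableSet_lt hU aemeasurable_const).inter hBx'.nullMeasurableSet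
  have hAfin : volume A ≠ ⊤ := measure_ne_top_of_subset inter_subset_right hBxfin
  have hAfin' : volume A' ≠ ⊤ := measure_ne_top_of_subset inter_subset_right hBxfin'
  have hAi : Integrable (A.indicator (1 : SpaceTime n → ℝ)) :=
    IntegrableOn.integrable_indicator₀ (integrableOn_const hAfin) hAm
  have hAint : ∫ z, A.indicator (1 : SpaceTime n → ℝ) z = volume.real A := by
    rw [integral_indicator₀ hAm]; simp
  have hAnn : ∀ z, 0 ≤ A.indicator (1 : SpaceTime n → ℝ) z :=
    fun z => indicator_nonneg (fun _ _ => zero_le_one) z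
  have hApast : ∫ z in past n t₁, A.indicator (1 : SpaceTime n → ℝ) z ≤ volume.real A := by
    rw [← hAint]
    exact setIntegral_le_integral hAi (Eventually.of_forall hAnn)
  have hAi' : Integrable (A'.indicator (1 : SpaceTime n → ℝ)) :=
    IntegrableOn.integrable_indicator₀ (integrableOn_const hAfin') hAm'
  have hAint' : ∫ z in past n t₁, A'.indicator (1 : SpaceTime n → ℝ) z = volume.real A' := by
    rw [setIntegral_eq_integral_of_forall_compl_eq_zero, integral_indicator₀ hAm']
    · simp
    · intro z hz
      exact indicator_of_notMem (fun h => hz (hpast h.2)) _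
  set C₁ := energyConst n N Λ with hC₁
  set C₂ := gradConst n N Λ with hC₂
  have hC₁1 : 1 ≤ C₁ := by
    have : (2 : ℝ) ≤ N := by exact_mod_cast hN2
    have h0 : 0 ≤ (n : ℝ) * (3 * (Λ ^ 2 * N) ^ N) := by positivity
    rw [hC₁, energyConst]; linarith
  have hBN : 1 ≤ B ^ N := one_le_pow₀ hB
  have hC₂0 : 0 ≤ C₂ := by rw [hC₂, gradConst]; positivity
  set c₁ := C₁ * B ^ N * (M ^ 3 / τ) with hc₁
  have hc₁0 : 0 ≤ c₁ := by positivity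
  obtain ⟨iE, iG, h0, hSob⟩ := S.energy_inequalities hn (ζ := fun z => ξ z ^ N) (hξ.pow N)
    (hξc.comp_left (g := fun r : ℝ => r ^ N) (zero_pow (by omega)))
    (fun z => pow_nonneg (hξ0 z) N)
    ((closure_mono fun z (hz : ξ z ^ N ≠ 0) (h : ξ z = 0) =>
      hz (by rw [h, zero_pow (by omega)])).trans hξQ) k t₁ hL
  have hae : ∀ᵐ z ∂(volume.restrict (past n t₁)), z ∉ tsupport ξ ∨ defect k U z = 0 ∨
      (z ∈ A ∧ defect k U z ≤ M) := by
    filter_upwards [ae_restrict_of_ae hμ, ae_restrict_mem (measurableSet_past n t₁)] with z h1 h2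
    exact defect_eq_zero_or_mem hk hsupp hξQ h2 h1
  set W := coercive p δ k N ξ U V with hW
  have hWi : ∀ i, IntegrableOn (W i) (past n t₁) := by
    intro i
    refine ((hVp i).const_mul M).integrableOn.mono' ?_ ?_
    · have hm : AEMeasurable (W i) := by
        have h1 : AEMeasurable (defect k U) := (hU.const_sub k).max aemeasurable_const
        have h2 : AEMeasurable fun z => max (|V i z| - δ i) 0 ^ p i :=
          ((((hV i).norm).sub_const (δ i)).max aemeasurable_const).pow_const (p i)
        exact (h1.mul h2).mul (hξ.continuous.measurable.pow_const N).aemeasurable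
      exact hm.aestronglyMeasurable.restrict
    · filter_upwards [hae] with z hz
      rw [Real.norm_eq_abs, abs_of_nonneg (coercive_nonneg (hξ0 z) i)]
      refine coercive_le hM.le (by have := hp i; linarith) (by omega) (hδ0 i) (hξ0 z) (hξ1 z) ?_
      rcases hz with h | h | h
      · exact Or.inl h
      · exact Or.inr (h.le.trans hM.le)
      · exact Or.inr h.2
  have hE : ∀ᵐ z ∂(volume.restrict (past n t₁)), energyDensity k (fun z => ξ z ^ N) U V F z ≤
      -(3 * Λ⁻¹ * ∑ i, W i z) + c₁ * A.indicator 1 z := by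
    filter_upwards [hae, ae_restrict_of_ae hFB, ae_restrict_mem (measurableSet_past n t₁)]
      with z h1 h2 h3
    exact energyDensity_le hΛ hM hτ hL hp (by omega) hpN hB hscale hξd (hξ0 z) (hξ1 z) (hdx z h3)
      (hdt z h3) h2 h1
  have hWsum : IntegrableOn (fun z => ∑ i, W i z) (past n t₁) :=
    integrable_finsetSum _ fun i _ => hWi i
  -- The integral of the energy density is nonnegative; integrating the pointwise upper bound
  -- therefore controls the coercive terms by the measure of the level set.
  have hWint : ∑ i, ∫ z in past n t₁, W i z ≤ Λ / 3 * (c₁ * volume.real A) := by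
    have i1 : IntegrableOn (fun z => -(3 * Λ⁻¹ * ∑ i, W i z)) (past n t₁) :=
      (hWsum.const_mul (3 * Λ⁻¹)).neg
    have h1 := integral_mono_ae iE.integrableOn (i1.add (hAi.integrableOn.const_mul c₁)) hE
    simp only [Pi.add_apply] at h1
    have h2 : ∫ z in past n t₁, (-(3 * Λ⁻¹ * ∑ i, W i z) + c₁ * A.indicator 1 z) =
        -(3 * Λ⁻¹ * ∑ i, ∫ z in past n t₁, W i z)
          + c₁ * ∫ z in past n t₁, A.indicator 1 z := by
      rw [integral_add i1 (hAi.integrableOn.const_mul c₁),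
        integral_neg, integral_const_mul, integral_const_mul,
        integral_finsetSum _ fun i _ => hWi i]
    have h3 : 0 ≤ -(3 * Λ⁻¹ * ∑ i, ∫ z in past n t₁, W i z)
          + c₁ * ∫ z in past n t₁, A.indicator 1 z := by
      rw [← h2]; exact h0.trans h1
    have h4 := mul_le_mul_of_nonneg_left hApast hc₁0
    have h5 : 3 * Λ⁻¹ * ∑ i, ∫ z in past n t₁, W i z ≤ c₁ * volume.real A := by linarith
    have h6 := mul_le_mul_of_nonneg_left h5 (by positivity : 0 ≤ Λ / 3)
    have h7 : Λ / 3 * (3 * Λ⁻¹ * ∑ i, ∫ z in past n t₁, W i z)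
        = ∑ i, ∫ z in past n t₁, W i z := by field_simp
    rwa [h7] at h6
  -- Here the coercive terms are discarded by sign.
  have hEpos : ∫ z in past n t₁, max (energyDensity k (fun z => ξ z ^ N) U V F z) 0 ≤
      c₁ * volume.real A := by
    refine le_trans ?_ (mul_le_mul_of_nonneg_left hApast hc₁0)
    rw [← integral_const_mul]
    refine integral_mono_ae iE.pos_part.integrableOn (hAi.integrableOn.const_mul c₁) ?_
    filter_upwards [hE] with z hz
    refine max_le (hz.trans ?_) (mul_nonneg hc₁0 (hAnn z))
    have : 0 ≤ 3 * Λ⁻¹ * ∑ i, W i z := mul_nonneg (by positivity)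
      (Finset.sum_nonneg fun i _ => coercive_nonneg (hξ0 z) i)
    linarith
  -- The coercive terms created by the gradient are bounded by the energy estimate just obtained;
  -- the factor `τ` cancels the denominator of `M ^ 3 / τ`.
  have hgrad : ∑ i, L i * ∫ z in past n t₁, |gradDensity k (fun z => ξ z ^ N) U (V i) i z| ≤
      C₂ * B ^ N * M ^ 3 * volume.real A := by
    have h1 : ∀ i, L i * ∫ z in past n t₁, |gradDensity k (fun z => ξ z ^ N) U (V i) i z| ≤
        (6 + N * B) * M ^ 3 * volume.real A + 3 * τ * ∫ z in past n t₁, W i z := by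
      intro i
      have h2 : ∫ z in past n t₁, L i * |gradDensity k (fun z => ξ z ^ N) U (V i) i z| ≤
          ∫ z in past n t₁, ((6 + N * B) * M ^ 3 * A.indicator 1 z + 3 * τ * W i z) := by
        refine integral_mono_of_nonneg
          (Eventually.of_forall fun z => mul_nonneg (hL i).le (abs_nonneg _))
          ((hAi.integrableOn.const_mul _).add ((hWi i).const_mul _)) ?_
        filter_upwards [hae, ae_restrict_mem (measurableSet_past n t₁)] with z h1 h3
        exact mul_abs_gradDensity_le hM hτ (hL i) (hp i) hN2 hB0.le (hδ0 i) (hδ i) (hscale i) hξd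
          (hξ0 z) (hξ1 z) (hdx z h3 i) h1
      rw [integral_add (hAi.integrableOn.const_mul _) ((hWi i).const_mul _), integral_const_mul,
        integral_const_mul, integral_const_mul] at h2
      exact h2.trans (add_le_add_left (mul_le_mul_of_nonneg_left hApast (by positivity)) _)
    refine (Finset.sum_le_sum fun i _ => h1 i).trans ?_
    rw [Finset.sum_add_distrib, Finset.sum_const, Finset.card_univ, Fintype.card_fin,
      nsmul_eq_mul, ← Finset.mul_sum]
    have h3 := mul_le_mul_of_nonneg_left hWint (by positivity : 0 ≤ 3 * τ)
    have e3 : 3 * τ * (Λ / 3 * (c₁ * volume.real A)) =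
        Λ * C₁ * B ^ N * M ^ 3 * volume.real A := by rw [hc₁]; field_simp
    have h4 : (n : ℝ) * ((6 + N * B) * M ^ 3 * volume.real A) ≤
        n * ((6 + N) * B ^ N * M ^ 3 * volume.real A) := by
      have hBB : B ≤ B ^ N := le_self_pow₀ hB (by omega)
      have : (6 + N * B) ≤ (6 + N) * B ^ N := by
        have : (N : ℝ) * B ≤ N * B ^ N := by gcongr
        linarith
      gcongr
    rw [e3] at h3
    refine (add_le_add h4 h3).trans (le_of_eq ?_)
    rw [hC₂, gradConst]; ring
  -- Chebyshev: on the smaller level set the cut-off is one and the truncation is at least `η * M`.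
  have hlow : ((η * M) ^ 3) ^ (1 + 1 / (n : ℝ)) * volume.real A' ≤
      ∫ z in past n t₁, (defect k U z ^ 3 * ξ z ^ N) ^ (1 + 1 / (n : ℝ)) := by
    rw [← hAint', ← integral_const_mul]
    refine integral_mono (hAi'.integrableOn.const_mul _) iG.integrableOn fun z => ?_
    have hd0 := defect_nonneg k U z
    have hz0 : 0 ≤ defect k U z ^ 3 * ξ z ^ N := mul_nonneg (pow_nonneg hd0 3)
      (pow_nonneg (hξ0 z) N)
    by_cases hz : z ∈ A'
    · simp only [indicator_of_mem hz, Pi.one_apply, mul_one, hone z hz.2, one_pow]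
      have h1 : U z < k - η * M := hz.1
      have h2 : η * M ≤ defect k U z := le_trans (by linarith) (le_max_left _ _)
      gcongr
    · simp only [indicator_of_notMem hz, mul_zero]
      exact Real.rpow_nonneg hz0 _
  refine decay_of_integral_bounds hn (b := B ^ N) (by nlinarith) hM hτ
    (Finset.prod_pos fun i _ => hL i) measureReal_nonneg measureReal_nonneg hη hη1 (by positivity)
    (hlow.trans (hSob.trans ?_))
  have hP0 : 0 ≤ (∏ i, L i) ^ (-(1 / (n : ℝ))) :=
    Real.rpow_nonneg (Finset.prod_nonneg fun i _ => (hL i).le) _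
  have hG0 : 0 ≤ ∑ i, L i * ∫ z in past n t₁, |gradDensity k (fun z => ξ z ^ N) U (V i) i z| :=
    Finset.sum_nonneg fun i _ => mul_nonneg (hL i).le (integral_nonneg fun z => abs_nonneg _)
  refine mul_le_mul (Real.rpow_le_rpow (integral_nonneg fun z => le_max_right _ _) hEpos
    (by positivity)) (mul_le_mul_of_nonneg_left hgrad hP0) (mul_nonneg hP0 hG0)
    (Real.rpow_nonneg (mul_nonneg hc₁0 measureReal_nonneg) _)

end Step

/-! ### Cut-off functions -/

/-- Each such point is a global minimum, an argument that also covers the endpoint zero. -/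
theorem deriv_smoothTransition_of_nonpos {x : ℝ} (hx : x ≤ 0) :
    deriv Real.smoothTransition x = 0 := by
  refine IsLocalMin.deriv_eq_zero (Eventually.of_forall fun y => ?_)
  rw [Real.smoothTransition.zero_of_nonpos hx]
  exact Real.smoothTransition.nonneg y

theorem deriv_smoothTransition_of_one_le {x : ℝ} (hx : 1 ≤ x) :
    deriv Real.smoothTransition x = 0 := by
  refine IsLocalMax.deriv_eq_zero (Eventually.of_forall fun y => ?_)
  rw [Real.smoothTransition.one_of_one_le hx]
  exact Real.smoothTransition.le_one y

theorem contDiff_smoothTransition : ContDiff ℝ 1 Real.smoothTransition :=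
  Real.smoothTransition.contDiff

theorem exists_bound_deriv_smoothTransition :
    ∃ D, 0 ≤ D ∧ ∀ x, |deriv Real.smoothTransition x| ≤ D := by
  have hc : Continuous (deriv Real.smoothTransition) :=
    contDiff_smoothTransition.continuous_deriv le_rfl
  obtain ⟨D, hD⟩ := (isCompact_Icc (a := (0 : ℝ)) (b := 1)).exists_bound_of_continuousOn
    hc.continuousOn
  have hD0 : 0 ≤ D := (norm_nonneg _).trans (hD 0 (by simp))
  refine ⟨D, hD0, fun x => ?_⟩
  rcases le_total x 0 with h | h
  · rwa [deriv_smoothTransition_of_nonpos h, abs_zero]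
  rcases le_total 1 x with h1 | h1
  · rwa [deriv_smoothTransition_of_one_le h1, abs_zero]
  · exact hD x ⟨h, h1⟩

theorem hasDerivAt_smoothTransition_comp {g : ℝ → ℝ} {g' x : ℝ} (hg : HasDerivAt g g' x) :
    HasDerivAt (fun x => Real.smoothTransition (g x)) (deriv Real.smoothTransition (g x) * g') x :=
  ((contDiff_smoothTransition.differentiable one_ne_zero (g x)).hasDerivAt).comp x hg

/-- A smooth function equal to `1` on `[-r, r]` and to `0` outside `(-R, R)`. -/
noncomputable def plateau (r R x : ℝ) : ℝ :=
  Real.smoothTransition ((R - x) / (R - r)) * Real.smoothTransition ((R + x) / (R - r))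

theorem contDiff_plateau (r R : ℝ) : ContDiff ℝ 1 (plateau r R) :=
  (contDiff_smoothTransition.comp (by fun_prop)).mul (contDiff_smoothTransition.comp (by fun_prop))

theorem plateau_nonneg (r R x : ℝ) : 0 ≤ plateau r R x :=
  mul_nonneg (Real.smoothTransition.nonneg _) (Real.smoothTransition.nonneg _)

theorem plateau_le_one (r R x : ℝ) : plateau r R x ≤ 1 :=
  mul_le_one₀ (Real.smoothTransition.le_one _) (Real.smoothTransition.nonneg _)
    (Real.smoothTransition.le_one _)

theorem plateau_eq_one {r R x : ℝ} (hrR : r < R) (hx : |x| ≤ r) : plateau r R x = 1 := by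
  obtain ⟨h1, h2⟩ := abs_le.1 hx
  have h : 0 < R - r := by linarith
  rw [plateau, Real.smoothTransition.one_of_one_le ((one_le_div h).2 (by linarith)),
    Real.smoothTransition.one_of_one_le ((one_le_div h).2 (by linarith)), one_mul]

theorem plateau_eq_zero {r R x : ℝ} (hrR : r < R) (hx : R ≤ |x|) : plateau r R x = 0 := by
  have h : 0 < R - r := by linarith
  rcases le_abs.1 hx with h1 | h1
  · rw [plateau, Real.smoothTransition.zero_of_nonpos
      (div_nonpos_of_nonpos_of_nonneg (by linarith) h.le), zero_mul]
  · rw [plateau, mul_comm, Real.smoothTransition.zero_of_nonpos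
      (div_nonpos_of_nonpos_of_nonneg (by linarith) h.le), zero_mul]

theorem abs_deriv_plateau_le {D : ℝ} (hD : ∀ x, |deriv Real.smoothTransition x| ≤ D)
    {r R : ℝ} (hrR : r < R) (x : ℝ) : |deriv (plateau r R) x| ≤ 2 * D / (R - r) := by
  have h : 0 < R - r := by linarith
  have h1 := hasDerivAt_smoothTransition_comp (((hasDerivAt_id x).const_sub R).div_const (R - r))
  have h2 := hasDerivAt_smoothTransition_comp (((hasDerivAt_id x).const_add R).div_const (R - r))
  have h3 : HasDerivAt (plateau r R) _ x := h1.mul h2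
  have key : ∀ a b c : ℝ, |a| ≤ D → |b| ≤ 1 / (R - r) → |c| ≤ 1 → |a * b * c| ≤ D / (R - r) := by
    intro a b c ha hb hc
    rw [abs_mul, abs_mul]
    have hD0 : 0 ≤ D := (abs_nonneg _).trans ha
    calc |a| * |b| * |c| ≤ D * (1 / (R - r)) * 1 := by gcongr
      _ = _ := by ring
  have hst : ∀ x, |Real.smoothTransition x| ≤ 1 := fun x => by
    rw [abs_of_nonneg (Real.smoothTransition.nonneg x)]; exact Real.smoothTransition.le_one x
  rw [h3.deriv]
  refine (abs_add_le _ _).trans ?_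
  have a1 := key _ (-1 / (R - r)) _ (hD ((R - x) / (R - r)))
    (by rw [abs_div, abs_neg, abs_one, abs_of_pos h]) (hst ((R + x) / (R - r)))
  have a2 := key _ (1 / (R - r)) _ (hD ((R + x) / (R - r)))
    (by rw [abs_div, abs_one, abs_of_pos h]) (hst ((R - x) / (R - r)))
  have e : 2 * D / (R - r) = D / (R - r) + D / (R - r) := by ring
  rw [e]
  refine add_le_add a1 ?_
  rw [mul_comm]
  exact a2

theorem dx_eq_deriv {n : ℕ} {ξ : SpaceTime n → ℝ} (hξ : Differentiable ℝ ξ) (i : Fin n)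
    (z : SpaceTime n) : dx i ξ z = deriv (fun r => ξ (Function.update z.1 i r, z.2)) (z.1 i) := by
  have h2 : HasDerivAt (fun r : ℝ => (Function.update z.1 i r, z.2))
      ((Pi.single i 1 : Fin n → ℝ), (0 : ℝ)) (z.1 i) :=
    (hasDerivAt_update z.1 i (z.1 i)).prodMk (hasDerivAt_const _ _)
  have hz : (Function.update z.1 i (z.1 i), z.2) = z := by simp
  have h1 : HasFDerivAt ξ (fderiv ℝ ξ z) (Function.update z.1 i (z.1 i), z.2) := by
    rw [hz]; exact (hξ z).hasFDerivAt
  exact (h1.comp_hasDerivAt (z.1 i) h2).deriv.symm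

/-- Cut-off functions between nested cylinders; only the derivative of the initial ramp enters
the bound for the time derivative. -/
theorem exists_cutoff : ∃ D : ℝ, 0 ≤ D ∧ ∀ (n : ℕ) (y r R : Fin n → ℝ) (a b c d : ℝ),
    (∀ i, r i < R i) → a < b → c < d →
    ∃ ξ : SpaceTime n → ℝ, ContDiff ℝ 1 ξ ∧ HasCompactSupport ξ ∧ (∀ z, 0 ≤ ξ z) ∧
      (∀ z, ξ z ≤ 1) ∧ tsupport ξ ⊆ {z | (∀ i, |z.1 i - y i| ≤ R i) ∧ z.2 ∈ Icc a d} ∧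
      (∀ z : SpaceTime n, (∀ i, |z.1 i - y i| ≤ r i) → z.2 ∈ Icc b c → ξ z = 1) ∧
      (∀ z i, |dx i ξ z| ≤ D / (R i - r i)) ∧ ∀ z : SpaceTime n, z.2 ≤ c → dt ξ z ≤ D / (b - a) := by
  obtain ⟨D, hD0, hD⟩ := exists_bound_deriv_smoothTransition
  refine ⟨2 * D, by positivity, fun n y r R a b c d hrR hab hcd => ?_⟩
  have hab' : 0 < b - a := by linarith
  have hcd' : 0 < d - c := by linarith
  set θ : ℝ → ℝ := fun t =>
    Real.smoothTransition ((t - a) / (b - a)) * Real.smoothTransition ((d - t) / (d - c)) with hθ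
  have hθ0 : ∀ t, 0 ≤ θ t := fun t =>
    mul_nonneg (Real.smoothTransition.nonneg _) (Real.smoothTransition.nonneg _)
  have hθ1 : ∀ t, θ t ≤ 1 := fun t =>
    mul_le_one₀ (Real.smoothTransition.le_one _) (Real.smoothTransition.nonneg _)
      (Real.smoothTransition.le_one _)
  have hθC : ContDiff ℝ 1 θ :=
    (contDiff_smoothTransition.comp (by fun_prop)).mul (contDiff_smoothTransition.comp (by fun_prop))
  set P : (Fin n → ℝ) → ℝ := fun x => ∏ i, plateau (r i) (R i) (x i - y i) with hP
  have hP0 : ∀ x, 0 ≤ P x := fun x => Finset.prod_nonneg fun i _ => plateau_nonneg _ _ _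
  have hP1 : ∀ x, P x ≤ 1 := fun x =>
    Finset.prod_le_one (fun i _ => plateau_nonneg _ _ _) fun i _ => plateau_le_one _ _ _
  have hPC : ContDiff ℝ 1 P :=
    contDiff_prod fun i _ => (contDiff_plateau (r i) (R i)).comp (by fun_prop)
  set ξ : SpaceTime n → ℝ := fun z => P z.1 * θ z.2 with hξ
  have hξC : ContDiff ℝ 1 ξ := (hPC.comp contDiff_fst).mul (hθC.comp contDiff_snd)
  have hK : {z : SpaceTime n | (∀ i, |z.1 i - y i| ≤ R i) ∧ z.2 ∈ Icc a d} =
      Icc (fun i => y i - R i) (fun i => y i + R i) ×ˢ Icc a d := by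
    ext z
    simp only [mem_ofPred_eq, mem_prod, mem_Icc, Pi.le_def, abs_le, ← forall_and]
    constructor
    · rintro ⟨h1, h2⟩
      exact ⟨fun i => ⟨by linarith [(h1 i).1], by linarith [(h1 i).2]⟩, h2⟩
    · rintro ⟨h1, h2⟩
      exact ⟨fun i => ⟨by linarith [(h1 i).1], by linarith [(h1 i).2]⟩, h2⟩
  have hKc : IsCompact {z : SpaceTime n | (∀ i, |z.1 i - y i| ≤ R i) ∧ z.2 ∈ Icc a d} := by
    rw [hK]; exact isCompact_Icc.prod isCompact_Icc
  have hzero : ∀ z, z ∉ {z : SpaceTime n | (∀ i, |z.1 i - y i| ≤ R i) ∧ z.2 ∈ Icc a d} →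
      ξ z = 0 := by
    intro z hz
    by_cases h : ∀ i, |z.1 i - y i| ≤ R i
    · have ht : ¬ z.2 ∈ Icc a d := fun h2 => hz ⟨h, h2⟩
      have : θ z.2 = 0 := by
        rw [mem_Icc, not_and_or, not_le, not_le] at ht
        rcases ht with h3 | h3
        · simp only [hθ]
          rw [Real.smoothTransition.zero_of_nonpos
            (div_nonpos_of_nonpos_of_nonneg (by linarith) hab'.le), zero_mul]
        · simp only [hθ]
          rw [mul_comm, Real.smoothTransition.zero_of_nonpos
            (div_nonpos_of_nonpos_of_nonneg (by linarith) hcd'.le), zero_mul]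
      simp [hξ, this]
    · push Not at h
      obtain ⟨i, hi⟩ := h
      have : P z.1 = 0 := Finset.prod_eq_zero (Finset.mem_univ i) (plateau_eq_zero (hrR i) hi.le)
      simp [hξ, this]
  have htsupp : tsupport ξ ⊆ {z | (∀ i, |z.1 i - y i| ≤ R i) ∧ z.2 ∈ Icc a d} :=
    closure_minimal (fun z hz => by_contra fun h => hz (hzero z h)) hKc.isClosed
  refine ⟨ξ, hξC, HasCompactSupport.intro hKc fun z hz => hzero z hz,
    fun z => mul_nonneg (hP0 _) (hθ0 _), fun z => mul_le_one₀ (hP1 _) (hθ0 _) (hθ1 _), htsupp,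
    ?_, ?_, ?_⟩
  · intro z hx ht
    have h1 : P z.1 = 1 := Finset.prod_eq_one fun i _ => plateau_eq_one (hrR i) (hx i)
    have h2 : θ z.2 = 1 := by
      simp only [hθ]
      rw [Real.smoothTransition.one_of_one_le ((one_le_div hab').2 (by linarith [ht.1])),
        Real.smoothTransition.one_of_one_le ((one_le_div hcd').2 (by linarith [ht.2])), one_mul]
    simp [hξ, h1, h2]
  · intro z i
    rw [dx_eq_deriv (hξC.differentiable one_ne_zero)]
    set K := (∏ j ∈ Finset.univ.erase i, plateau (r j) (R j) (z.1 j - y j)) * θ z.2 with hKdef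
    have hfun : (fun s => ξ (Function.update z.1 i s, z.2)) =
        fun s => plateau (r i) (R i) (s - y i) * K := by
      ext s
      simp only [hξ, hP, hKdef]
      rw [← Finset.mul_prod_erase _ _ (Finset.mem_univ i), Function.update_self, mul_assoc]
      congr 2
      refine Finset.prod_congr rfl fun j hj => ?_
      rw [Function.update_of_ne (Finset.ne_of_mem_erase hj)]
    have hK0 : 0 ≤ K := mul_nonneg (Finset.prod_nonneg fun j _ => plateau_nonneg _ _ _) (hθ0 _)
    have hK1 : K ≤ 1 := mul_le_one₀ (Finset.prod_le_one (fun j _ => plateau_nonneg _ _ _)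
      fun j _ => plateau_le_one _ _ _) (hθ0 _) (hθ1 _)
    have hd : HasDerivAt (fun s => plateau (r i) (R i) (s - y i) * K)
        (deriv (plateau (r i) (R i)) (z.1 i - y i) * K) (z.1 i) := by
      have h1 := ((contDiff_plateau (r i) (R i)).differentiable one_ne_zero
        (z.1 i - y i)).hasDerivAt.comp (z.1 i) ((hasDerivAt_id (z.1 i)).sub_const (y i))
      rw [mul_one] at h1
      exact h1.mul_const K
    rw [hfun, hd.deriv, abs_mul, abs_of_nonneg hK0]
    have h2 := abs_deriv_plateau_le hD (hrR i) (z.1 i - y i)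
    calc _ ≤ 2 * D / (R i - r i) * 1 :=
          mul_le_mul h2 hK1 hK0 ((abs_nonneg _).trans h2)
      _ = _ := mul_one _
  · intro z hz
    rw [← deriv_spaceSlice (hξC.differentiable one_ne_zero) z.1 z.2]
    have h1 := hasDerivAt_smoothTransition_comp
      (((hasDerivAt_id z.2).sub_const a).div_const (b - a))
    have h2 := hasDerivAt_smoothTransition_comp
      (((hasDerivAt_id z.2).const_sub d).div_const (d - c))
    have h3 : HasDerivAt (fun t => P z.1 * θ t) _ z.2 := (h1.mul h2).const_mul (P z.1)
    change deriv (fun t => P z.1 * θ t) z.2 ≤ _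
    rw [h3.deriv]
    simp only [id]
    -- Up to time `c` the final ramp sits at its maximum one, with zero derivative; hence the length
    -- `d - c` does not enter the bound.
    have hone : 1 ≤ (d - z.2) / (d - c) := (one_le_div hcd').2 (by linarith)
    rw [deriv_smoothTransition_of_one_le hone, Real.smoothTransition.one_of_one_le hone, zero_mul,
      mul_zero, add_zero, mul_one]
    have h4 := (le_abs_self _).trans (hD ((z.2 - a) / (b - a)))
    have h5 : deriv Real.smoothTransition ((z.2 - a) / (b - a)) * (1 / (b - a)) ≤ D / (b - a) := by
      rw [mul_one_div]; gcongr
    calc _ ≤ P z.1 * (D / (b - a)) := mul_le_mul_of_nonneg_left h5 (hP0 _)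
      _ ≤ 1 * (D / (b - a)) := mul_le_mul_of_nonneg_right (hP1 _) (by positivity)
      _ ≤ 2 * D / (b - a) := by rw [one_mul]; gcongr; linarith

/-! ### The De Giorgi iteration -/

/-- The open box with half sides `ℓ i` and centre `y`. -/
def openBox (y ℓ : Fin n → ℝ) : Set (Fin n → ℝ) := {x | ∀ i, |x i - y i| < ℓ i}

theorem openBox_eq_pi (y ℓ : Fin n → ℝ) :
    openBox y ℓ = Set.pi univ fun i => Ioo (y i - ℓ i) (y i + ℓ i) := by
  ext x
  simp only [openBox, mem_ofPred_eq, Set.mem_pi, mem_univ, true_implies, mem_Ioo, abs_lt]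
  refine forall_congr' fun i => ⟨fun h => ⟨?_, ?_⟩, fun h => ⟨?_, ?_⟩⟩ <;> linarith [h.1, h.2]

theorem isOpen_openBox (y ℓ : Fin n → ℝ) : IsOpen (openBox y ℓ) := by
  rw [openBox_eq_pi]
  exact isOpen_set_pi finite_univ fun i _ => isOpen_Ioo

theorem volume_openBox (y : Fin n → ℝ) {ℓ : Fin n → ℝ} :
    volume (openBox y ℓ) = ∏ i, ENNReal.ofReal (2 * ℓ i) := by
  rw [openBox_eq_pi, Real.volume_pi_Ioo]
  refine Finset.prod_congr rfl fun i _ => ?_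
  congr 1; ring

theorem volume_openBox_ne_top (y ℓ : Fin n → ℝ) : volume (openBox y ℓ) ≠ ⊤ := by
  rw [volume_openBox]
  exact ENNReal.prod_ne_top fun i _ => ENNReal.ofReal_ne_top

theorem volume_openBox_prod_ne_top (y ℓ : Fin n → ℝ) (a b : ℝ) :
    volume (openBox y ℓ ×ˢ Ioc a b) ≠ ⊤ := by
  rw [Measure.volume_eq_prod, Measure.prod_prod, Real.volume_Ioc]
  exact ENNReal.mul_ne_top (volume_openBox_ne_top y ℓ) ENNReal.ofReal_ne_top

/-- The shrinking cylinders of the iteration. -/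
def iterBox (y L c : Fin n → ℝ) (τ c₀ s t₁ : ℝ) (j : ℕ) : Set (SpaceTime n) :=
  openBox y (fun i => L i * (1 + c i * (1 / 2) ^ j)) ×ˢ Ioc (s - τ * (1 + c₀ * (1 / 2) ^ j)) t₁

theorem measurableSet_iterBox (y L c : Fin n → ℝ) (τ c₀ s t₁ : ℝ) (j : ℕ) :
    MeasurableSet (iterBox y L c τ c₀ s t₁ j) :=
  (isOpen_openBox _ _).measurableSet.prod measurableSet_Ioc

set_option maxHeartbeats 400000 in
/-- De Giorgi iteration: if `U` is below `μ + M` only on a small portion of the large cylinder then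
`U ≥ μ + a M` in the small one. -/
theorem exists_critical_mass (hn : 2 ≤ n) {Λ : ℝ} (hΛ : 1 ≤ Λ) {p : Fin n → ℝ}
    (hp : ∀ i, 1 < p i) {a : ℝ} (ha : a ∈ Ioo (0 : ℝ) 1) {c : Fin n → ℝ} (hc : ∀ i, 0 < c i)
    {c₀ : ℝ} (hc₀ : 0 < c₀) :
    ∃ ν : ℝ, 0 < ν ∧ ∀ (U : SpaceTime n → ℝ) (V F : Fin n → SpaceTime n → ℝ) (y δ L : Fin n → ℝ)
      (s t₁ τ M μ : ℝ), 0 < M → 0 < τ → (∀ i, 0 < L i) → (∀ i, 0 ≤ δ i) → (∀ i, δ i ≤ M / L i) →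
      (∀ i, (M / L i) ^ p i = M ^ 2 / τ) → s - τ ≤ t₁ → t₁ < s →
      WeakSupersolution (openBox y (fun i => L i * (1 + c i)) ×ˢ Ioo (s - τ * (1 + c₀)) s) U V F →
      FluxBounds Λ p δ V F → (∀ i, Integrable fun z => |V i z| ^ p i) →
      (∀ i, Integrable fun z => |F i z| ^ (p i).conjExponent) →
      (∀ᵐ z, z ∈ openBox y (fun i => L i * (1 + c i)) ×ˢ Ioo (s - τ * (1 + c₀)) s → μ ≤ U z) →
      volume.real ({z | U z < μ + M} ∩ iterBox y L c τ c₀ s t₁ 0) ≤ ν * (τ * ∏ i, L i) →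
      ∀ᵐ z, z ∈ openBox y L ×ˢ Ioc (s - τ) t₁ → μ + a * M ≤ U z := by
  obtain ⟨D, hD0, hcut⟩ := exists_cutoff
  obtain ⟨N, hpN⟩ : ∃ N : ℕ, ∀ i, p i ≤ N := by
    obtain ⟨N, hN⟩ := exists_nat_ge (∑ i, p i)
    exact ⟨N, fun i => (Finset.single_le_sum (f := p) (fun j _ => by have := hp j; linarith)
      (Finset.mem_univ i)).trans hN⟩
  have hn0 : 0 < n := by omega
  have hnR : (0 : ℝ) < n := by exact_mod_cast hn0
  have hN1 : (1 : ℝ) < N := (hp ⟨0, hn0⟩).trans_le (hpN _)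
  have ha1 : 0 < 1 - a := by linarith [ha.2]
  -- At stage `j` the ramps have widths `L i * c i * h / 4` and `τ * c₀ * h / 4` with `h = (1 / 2) ^
  -- j`, so `κ * 2 ^ j` bounds the cut-off derivatives in all scaled directions.
  set κ : ℝ := 1 + ∑ i, 4 * D / c i + 4 * D / c₀ with hκ
  have hκi0 : ∀ i, 0 ≤ 4 * D / c i := fun i => by have := hc i; positivity
  have hκ00 : 0 ≤ 4 * D / c₀ := by positivity
  have hκs : 0 ≤ ∑ i, 4 * D / c i := Finset.sum_nonneg fun i _ => hκi0 i
  have hκ1 : 1 ≤ κ := by linarith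
  have hκi : ∀ i, 4 * D / c i ≤ κ := fun i => by
    have := Finset.single_le_sum (f := fun i => 4 * D / c i) (fun j _ => hκi0 j)
      (Finset.mem_univ i)
    linarith
  have hκ0 : 4 * D / c₀ ≤ κ := by linarith
  have hE0 : 0 < energyConst n N Λ := by unfold energyConst; positivity
  have hG0 : 0 < gradConst n N Λ := by unfold gradConst; positivity
  -- With `B = κ * 2 ^ j` and `η⁻¹ = 2 / (1 - a) * 2 ^ j`, the constant of the decay step factors as
  -- `K * b ^ j`.
  set K : ℝ := energyConst n N Λ * gradConst n N Λ * (κ ^ N) ^ 2 * (2 / (1 - a)) ^ 6 with hK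
  have hK0 : 0 < K := by positivity
  set b : ℝ := (2 ^ N) ^ 2 * 2 ^ 6 with hb
  have hb1 : 1 < b := by
    have : (1 : ℝ) ≤ (2 ^ N) ^ 2 := one_le_pow₀ (one_le_pow₀ (by norm_num))
    rw [hb]; linarith
  -- Solves `K * ν ^ (1 / n) = b ^ (-n)`, the threshold for fast geometric convergence.
  set ν : ℝ := (b ^ (-(1 / (1 / (n : ℝ)))) / K) ^ (n : ℝ) with hν
  have hbp : 0 < b ^ (-(1 / (1 / (n : ℝ)))) := Real.rpow_pos_of_pos (by linarith) _
  have hν0 : 0 < ν := Real.rpow_pos_of_pos (by positivity) _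
  refine ⟨ν, hν0, ?_⟩
  intro U V F y δ L s t₁ τ M μ hM hτ hL hδ0 hδ hscale hst hts hU hFB hVp hFp hμ hY0
  set Q := openBox y (fun i => L i * (1 + c i)) ×ˢ Ioo (s - τ * (1 + c₀)) s with hQ
  obtain ⟨u, v, f, Dm, D₀, S⟩ := hU.exists_smoothApproximation
    ((isOpen_openBox _ _).prod isOpen_Ioo) hμ hp hVp hFp
  have hP0 : 0 < τ * ∏ i, L i := mul_pos hτ (Finset.prod_pos fun i _ => hL i)
  -- The levels decrease from `μ + M` to `μ + a * M`, consecutive ones differing by `(1 - a) * (h /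
  -- 2) * M`.
  set k : ℕ → ℝ := fun j => μ + a * M + (1 - a) * (1 / 2) ^ j * M with hk
  set Bx := iterBox y L c τ c₀ s t₁ with hBx
  set Y : ℕ → ℝ := fun j => volume.real ({z | U z < k j} ∩ Bx j) / (τ * ∏ i, L i) with hYdef
  have hfin : ∀ j, volume (Bx j) ≠ ⊤ := fun j => volume_openBox_prod_ne_top _ _ _ _
  have hstep : ∀ j, Y (j + 1) ≤ K * b ^ j * Y j * Y j ^ (1 / (n : ℝ)) := by
    intro j
    set h : ℝ := (1 / 2) ^ j with hh
    have h0 : 0 < h := by positivity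
    have h1 : h ≤ 1 := pow_le_one₀ (by norm_num) (by norm_num)
    have hs1 : (1 / 2 : ℝ) ^ (j + 1) = h / 2 := by rw [pow_succ, ← hh]; ring
    -- The cut-off is one on the box of stage `j + 1` and is supported at the intermediate size `3 *
    -- h / 4`, strictly inside stage `j`. It falls to zero between `t₁` and `(t₁ + s) / 2`: after
    -- every time that is integrated, but before the top of `Q`.
    obtain ⟨ξ, hξC, hξc, hξ0, hξ1, hξs, hξone, hξx, hξt⟩ := hcut n y
      (fun i => L i * (1 + c i * (h / 2))) (fun i => L i * (1 + c i * (3 * h / 4)))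
      (s - τ * (1 + c₀ * (3 * h / 4))) (s - τ * (1 + c₀ * (h / 2))) t₁ ((t₁ + s) / 2)
      (fun i => by
        have := mul_pos (hL i) (mul_pos (hc i) h0)
        linarith)
      (by have := mul_pos hτ (mul_pos hc₀ h0); linarith) (by linarith)
    have hξQ : tsupport ξ ⊆ Q := by
      intro z hz
      obtain ⟨hz1, hz2⟩ := hξs hz
      refine ⟨fun i => (hz1 i).trans_lt ?_, ?_, ?_⟩
      · have := mul_pos (hL i) (hc i)
        have h3 : L i * c i * h ≤ L i * c i * 1 := mul_le_mul_of_nonneg_left h1 this.le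
        linarith
      · have := mul_pos hτ hc₀
        have h3 : τ * c₀ * h ≤ τ * c₀ * 1 := mul_le_mul_of_nonneg_left h1 this.le
        have := hz2.1
        linarith
      · have := hz2.2; linarith
    have hB1 : 1 ≤ κ * 2 ^ j := one_le_mul_of_one_le_of_one_le hκ1 (one_le_pow₀ (by norm_num))
    have hhj : h * 2 ^ j = 1 := by rw [hh, ← mul_pow]; norm_num
    have hη : 0 < (1 - a) * (h / 2) := by positivity
    have hmain := measure_decay_step (k := k j) (t₁ := t₁) (B := κ * 2 ^ j) (Bx := Bx j)
      (Bx' := Bx (j + 1)) (η := (1 - a) * (h / 2)) hn S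
      hU.integrable.aestronglyMeasurable.aemeasurable
      (fun i => (hU.integrable_grad i).aestronglyMeasurable.aemeasurable) hVp hμ hFB hΛ hM hτ hL hp
      hpN hB1 hδ0 hδ hscale hξC hξc hξ0 hξ1 hξQ ?_ ?_ (measurableSet_iterBox _ _ _ _ _ _ _ _)
      (hfin j) ?_ (measurableSet_iterBox _ _ _ _ _ _ _ _) (hfin _) ?_ ?_ ?_ hη ?_
    · have hkk : k j - (1 - a) * (h / 2) * M = k (j + 1) := by
        simp only [hk]; rw [hs1, ← hh]; ring
      rw [hkk] at hmain
      refine hmain.trans (le_of_eq ?_)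
      have e2 : ((1 - a) * (h / 2))⁻¹ = 2 / (1 - a) * 2 ^ j := by
        have : h = (2 ^ j)⁻¹ := by rw [hh, one_div, inv_pow]
        rw [this]; field_simp
      rw [e2]
      have e3 : ∀ x : ℝ, ((x ^ N) ^ 2 * x ^ 6) ^ j = ((x ^ j) ^ N) ^ 2 * (x ^ j) ^ 6 := fun x => by
        ring
      simp only [hYdef, hK, hb]
      rw [e3]
      generalize (2 : ℝ) ^ j = T
      ring_nf
    · intro z _ i
      refine (hξx z i).trans ?_
      have e1 : L i * (1 + c i * (3 * h / 4)) - L i * (1 + c i * (h / 2)) = L i * c i * h / 4 := by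
        ring
      rw [e1]
      have e2 : D / (L i * c i * h / 4) = 4 * D / c i * 2 ^ j / L i := by
        have := hL i; have := hc i
        have e3 : (2 : ℝ) ^ j = h⁻¹ := eq_inv_of_mul_eq_one_right hhj
        rw [e3]; field_simp
      rw [e2]
      have := hκi i; have := hL i
      gcongr
    · intro z hz
      refine (hξt z hz.2).trans ?_
      have e1 : s - τ * (1 + c₀ * (h / 2)) - (s - τ * (1 + c₀ * (3 * h / 4))) = τ * c₀ * h / 4 := by
        ring
      rw [e1]
      have e2 : D / (τ * c₀ * h / 4) = 4 * D / c₀ * 2 ^ j / τ := by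
        have e3 : (2 : ℝ) ^ j = h⁻¹ := eq_inv_of_mul_eq_one_right hhj
        rw [e3]; field_simp
      rw [e2]
      gcongr
    · intro z hz hzs
      obtain ⟨hz1, hz2⟩ := hξs hzs
      refine ⟨fun i => (hz1 i).trans_lt ?_, ?_, hz.2⟩
      · have := mul_pos (hL i) (mul_pos (hc i) h0)
        rw [← hh]; linarith
      · have := mul_pos hτ (mul_pos hc₀ h0)
        have := hz2.1
        rw [← hh]; linarith
    · exact fun z hz => ⟨mem_univ _, hz.2.2⟩
    · intro z hz
      refine hξone z (fun i => ?_) ⟨?_, hz.2.2⟩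
      · have := hz.1 i
        simp only [hs1] at this
        exact this.le
      · have := hz.2.1
        rw [hs1] at this
        exact this.le
    · simp only [hk]
      rw [← hh]
      have : (1 - a) * h * M ≤ (1 - a) * 1 * M := by gcongr
      linarith
    · exact mul_le_one₀ (by linarith [ha.1]) (by positivity) (by linarith)
  have hYlim : Tendsto Y atTop (𝓝 0) := by
    refine tendsto_zero_of_superlinear hK0.le hb1 (by positivity : 0 < 1 / (n : ℝ)) hν0.le ?_
      (fun j => div_nonneg measureReal_nonneg hP0.le) ?_ hstep
    · rw [hν, ← Real.rpow_mul (by positivity), mul_one_div_cancel hnR.ne', Real.rpow_one,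
        mul_div_cancel₀ _ hK0.ne']
    · rw [hYdef]
      simp only
      rw [div_le_iff₀ hP0]
      have : k 0 = μ + M := by simp only [hk, pow_zero]; ring
      rw [this]
      exact hY0
  set A := {z | U z < μ + a * M} ∩ openBox y L ×ˢ Ioc (s - τ) t₁ with hA
  -- The limiting bad set lies in every level set of the iteration, so its measure is at most the
  -- limit of theirs.
  have hsub : ∀ j, A ⊆ {z | U z < k j} ∩ Bx j := by
    rintro j z ⟨hz1, hz2, hz3⟩
    have hh0 : (0 : ℝ) < (1 / 2) ^ j := by positivity
    refine ⟨?_, fun i => (hz2 i).trans ?_, ?_, hz3.2⟩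
    · have : 0 < (1 - a) * (1 / 2) ^ j * M := by positivity
      exact lt_trans (show U z < μ + a * M from hz1) (by simp only [hk]; linarith)
    · have := mul_pos (hL i) (mul_pos (hc i) hh0)
      linarith
    · have := mul_pos hτ (mul_pos hc₀ hh0)
      have := hz3.1
      linarith
  have hA0 : volume.real A = 0 := by
    refine le_antisymm ?_ measureReal_nonneg
    have hlim := hYlim.mul_const (τ * ∏ i, L i)
    rw [zero_mul] at hlim
    refine ge_of_tendsto' hlim fun j => ?_
    simp only [hYdef]
    rw [div_mul_cancel₀ _ hP0.ne']
    exact measureReal_mono (hsub j) (measure_ne_top_of_subset inter_subset_right (hfin j))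
  have hA1 : volume A = 0 := by
    rw [measureReal_eq_zero_iff (measure_ne_top_of_subset inter_subset_right
      (volume_openBox_prod_ne_top _ _ _ _))] at hA0
    exact hA0
  have hA2 : ∀ᵐ z, z ∉ A := measure_eq_zero_iff_ae_notMem.1 hA1
  filter_upwards [hA2] with z hz hzB
  by_contra hlt
  exact hz ⟨not_le.1 hlt, hzB⟩

/-! ### Structure of the flux and localization of weak solutions -/

theorem abs_flux_le {p δ r : ℝ} : |flux p δ r| ≤ max (|r| - δ) 0 ^ (p - 1) := by
  have h0 : 0 ≤ max (|r| - δ) 0 ^ (p - 1) := Real.rpow_nonneg (le_max_right _ _) _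
  rw [flux, abs_mul, abs_of_nonneg h0, abs_div, abs_abs]
  exact mul_le_of_le_one_right h0 (div_self_le_one _)

theorem le_flux_mul {p δ r : ℝ} (hp : 1 < p) (hδ : 0 ≤ δ) :
    max (|r| - δ) 0 ^ p ≤ flux p δ r * r := by
  have h0 : 0 ≤ max (|r| - δ) 0 := le_max_right _ _
  have e : flux p δ r * r = max (|r| - δ) 0 ^ (p - 1) * |r| := by
    rw [flux, mul_assoc]
    congr 1
    rcases eq_or_ne r 0 with h | h
    · simp [h]
    · have := abs_pos.2 h
      rw [div_mul_eq_mul_div, ← abs_mul_abs_self, mul_div_assoc, div_self this.ne', mul_one]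
  have e2 : max (|r| - δ) 0 ^ p = max (|r| - δ) 0 ^ (p - 1) * max (|r| - δ) 0 := by
    rw [← Real.rpow_add_one' h0 (by linarith), sub_add_cancel]
  rw [e, e2]
  exact mul_le_mul_of_nonneg_left (max_le (by linarith) (abs_nonneg _)) (Real.rpow_nonneg h0 _)

theorem measurable_flux (p δ : ℝ) : Measurable (flux p δ) := by
  unfold flux
  exact ((((measurable_id.abs).sub_const δ).max measurable_const).pow_const (p - 1)).mul
    (measurable_id.div measurable_id.abs)

theorem flux_neg (p δ r : ℝ) : flux p δ (-r) = -flux p δ r := by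
  simp only [flux, abs_neg]; ring

theorem measurableSet_parCyl {Ω : Set (Fin n → ℝ)} (hΩ : IsOpen Ω) (T : ℝ) :
    MeasurableSet (parCyl Ω T) := hΩ.measurableSet.prod measurableSet_Ioo

section Restrict

variable {p δ : Fin n → ℝ} {Λ T : ℝ} {A : Fin n → SpaceTime n → ℝ} {Ω : Set (Fin n → ℝ)}
  {u : SpaceTime n → ℝ} {Du : Fin n → SpaceTime n → ℝ} {Q K : Set (SpaceTime n)}

/-- The flux `a_i (|∂_i u| - δ_i)_+^{p_i-1} ∂_i u / |∂_i u|`, extended by zero outside `Q`. -/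
noncomputable def localFlux (p δ : Fin n → ℝ) (A Du : Fin n → SpaceTime n → ℝ)
    (Q : Set (SpaceTime n)) (i : Fin n) : SpaceTime n → ℝ :=
  Q.indicator fun z => A i z * flux (p i) (δ i) (Du i z)

/-- Extension by zero preserves the bounds: at zero gradient the truncation by `δ i ≥ 0` vanishes,
and so do its positive powers. -/
theorem fluxBounds_localFlux (hΛ : 1 ≤ Λ) (hp : ∀ i, 1 < p i) (hδ : ∀ i, 0 ≤ δ i)
    (hΩ : IsOpen Ω) (hA : CoeffBounds Λ A Ω T) (hQ : Q ⊆ parCyl Ω T) :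
    FluxBounds Λ p δ (fun i => Q.indicator (Du i)) (localFlux p δ A Du Q) := by
  have hΛ0 : 0 < Λ := by linarith
  have h := ae_all_iff.2 fun i => (ae_restrict_iff' (measurableSet_parCyl hΩ T)).1 (hA i).2
  filter_upwards [h] with z hz i
  by_cases hzQ : z ∈ Q
  · obtain ⟨h1, h2⟩ := hz i (hQ hzQ)
    simp only [localFlux, indicator_of_mem hzQ]
    have hA0 : 0 < A i z := (inv_pos.2 hΛ0).trans_le h1
    constructor
    · rw [abs_mul, abs_of_pos hA0]
      exact mul_le_mul h2 abs_flux_le (abs_nonneg _) hΛ0.le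
    · rw [mul_assoc]
      exact mul_le_mul h1 (le_flux_mul (hp i) (hδ i)) (Real.rpow_nonneg (le_max_right _ _) _) hA0.le
  · simp only [localFlux, indicator_of_notMem hzQ, abs_zero, zero_sub, zero_mul]
    rw [max_eq_right (by linarith [hδ i]), Real.zero_rpow (by linarith [hp i]),
      Real.zero_rpow (by linarith [hp i])]
    simp

theorem MemLpLoc.integrableOn {X : Type*} [TopologicalSpace X] [MeasureSpace X] {f : X → ℝ}
    {U K : Set X} (hf : MemLpLoc f 1 U) (hK : IsCompact K) (hKU : K ⊆ U) :
    IntegrableOn f K := by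
  have := hf K hK hKU
  rwa [ENNReal.ofReal_one, memLp_one_iff_integrable] at this

theorem MemLpLoc.integrable_indicator_rpow {X : Type*} [TopologicalSpace X] [MeasureSpace X]
    {f : X → ℝ} {q : ℝ} {U K Q : Set X} (hq : 0 < q) (hf : MemLpLoc f q U) (hK : IsCompact K)
    (hKU : K ⊆ U) (hQ : MeasurableSet Q) (hQK : Q ⊆ K) :
    Integrable fun z => |Q.indicator f z| ^ q := by
  have h1 := (hf K hK hKU).integrable_norm_rpow (by simpa using hq) ENNReal.ofReal_ne_top
  rw [ENNReal.toReal_ofReal hq.le] at h1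
  have h2 : IntegrableOn (fun z => ‖f z‖ ^ q) Q := IntegrableOn.mono_set h1 hQK
  refine ((integrable_indicator_iff hQ).2 h2).congr (Eventually.of_forall fun z => ?_)
  by_cases hz : z ∈ Q
  · simp [indicator_of_mem hz]
  · simp [indicator_of_notMem hz, Real.zero_rpow hq.ne']

theorem aestronglyMeasurable_localFlux (hA : CoeffBounds Λ A Ω T)
    (hQm : MeasurableSet Q) (hQ : Q ⊆ parCyl Ω T) {i : Fin n} (hDu : IntegrableOn (Du i) Q) :
    AEStronglyMeasurable (localFlux p δ A Du Q i) := by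
  refine (aestronglyMeasurable_indicator_iff hQm).2 ?_
  have h1 : AEMeasurable (A i) (volume.restrict Q) :=
    (hA i).1.mono_measure (Measure.restrict_mono hQ le_rfl)
  exact (h1.mul ((measurable_flux _ _).comp_aemeasurable
    hDu.aestronglyMeasurable.aemeasurable)).aestronglyMeasurable

/-- Since `(q - 1) * q.conjExponent = q`, integrability of the gradient to the power `q` gives that
of the flux to the conjugate power. -/
theorem rpow_conjExponent_le_of_abs_le {r : ℝ} (hΛ : 1 ≤ Λ) {q d x X : ℝ} (hq : 1 < q) (hd : 0 ≤ d)
    (hX : X = max (|x| - d) 0) (h : |r| ≤ Λ * X ^ (q - 1)) :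
    |r| ^ q.conjExponent ≤ Λ ^ q.conjExponent * |x| ^ q := by
  have hX0 : 0 ≤ X := hX ▸ le_max_right _ _
  have hc : 0 < q.conjExponent := (Real.HolderConjugate.conjExponent hq).symm.pos
  refine (Real.rpow_le_rpow (abs_nonneg _) h hc.le).trans ?_
  rw [Real.mul_rpow (by linarith) (Real.rpow_nonneg hX0 _), ← Real.rpow_mul hX0]
  have e : (q - 1) * q.conjExponent = q := by
    rw [Real.conjExponent]; field_simp [(by linarith : q - 1 ≠ 0)]
  rw [e]
  refine mul_le_mul_of_nonneg_left (Real.rpow_le_rpow hX0 ?_ (by linarith))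
    (Real.rpow_nonneg (by linarith) _)
  rw [hX]
  exact max_le (by linarith) (abs_nonneg _)

theorem isTestFunction_timeSlice {φ : SpaceTime n → ℝ} (hφ : IsTestFunction φ (parCyl Ω T))
    (t : ℝ) : IsTestFunction (fun x => φ (x, t)) Ω := by
  refine ⟨hφ.smooth.comp (by fun_prop), hasCompactSupport_timeSlice hφ.compact t, ?_⟩
  have hc : IsClosed {x : Fin n → ℝ | (x, t) ∈ tsupport φ} :=
    (isClosed_tsupport φ).preimage (by fun_prop)
  have h1 : tsupport (fun x => φ (x, t)) ⊆ {x : Fin n → ℝ | (x, t) ∈ tsupport φ} :=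
    closure_minimal (fun x hx => subset_tsupport φ hx) hc
  exact fun x hx => (hφ.support (h1 hx)).1

theorem IsTestFunction.contDiff_one {E : Type*} [NormedAddCommGroup E] [NormedSpace ℝ E]
    {φ : E → ℝ} {U : Set E} (hφ : IsTestFunction φ U) : ContDiff ℝ 1 φ :=
  hφ.smooth.of_le (by exact_mod_cast le_top)

theorem integrable_mul_of_hasCompactSupport {g η : SpaceTime n → ℝ} (hg : Integrable g)
    (hη : Continuous η) (hηc : HasCompactSupport η) : Integrable fun z => g z * η z := by
  obtain ⟨C, hC⟩ := hηc.exists_bound_of_continuous hη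
  exact hg.mul_bdd hη.aestronglyMeasurable (Eventually.of_forall hC)

/-- Fubini reduces the space-time identity to the slicewise weak derivative at almost every time.
The indicators are invisible to test functions supported in `Q`, and slices outside `(0, T)`
contribute nothing. -/
theorem integral_indicator_mul_dx (hu : IsSpatialGradient p Ω T u Du)
    (hQ : Q ⊆ parCyl Ω T) (hU : Integrable (Q.indicator u))
    (i : Fin n) (hV : Integrable (Q.indicator (Du i)))
    {φ : SpaceTime n → ℝ} (hφ : IsTestFunction φ Q) :
    ∫ z, Q.indicator u z * dx i φ z = -∫ z, Q.indicator (Du i) z * φ z := by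
  have hφ1 := hφ.contDiff_one
  have hφd := hφ1.differentiable one_ne_zero
  have hφ' : IsTestFunction φ (parCyl Ω T) := ⟨hφ.smooth, hφ.compact, hφ.support.trans hQ⟩
  have i1 := integrable_mul_of_hasCompactSupport hU (continuous_dx i hφ1)
    (hasCompactSupport_dx i hφ.compact)
  have i2 := integrable_mul_of_hasCompactSupport hV hφ1.continuous hφ.compact
  have e1 : ∀ (g : SpaceTime n → ℝ) z, Q.indicator g z * dx i φ z = g z * dx i φ z := by
    intro g z
    by_cases hz : z ∈ Q
    · rw [indicator_of_mem hz]
    · rw [dx_eq_zero i fun h => hz (hφ.support h), mul_zero, mul_zero]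
  have e2 : ∀ (g : SpaceTime n → ℝ) z, Q.indicator g z * φ z = g z * φ z := by
    intro g z
    by_cases hz : z ∈ Q
    · rw [indicator_of_mem hz]
    · rw [image_eq_zero_of_notMem_tsupport fun h => hz (hφ.support h), mul_zero, mul_zero]
  rw [Measure.volume_eq_prod] at i1 i2 ⊢
  rw [integral_prod_symm _ i1, integral_prod_symm _ i2, ← integral_neg]
  refine integral_congr_ae ?_
  have hw := (ae_restrict_iff' measurableSet_Ioo).1 hu.weak
  filter_upwards [hw] with t ht
  simp only [e1, e2]
  have hts := isTestFunction_timeSlice hφ' t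
  by_cases hT : t ∈ Ioo 0 T
  · have h1 := ((ht hT i).2.2 _ hts)
    simp only [fderiv_timeSlice hφd] at h1
    rw [setIntegral_eq_integral_of_forall_compl_eq_zero,
      setIntegral_eq_integral_of_forall_compl_eq_zero] at h1
    · exact h1
    · intro x hx
      rw [image_eq_zero_of_notMem_tsupport fun h => hx (hφ'.support h).1, mul_zero]
    · intro x hx
      rw [dx_eq_zero i fun h => hx (hφ'.support h).1, mul_zero]
  · have h3 : ∀ x, (x, t) ∉ tsupport φ := fun x h => hT (hφ'.support h).2
    simp only [dx_eq_zero i (h3 _), image_eq_zero_of_notMem_tsupport (h3 _), mul_zero,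
      integral_zero, neg_zero]

theorem integral_local_weakForm {φ : SpaceTime n → ℝ} (hQ : Q ⊆ parCyl Ω T)
    (hφ : IsTestFunction φ Q) :
    ∫ z, (Q.indicator u z * dt φ z - ∑ i, localFlux p δ A Du Q i z * dx i φ z) =
      weakForm p δ A Ω T u Du φ := by
  rw [weakForm, setIntegral_eq_integral_of_forall_compl_eq_zero]
  · refine integral_congr_ae (Eventually.of_forall fun z => ?_)
    by_cases hz : z ∈ Q
    · simp only [localFlux, indicator_of_mem hz, dx, dt]
    · have h : z ∉ tsupport φ := fun h => hz (hφ.support h)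
      have h1 := fun i => dx_eq_zero i h
      have h2 := dt_eq_zero h
      simp only [h1, h2, mul_zero, Finset.sum_const_zero, sub_zero]
      simp only [dx, dt] at h1 h2
      rw [h2, Finset.sum_eq_zero fun i _ => mul_eq_zero_of_right _ (h1 i), mul_zero, sub_zero]
  · intro z hz
    have h : z ∉ tsupport φ := fun h => hz (hQ (hφ.support h))
    have h1 := fun i => dx_eq_zero i h
    have h2 := dt_eq_zero h
    simp only [dx, dt] at h1 h2
    simp [h1, h2]

/-- Localization of a weak supersolution to an open set with compact closure. -/
theorem exists_weakSupersolution (hΛ : 1 ≤ Λ) (hp : ∀ i, 1 < p i) (hδ : ∀ i, 0 ≤ δ i)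
    (hΩ : IsOpen Ω) (hA : CoeffBounds Λ A Ω T) (hQo : IsOpen Q) (hK : IsCompact K) (hQK : Q ⊆ K)
    (hKΩ : K ⊆ parCyl Ω T) (hu : IsSpatialGradient p Ω T u Du)
    (hsup : ∀ φ : SpaceTime n → ℝ, IsTestFunction φ (parCyl Ω T) → (∀ z, 0 ≤ φ z) →
        weakForm p δ A Ω T u Du φ ≤ 0) :
    ∃ V F, WeakSupersolution Q (Q.indicator u) V F ∧ FluxBounds Λ p δ V F ∧
      (∀ i, Integrable fun z => |V i z| ^ p i) ∧
      ∀ i, Integrable fun z => |F i z| ^ (p i).conjExponent := by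
  have hQm := hQo.measurableSet
  have hQΩ : Q ⊆ parCyl Ω T := hQK.trans hKΩ
  have hFB := fluxBounds_localFlux (Du := Du) hΛ hp hδ hΩ hA hQΩ
  have hU : Integrable (Q.indicator u) :=
    (integrable_indicator_iff hQm).2 ((hu.memL1.integrableOn hK hKΩ).mono_set hQK)
  have hDuQ : ∀ i, IntegrableOn (Du i) Q := fun i =>
    ((hu.grad_memL1 i).integrableOn hK hKΩ).mono_set hQK
  have hV : ∀ i, Integrable (Q.indicator (Du i)) := fun i =>
    (integrable_indicator_iff hQm).2 (hDuQ i)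
  have hVp : ∀ i, Integrable fun z => |Q.indicator (Du i) z| ^ p i := fun i =>
    (hu.grad_memLp i).integrable_indicator_rpow (by linarith [hp i]) hK hKΩ hQm hQK
  have hFm : ∀ i, AEStronglyMeasurable (localFlux p δ A Du Q i) := fun i =>
    aestronglyMeasurable_localFlux hA hQm hQΩ (hDuQ i)
  have hFp : ∀ i, Integrable fun z => |localFlux p δ A Du Q i z| ^ (p i).conjExponent := by
    intro i
    refine ((hVp i).const_mul (Λ ^ (p i).conjExponent)).mono'
      (((hFm i).aemeasurable.norm.pow_const _).aestronglyMeasurable) ?_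
    filter_upwards [hFB] with z hz
    rw [Real.norm_eq_abs, abs_of_nonneg (Real.rpow_nonneg (abs_nonneg _) _)]
    exact rpow_conjExponent_le_of_abs_le hΛ (hp i) (hδ i) rfl (hz i).1
  -- `Q` has finite measure, so `|F| ≤ 1 + |F| ^ p'` on `Q` suffices.
  have hF : ∀ i, Integrable (localFlux p δ A Du Q i) := by
    intro i
    have h1 : Integrable (Q.indicator (1 : SpaceTime n → ℝ)) :=
      (integrable_indicator_iff hQm).2
        (integrableOn_const (measure_ne_top_of_subset hQK hK.measure_ne_top))
    refine (h1.add (hFp i)).mono' (hFm i) (Eventually.of_forall fun z => ?_)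
    rw [Real.norm_eq_abs, Pi.add_apply]
    by_cases hz : z ∈ Q
    · rw [indicator_of_mem hz]
      exact le_one_add_rpow (abs_nonneg _) (Real.HolderConjugate.conjExponent (hp i)).symm.lt
    · have : localFlux p δ A Du Q i z = 0 := indicator_of_notMem hz _
      rw [this, abs_zero, indicator_of_notMem hz, zero_add]
      exact Real.rpow_nonneg le_rfl _
  refine ⟨fun i => Q.indicator (Du i), localFlux p δ A Du Q, ⟨hU, hV, hF, ?_, ?_⟩, hFB, hVp, hFp⟩
  · exact fun i φ hφ => integral_indicator_mul_dx hu hQΩ hU i (hV i) hφ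
  · intro φ hφ hφ0
    rw [integral_local_weakForm hQΩ hφ]
    exact hsup φ ⟨hφ.smooth, hφ.compact, hφ.support.trans hQΩ⟩ hφ0

end Restrict

/-! ### Change of sign -/

section Negation

variable {p δ : Fin n → ℝ} {T : ℝ} {A : Fin n → SpaceTime n → ℝ} {Ω : Set (Fin n → ℝ)}
  {u : SpaceTime n → ℝ} {Du : Fin n → SpaceTime n → ℝ}

theorem MemLpLoc.neg {X : Type*} [TopologicalSpace X] [MeasureSpace X] {f : X → ℝ} {q : ℝ}
    {U : Set X} (hf : MemLpLoc f q U) : MemLpLoc (fun x => -f x) q U :=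
  fun K hK hKU => (hf K hK hKU).neg

theorem IsSpatialGradient.neg (hu : IsSpatialGradient p Ω T u Du) :
    IsSpatialGradient p Ω T (fun z => -u z) (fun i z => -Du i z) where
  memL1 := hu.memL1.neg
  grad_memL1 i := (hu.grad_memL1 i).neg
  weak := by
    filter_upwards [hu.weak] with t ht i
    obtain ⟨h1, h2, h3⟩ := ht i
    refine ⟨h1.neg, h2.neg, fun φ hφ => ?_⟩
    simp only [neg_mul, integral_neg, h3 φ hφ]
  grad_memLp i := (hu.grad_memLp i).neg

theorem weakForm_neg (φ : SpaceTime n → ℝ) :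
    weakForm p δ A Ω T (fun z => -u z) (fun i z => -Du i z) φ = -weakForm p δ A Ω T u Du φ := by
  simp only [weakForm, flux_neg]
  rw [← integral_neg]
  congr 1
  ext z
  simp only [mul_neg, neg_mul, Finset.sum_neg_distrib]
  ring

/-- The flux is odd in the gradient, so the weak form changes sign under `u ↦ -u`. -/
theorem IsSubsolution.neg (hu : IsSubsolution p δ A Ω T u) :
    IsSupersolution p δ A Ω T (fun z => -u z) := by
  obtain ⟨h1, Du, h2, h3⟩ := hu
  refine ⟨h1.neg, fun i z => -Du i z, h2.neg, fun φ hφ hφ0 => ?_⟩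
  rw [weakForm_neg]
  linarith [h3 φ hφ hφ0]

end Negation

/-! ### Geometry of the intrinsic cylinders -/

theorem pbar_pos (hn : 0 < n) {p : Fin n → ℝ} (hp : ∀ i, 1 < p i) : 0 < pbar p := by
  have : (0 : ℝ) < n := by exact_mod_cast hn
  have hs : 0 < ∑ i, 1 / p i := Finset.sum_pos (fun i _ => by have := hp i; positivity)
    ⟨⟨0, hn⟩, Finset.mem_univ _⟩
  unfold pbar
  positivity

/-- The half sides of the intrinsic cube. -/
noncomputable def halfSide (p : Fin n → ℝ) (M ρ : ℝ) (i : Fin n) : ℝ :=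
  M ^ ((p i - 2) / p i) * ρ ^ (pbar p / p i)

theorem cyl_eq (p : Fin n → ℝ) (M ρ : ℝ) (y : Fin n → ℝ) (s : ℝ) :
    cyl p M ρ y s = openBox y (halfSide p M ρ) ×ˢ Ioc (s - ρ ^ pbar p) s := rfl

/-- The factor is written as `1 + c i` so that the doubled cylinder is stage zero of the iteration.
-/
theorem halfSide_two_mul (p : Fin n → ℝ) (M : ℝ) {ρ : ℝ} (hρ : 0 < ρ) :
    halfSide p M (2 * ρ) = fun i => halfSide p M ρ i * (1 + (2 ^ (pbar p / p i) - 1)) := by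
  ext i
  rw [halfSide, halfSide, Real.mul_rpow (by norm_num) hρ.le]
  ring

theorem two_mul_rpow_pbar (p : Fin n → ℝ) {ρ : ℝ} (hρ : 0 < ρ) :
    (2 * ρ) ^ pbar p = ρ ^ pbar p * (1 + (2 ^ pbar p - 1)) := by
  rw [Real.mul_rpow (by norm_num) hρ.le]
  ring

/-- The defining property of the intrinsic scaling: the right side does not depend on `i`, so all
directions balance the time scale. -/
theorem div_halfSide_rpow {p : Fin n → ℝ} {M ρ : ℝ} (hM : 0 < M) (hρ : 0 < ρ) {i : Fin n}
    (hp : 0 < p i) : (M / halfSide p M ρ i) ^ p i = M ^ 2 / ρ ^ pbar p := by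
  have e : (halfSide p M ρ i) ^ p i = M ^ (p i - 2) * ρ ^ pbar p := by
    rw [halfSide, Real.mul_rpow (by positivity) (by positivity), ← Real.rpow_mul hM.le,
      ← Real.rpow_mul hρ.le, div_mul_cancel₀ _ hp.ne', div_mul_cancel₀ _ hp.ne']
  have h0 : 0 < halfSide p M ρ i := by unfold halfSide; positivity
  rw [Real.div_rpow hM.le h0.le, e, Real.rpow_sub hM, Real.rpow_two]
  have := Real.rpow_pos_of_pos hM (p i)
  field_simp

/-- Compare powers: `δ i ^ p i ≤ Γ ≤ M ^ 2 / τ`, and the last term is `(M / L i) ^ p i`. -/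
theorem le_div_halfSide {p δ : Fin n → ℝ} {M ρ : ℝ} (hM : 0 < M) (hρ : 0 < ρ) (hδ : ∀ i, 0 ≤ δ i)
    (h : Gam p δ * ρ ^ pbar p < M ^ 2) {i : Fin n} (hp : 0 < p i) :
    δ i ≤ M / halfSide p M ρ i := by
  have h0 : 0 < halfSide p M ρ i := by unfold halfSide; positivity
  have h1 : δ i ^ p i ≤ Gam p δ :=
    Finset.single_le_sum (f := fun i => δ i ^ p i) (fun j _ => Real.rpow_nonneg (hδ j) _)
      (Finset.mem_univ i)
  have hτ : 0 < ρ ^ pbar p := Real.rpow_pos_of_pos hρ _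
  have h2 : Gam p δ ≤ M ^ 2 / ρ ^ pbar p := by rw [le_div_iff₀ hτ]; exact h.le
  rw [← Real.rpow_le_rpow_iff (hδ i) (by positivity) hp, div_halfSide_rpow hM hρ hp]
  exact h1.trans h2

theorem isCompact_closure_cyl (p : Fin n → ℝ) (M ρ : ℝ) (y : Fin n → ℝ) (s : ℝ) :
    IsCompact (closure (cyl p M ρ y s)) := by
  refine (isCompact_Icc.prod isCompact_Icc : IsCompact
    (Icc (fun i => y i - halfSide p M ρ i) (fun i => y i + halfSide p M ρ i) ×ˢ
      Icc (s - ρ ^ pbar p) s)).closure_of_subset ?_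
  rintro z ⟨h1, h2⟩
  refine ⟨⟨fun i => ?_, fun i => ?_⟩, Ioc_subset_Icc_self h2⟩
  · have := (abs_lt.1 (h1 i)).1
    simp only [halfSide]; linarith
  · have := (abs_lt.1 (h1 i)).2
    simp only [halfSide]; linarith

theorem ae_snd_ne (s : ℝ) : ∀ᵐ z : SpaceTime n, z.2 ≠ s := by
  have h : volume ((univ : Set (Fin n → ℝ)) ×ˢ ({s} : Set ℝ)) = 0 := by
    rw [Measure.volume_eq_prod, Measure.prod_prod, Real.volume_singleton, mul_zero]
  filter_upwards [measure_eq_zero_iff_ae_notMem.1 h] with z hz h2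
  exact hz ⟨mem_univ _, h2⟩

theorem volume_cyl {p : Fin n → ℝ} {M ρ : ℝ} (hM : 0 < M) (hρ : 0 < ρ) (y : Fin n → ℝ) (s : ℝ) :
    volume (cyl p M ρ y s) =
      ENNReal.ofReal ((∏ i, 2 * halfSide p M ρ i) * ρ ^ pbar p) := by
  have h0 : ∀ i, 0 ≤ 2 * halfSide p M ρ i := fun i => by unfold halfSide; positivity
  rw [cyl_eq, Measure.volume_eq_prod, Measure.prod_prod, volume_openBox, Real.volume_Ioc,
    ← ENNReal.ofReal_prod_of_nonneg fun i _ => h0 i,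
    ← ENNReal.ofReal_mul (Finset.prod_nonneg fun i _ => h0 i), sub_sub_cancel]

/-! ### The critical mass lemma -/

/-- Critical mass lemma for supersolutions. -/
theorem critical_mass_supersolution (hn : 2 ≤ n) {Λ : ℝ} (hΛ : 1 ≤ Λ) {p : Fin n → ℝ}
    (hp : ∀ i, 1 < p i) {a : ℝ} (ha : a ∈ Ioo (0 : ℝ) 1) :
    ∃ ν ∈ Ioo (0 : ℝ) 1,
      ∀ (Ω : Set (Fin n → ℝ)) (T : ℝ) (δ : Fin n → ℝ) (A : Fin n → SpaceTime n → ℝ)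
        (u : SpaceTime n → ℝ) (y : Fin n → ℝ) (s M ρ μ : ℝ),
        IsOpen Ω → (∀ i, 0 ≤ δ i) → CoeffBounds Λ A Ω T → IsSupersolution p δ A Ω T u →
        0 < M → 0 < ρ → closure (cyl p M (2 * ρ) y s) ⊆ parCyl Ω T →
        (∀ᵐ z ∂(volume.restrict (cyl p M (2 * ρ) y s)), μ ≤ u z) →
        volume ({z | u z ≤ μ + M} ∩ cyl p M (2 * ρ) y s)
          ≤ ENNReal.ofReal ν * volume (cyl p M (2 * ρ) 0 0) →
        M ^ 2 > Gam p δ * ρ ^ pbar p →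
        ∀ᵐ z ∂(volume.restrict (cyl p M ρ y s)), μ + a * M ≤ u z := by
  have hpb := pbar_pos (by omega : 0 < n) hp
  set c : Fin n → ℝ := fun i => 2 ^ (pbar p / p i) - 1 with hc
  set c₀ : ℝ := 2 ^ pbar p - 1 with hc₀
  have hcpos : ∀ i, 0 < c i := fun i => by
    have hpi := hp i
    have := Real.one_lt_rpow (x := 2) (by norm_num) (by positivity : 0 < pbar p / p i)
    simp only [hc]; linarith
  have hc₀pos : 0 < c₀ := by
    have := Real.one_lt_rpow (x := 2) (by norm_num) hpb
    rw [hc₀]; linarith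
  obtain ⟨ν₀, hν₀, hmain⟩ := exists_critical_mass hn hΛ hp ha hcpos hc₀pos
  -- The doubled cylinder has measure `W * (τ * ∏ L i)`; `W` converts between the two normalizations
  -- of the smallness condition.
  set W : ℝ := (∏ i, 2 * (1 + c i)) * (1 + c₀) with hW
  have hW0 : 0 < W := mul_pos (Finset.prod_pos fun i _ => by have := hcpos i; positivity)
    (by positivity)
  refine ⟨min (1 / 2) (ν₀ / W), ⟨lt_min (by norm_num) (by positivity),
    (min_le_left _ _).trans_lt (by norm_num)⟩, ?_⟩
  intro Ω T δ A u y s M ρ μ hΩ hδ hA hu hM hρ hcl hμ hvol hΓ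
  obtain ⟨-, Du, hgrad, hsup⟩ := hu
  set L := halfSide p M ρ with hLdef
  set τ := ρ ^ pbar p with hτdef
  have hτ : 0 < τ := Real.rpow_pos_of_pos hρ _
  have hL : ∀ i, 0 < L i := fun i => by rw [hLdef, halfSide]; positivity
  have hp0 : ∀ i, 0 < p i := fun i => by linarith [hp i]
  have hbig : cyl p M (2 * ρ) y s =
      openBox y (fun i => L i * (1 + c i)) ×ˢ Ioc (s - τ * (1 + c₀)) s := by
    rw [cyl_eq, halfSide_two_mul p M hρ, two_mul_rpow_pbar p hρ]
  have hbigm : MeasurableSet (cyl p M (2 * ρ) y s) := by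
    rw [hbig]; exact (isOpen_openBox _ _).measurableSet.prod measurableSet_Ioc
  set Q := openBox y (fun i => L i * (1 + c i)) ×ˢ Ioo (s - τ * (1 + c₀)) s with hQ
  have hQo : IsOpen Q := (isOpen_openBox _ _).prod isOpen_Ioo
  have hQcyl : Q ⊆ cyl p M (2 * ρ) y s := by
    rw [hbig]; exact prod_mono_right Ioo_subset_Ioc_self
  obtain ⟨V, F, hU, hFB, hVp, hFp⟩ := exists_weakSupersolution (Q := Q) hΛ hp hδ hΩ hA hQo
    (isCompact_closure_cyl p M (2 * ρ) y s) (hQcyl.trans subset_closure) hcl hgrad hsup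
  have hμ' : ∀ᵐ z, z ∈ Q → μ ≤ Q.indicator u z := by
    filter_upwards [(ae_restrict_iff' hbigm).1 hμ] with z hz hzQ
    rw [indicator_of_mem hzQ]
    exact hz (hQcyl hzQ)
  -- For `t₁ < s` the starting box lies in the open cylinder `Q`, where the extension by zero agrees
  -- with `u`.
  have hvol' : ∀ t₁ < s, volume.real ({z | Q.indicator u z < μ + M} ∩ iterBox y L c τ c₀ s t₁ 0) ≤
      ν₀ * (τ * ∏ i, L i) := by
    intro t₁ ht₁
    have hsub : {z | Q.indicator u z < μ + M} ∩ iterBox y L c τ c₀ s t₁ 0 ⊆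
        {z | u z ≤ μ + M} ∩ cyl p M (2 * ρ) y s := by
      rintro z ⟨hz1, hz2⟩
      simp only [iterBox, pow_zero, mul_one] at hz2
      have hzQ : z ∈ Q := ⟨hz2.1, hz2.2.1, hz2.2.2.trans_lt ht₁⟩
      refine ⟨?_, hQcyl hzQ⟩
      have h3 : Q.indicator u z < μ + M := hz1
      rw [indicator_of_mem hzQ] at h3
      exact h3.le
    have h1 := (measure_mono hsub).trans hvol
    rw [volume_cyl hM (by positivity), halfSide_two_mul p M hρ, two_mul_rpow_pbar p hρ,
      ← ENNReal.ofReal_mul (le_min (by norm_num) (by positivity))] at h1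
    have e : (∏ i, 2 * (halfSide p M ρ i * (1 + (2 ^ (pbar p / p i) - 1)))) *
        (ρ ^ pbar p * (1 + (2 ^ pbar p - 1))) = W * (τ * ∏ i, L i) := by
      have e1 : ∀ i, 2 * (halfSide p M ρ i * (1 + (2 ^ (pbar p / p i) - 1))) =
          (2 * (1 + c i)) * L i := fun i => by simp only [hc, hLdef]; ring
      simp only [e1]
      rw [Finset.prod_mul_distrib, hW]
      ring
    rw [e] at h1
    have hX : 0 < τ * ∏ i, L i := mul_pos hτ (Finset.prod_pos fun i _ => hL i)
    refine (ENNReal.toReal_le_of_le_ofReal (by positivity) h1).trans ?_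
    calc min (1 / 2) (ν₀ / W) * (W * (τ * ∏ i, L i))
        ≤ ν₀ / W * (W * (τ * ∏ i, L i)) := by gcongr; exact min_le_right _ _
      _ = _ := by field_simp
  -- The truncation times `s - τ / (m + 1)` increase to `s`; countably many null sets and the null
  -- top face are discarded at the end.
  have hconc : ∀ m : ℕ, ∀ᵐ z, z ∈ openBox y L ×ˢ Ioc (s - τ) (s - τ / (m + 1)) →
      μ + a * M ≤ Q.indicator u z := by
    intro m
    have hm : 0 < τ / ((m : ℝ) + 1) := by positivity
    have hm2 : τ / ((m : ℝ) + 1) ≤ τ := div_le_self hτ.le (by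
      have : (0 : ℝ) ≤ m := Nat.cast_nonneg m
      linarith)
    exact hmain (Q.indicator u) V F y δ L s (s - τ / (m + 1)) τ M μ hM hτ hL hδ
      (fun i => le_div_halfSide hM hρ hδ hΓ (hp0 i))
      (fun i => div_halfSide_rpow hM hρ (hp0 i)) (by linarith) (by linarith)
      hU hFB hVp hFp hμ' (hvol' _ (by linarith))
  have hsm : MeasurableSet (cyl p M ρ y s) := by
    rw [cyl_eq]; exact (isOpen_openBox _ _).measurableSet.prod measurableSet_Ioc
  rw [ae_restrict_iff' hsm]
  filter_upwards [ae_all_iff.2 hconc, ae_snd_ne s] with z hz hzs hzc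
  rw [cyl_eq] at hzc
  obtain ⟨h1, h2, h3⟩ := hzc
  have h4 : 0 < s - z.2 := sub_pos.2 (lt_of_le_of_ne h3 hzs)
  have hzQ : z ∈ Q := by
    refine ⟨fun i => (h1 i).trans ?_, ?_, lt_of_le_of_ne h3 hzs⟩
    · have := mul_pos (hL i) (hcpos i)
      linarith
    · have := mul_pos hτ hc₀pos
      linarith
  obtain ⟨m, hm⟩ := exists_nat_gt (τ / (s - z.2))
  have h5 : τ / ((m : ℝ) + 1) ≤ s - z.2 := by
    rw [div_lt_iff₀ h4] at hm
    rw [div_le_iff₀ (by positivity)]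
    linarith
  have := hz m ⟨h1, h2, by linarith⟩
  rwa [indicator_of_mem hzQ] at this

end CritMass

theorem mainTheorem4 (n : ℕ) (hn : 2 ≤ n) (Λ : ℝ) (hΛ : 1 ≤ Λ)
    (p : Fin n → ℝ) (hp : ∀ i, 1 < p i) (a : ℝ) (ha : a ∈ Ioo (0 : ℝ) 1) :
    (∃ ν ∈ Ioo (0 : ℝ) 1,
      ∀ (Ω : Set (Fin n → ℝ)) (T : ℝ) (δ : Fin n → ℝ) (A : Fin n → SpaceTime n → ℝ)
        (u : SpaceTime n → ℝ) (y : Fin n → ℝ) (s M ρ μ : ℝ),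
        IsOpen Ω → IsConnected Ω → Bornology.IsBounded Ω → 0 < T → (∀ i, 0 ≤ δ i) →
        CoeffBounds Λ A Ω T →
        IsSupersolution p δ A Ω T u → LocBddBelow u (parCyl Ω T) →
        0 < M → 0 < ρ → closure (cyl p M (2 * ρ) y s) ⊆ parCyl Ω T →
        (∀ᵐ z ∂(volume.restrict (cyl p M (2 * ρ) y s)), μ ≤ u z) →
        volume ({z | u z ≤ μ + M} ∩ cyl p M (2 * ρ) y s)
          ≤ ENNReal.ofReal ν * volume (cyl p M (2 * ρ) 0 0) →
        M ^ 2 > Gam p δ * ρ ^ pbar p →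
        ∀ᵐ z ∂(volume.restrict (cyl p M ρ y s)), μ + a * M ≤ u z) ∧
    (∃ ν ∈ Ioo (0 : ℝ) 1,
      ∀ (Ω : Set (Fin n → ℝ)) (T : ℝ) (δ : Fin n → ℝ) (A : Fin n → SpaceTime n → ℝ)
        (u : SpaceTime n → ℝ) (y : Fin n → ℝ) (s M ρ μ : ℝ),
        IsOpen Ω → IsConnected Ω → Bornology.IsBounded Ω → 0 < T → (∀ i, 0 ≤ δ i) →
        CoeffBounds Λ A Ω T →
        IsSubsolution p δ A Ω T u → LocBddAbove u (parCyl Ω T) →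
        0 < M → 0 < ρ → closure (cyl p M (2 * ρ) y s) ⊆ parCyl Ω T →
        (∀ᵐ z ∂(volume.restrict (cyl p M (2 * ρ) y s)), u z ≤ μ) →
        volume ({z | u z ≥ μ - M} ∩ cyl p M (2 * ρ) y s)
          ≤ ENNReal.ofReal ν * volume (cyl p M (2 * ρ) 0 0) →
        M ^ 2 > Gam p δ * ρ ^ pbar p →
        ∀ᵐ z ∂(volume.restrict (cyl p M ρ y s)), u z ≤ μ - a * M) := by
  obtain ⟨ν, hν, h⟩ := critical_mass_supersolution hn hΛ hp ha
  refine ⟨⟨ν, hν, ?_⟩, ⟨ν, hν, ?_⟩⟩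
  · intro Ω T δ A u y s M ρ μ hΩ _ _ _ hδ hA hu _ hM hρ hcl hμ hvol hΓ
    exact h Ω T δ A u y s M ρ μ hΩ hδ hA hu hM hρ hcl hμ hvol hΓ
  · intro Ω T δ A u y s M ρ μ hΩ _ _ _ hδ hA hu _ hM hρ hcl hμ hvol hΓ
    have hset : {z : SpaceTime n | -u z ≤ -μ + M} = {z | u z ≥ μ - M} := by
      ext z
      exact ⟨fun (h : -u z ≤ -μ + M) => show μ - M ≤ u z by linarith,
        fun (h : μ - M ≤ u z) => show -u z ≤ -μ + M by linarith⟩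
    -- The function `-u` with lower bound `-μ` satisfies the first part, so the same `ν` serves both
    -- parts.
    have := h Ω T δ A (fun z => -u z) y s M ρ (-μ) hΩ hδ hA hu.neg hM hρ hcl
      (hμ.mono fun z hz => neg_le_neg hz) (by rw [hset]; exact hvol) hΓ
    filter_upwards [this] with z hz
    linarith
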